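/- **Definitions.** A homomorphism $p:\widetilde G\to G$ of topological groups is a *connective covering* if it is a covering of a union of connected components of $G$ (so $p$ need not be surjective) and the preimage of the identity component $G_e$ is connected. A *planar Lie group* is a connective covering $p:G\to O(2)$. Write $e:\mathbb R\to G$ for the continuous one-parameter subgroup with $p(e(t))=$ rotation by $2\pi t$, and $\mathfrak G_0=p^{-1}(O(1))$, where $O(1)\subset O(2)$ is the stabilizer of $1\in S^1$. *The crossed simplicial group $\Delta\mathfrak G$ of $G$.* Its objects are $[n]$, $n\ge 0$. A morphism $[m]\to[n]$ is a class of pairs $(w,f)$ (standing for $w\circ f$), where $w\in\mathfrak G_0$ and $f:\mathbb Z\to\mathbb Z$ is monotone with $f(l+m+1)=f(l)+n+1$, under the identification $(w\,e(k),f)=(w,f+k(n+1))$, $k\in\mathbb Z$. The composite is $(w',f')\circ(w,f)=(w'w,\,f'^{\,w}\circ f)$, where $f'^{\,w}=f'$ if $\det p(w)=1$ and $f'^{\,w}(l)=-f'(-l)$ if $\det p(w)=-1$. The simplex category $\Delta$ embeds by periodic extension of monotone maps, and every morphism is uniquely $\phi\circ g$ with $\phi$ in $\Delta$ and $g\in\mathfrak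 G_m:=\mathrm{Aut}([m])$. The group $\mathfrak G_n$ is $p^{-1}(D_{n+1})$, with $w\circ(l\mapsto l+j)$ corresponding to $w\,e(j/(n+1))$. For $SO(2)$, $O(2)$, their universal, $N$-fold, $\mathrm{Pin}^{+}_N$ and $\mathrm{Pin}^-_{2N}$ coverings these are the cyclic, dihedral, paracyclic, paradihedral, $N$-cyclic, $N$-dihedral and $N$-quaternionic categories. The action of morphisms on $\mathrm{Hom}([0],[n])/\mathfrak G_0=\{0,\dots,n\}$ gives $\lambda_n:\mathfrak G_n\to S_{n+1}$. *Structured sets.* A $\Delta\mathfrak G$-structured set is a finite set $I$ with $n+1\geq 1$ elements, a right $\mathfrak G_n$-torsor $\mathcal O(I)$ and a $\lambda_n$-equivariant map $\mathcal O(I)\to\mathrm{Isom}(\{0,\dots,n\},I)$. A morphism $(I',\mathcal O(I'))\to(I,\mathcal O(I))$ is a family $\psi_{f,f'}\in\mathrm{Hom}_{\Delta\mathfrak G}([n'],[n])$, $f\in\mathcal O(I)$, $f'\in\mathcal O(I')$, with $\psi_{fg,f'g'}=g^{-1}\psi_{f,f'}g'$; composition is $(\psi\psi')_{f,f''}=\psi_{f,f'}\psi'_{f',f''}$.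 Let $\mathcal G$ be the resulting category and $\lambda_{\mathcal G}:\mathcal G\to\mathrm{FSet}$, $(I,\mathcal O(I))\mapsto I$, the forgetful functor to nonempty finite sets. *Structured marked circles.* Let $\mathrm{Homeo}^G(S^1)\to\mathrm{Homeo}(S^1)$ be a connective covering (compact-open topology) together with an isomorphism of its pullback along $O(2)\to\mathrm{Homeo}(S^1)$ with $p:G\to O(2)$. A $G$-structured marked circle consists of a space $C$ homeomorphic to $S^1$, a right torsor $F$ over the topological group $\mathrm{Homeo}^G(S^1)$ with an equivariant map $\rho:F\to\mathrm{Homeo}(S^1,C)$, and a nonempty closed $J\subset C$ homeomorphic to a finite disjoint union of copies of $[0,1]$. Let $\mathrm{Homeo}^G((C,J),(C',J'))$ be the space of pairs $(\varphi,\widetilde\varphi)$ of a homeomorphism $\varphi:C\to C'$ with $\varphi(J)\subset J'$ and an equivariant homeomorphism $\widetilde\varphi:F\to F'$ with $\rho'\widetilde\varphi=\varphi\rho$. The category $\mathcal C^G$ has the $G$-structured marked circles as objects and $\mathrm{Hom}((C,J),(C',J'))=\pi_0\,\mathrm{Homeo}^G((C,J),(C',J'))$. **Theorem.** Let $p:G\to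 O(2)$ be a planar Lie group with corresponding crossed simplicial group $\Delta\mathfrak G$. Then $\mathrm{Homeo}^G(S^1)$ exists, and for every choice of it the functor $$\lambda_{\mathcal C^G}:\mathcal C^G\to\mathrm{FSet},\qquad (C,J)\mapsto\pi_0(J),$$ factors canonically, up to natural isomorphism, as $\lambda_{\mathcal G}\circ\pi$ with an equivalence of categories $\pi:\mathcal C^G\to\mathcal G$. Here, if $J$ has $n+1$ components, the structured frames of $\pi(C,J)$ are in bijection with $\pi_0(F_J)$, where $F_J\subset F$ is the space of those $x$ for which $\rho(x)$ maps exactly one $(n+1)$-st root of unity into each component of $J$ and no root of unity outside $J$; under this bijection the class of $x$ gives the identification $\{0,\dots,n\}\cong\pi_0(J)$ sending $k$ to the component containing $\rho(x)(e^{2\pi i k/(n+1)})$, and $\mathfrak G_n=p^{-1}(D_{n+1})\subset G\subset\mathrm{Homeo}^G(S^1)$ acts through its right action on $F$. In particular, the category $\mathcal C^G$ is equivalent to $\Delta\mathfrak G$. -/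

import Mathlib

open CategoryTheory Topology

universe u w

namespace PlanarCSG

noncomputable section

/-! ### Homeomorphisms of the circle, orthogonal transformations -/

/-- The set of homeomorphisms `X → Y` with the compact-open topology. -/
instance homeoTopology (X Y : Type*) [TopologicalSpace X] [TopologicalSpace Y] :
    TopologicalSpace (X ≃ₜ Y) :=
  TopologicalSpace.induced (fun φ : X ≃ₜ Y => (φ : C(X, Y))) inferInstance

/-- The orthogonal group `O(2)`. -/
abbrev O2 := Matrix.orthogonalGroup (Fin 2) ℝ

namespace O2

theorem sq_sum (A : O2) :
    A.1 0 0 * A.1 0 0 + A.1 1 0 * A.1 1 0 = 1 ∧ A.1 0 0 * A.1 0 1 + A.1 1 0 * A.1 1 1 = 0 ∧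
      A.1 0 1 * A.1 0 1 + A.1 1 1 * A.1 1 1 = 1 := by
  have h : A.1.transpose * A.1 = 1 := by
    have := A.2.1
    rwa [Matrix.star_eq_conjTranspose, Matrix.conjTranspose_eq_transpose_of_trivial] at this
  have h00 := congrFun (congrFun h 0) 0
  have h01 := congrFun (congrFun h 0) 1
  have h11 := congrFun (congrFun h 1) 1
  simp [Matrix.mul_apply, Fin.sum_univ_two] at h00 h01 h11
  exact ⟨h00, h01, h11⟩

/-- The action of an orthogonal matrix on the unit circle of `ℂ = ℝ²`. -/
def act (A : O2) (z : Circle) : Circle :=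
  ⟨⟨A.1 0 0 * (z : ℂ).re + A.1 0 1 * (z : ℂ).im, A.1 1 0 * (z : ℂ).re + A.1 1 1 * (z : ℂ).im⟩, by
    obtain ⟨h1, h2, h3⟩ := sq_sum A
    have hz : (z : ℂ).re * (z : ℂ).re + (z : ℂ).im * (z : ℂ).im = 1 := by
      have := Circle.normSq_coe z
      rwa [Complex.normSq_apply] at this
    refine mem_sphere_zero_iff_norm.2 ?_
    rw [← sq_eq_sq₀ (norm_nonneg _) zero_le_one, ← Complex.normSq_eq_norm_sq,
      Complex.normSq_apply]
    dsimp only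
    linear_combination (z : ℂ).re ^ 2 * h1 + 2 * (z : ℂ).re * (z : ℂ).im * h2 +
      (z : ℂ).im ^ 2 * h3 + hz⟩

theorem act_one (z : Circle) : act 1 z = z := by
  apply Circle.ext
  apply Complex.ext <;> simp [act]

theorem act_mul (A B : O2) (z : Circle) : act (A * B) z = act A (act B z) := by
  apply Circle.ext
  apply Complex.ext <;> simp [act, Matrix.mul_apply, Fin.sum_univ_two] <;> ring

theorem continuous_act (A : O2) : Continuous (act A) := by
  refine Continuous.subtype_mk ?_ _
  have h : Continuous fun z : Circle => (z : ℂ) := continuous_subtype_val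
  have : Continuous fun z : Circle =>
      ((A.1 0 0 * (z : ℂ).re + A.1 0 1 * (z : ℂ).im : ℝ) : ℂ) +
        ((A.1 1 0 * (z : ℂ).re + A.1 1 1 * (z : ℂ).im : ℝ) : ℂ) * Complex.I := by fun_prop
  convert this using 2 with z
  apply Complex.ext <;> simp

/-- The standard homomorphism `O(2) → Homeo(S¹)`. -/
def toHomeo : O2 →* (Circle ≃ₜ Circle) where
  toFun A :=
    { toFun := act A
      invFun := act A⁻¹
      left_inv := fun z => by rw [← act_mul, inv_mul_cancel, act_one]
      right_inv := fun z => by rw [← act_mul, mul_inv_cancel, act_one]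
      continuous_toFun := continuous_act A
      continuous_invFun := continuous_act A⁻¹ }
  map_one' := by ext1 z; exact act_one z
  map_mul' A B := by ext1 z; exact act_mul A B z

theorem det_eq (A : O2) : A.1.det = 1 ∨ A.1.det = -1 := by
  obtain ⟨h1, h2, h3⟩ := sq_sum A
  rw [Matrix.det_fin_two, ← sq_eq_one_iff]
  nlinarith

/-- The sign `±1` of an orthogonal transformation (the sign of its determinant). -/
def sign : O2 →* ℤˣ where
  toFun A := if A.1.det = 1 then 1 else -1
  map_one' := by simp
  map_mul' A B := by
    have h : (A * B).1.det = A.1.det * B.1.det := by simp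
    rw [h]
    rcases det_eq A with hA | hA <;> rcases det_eq B with hB | hB <;> rw [hA, hB] <;> norm_num

theorem sign_cast (A : O2) : (((sign A : ℤˣ) : ℤ) : ℝ) = A.1.det := by
  show (((if A.1.det = 1 then (1 : ℤˣ) else -1 : ℤˣ) : ℤ) : ℝ) = _
  rcases det_eq A with hA | hA <;> rw [hA] <;> norm_num

/-- The rotation by the angle `2πt`. -/
def rotation (t : ℝ) : O2 :=
  ⟨!![Real.cos (2 * Real.pi * t), -Real.sin (2 * Real.pi * t);
      Real.sin (2 * Real.pi * t), Real.cos (2 * Real.pi * t)], by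
    rw [Matrix.mem_orthogonalGroup_iff]
    ext a b
    have := Real.sin_sq_add_cos_sq (2 * Real.pi * t)
    fin_cases a <;> fin_cases b <;>
      simp [Matrix.mul_apply, Fin.sum_univ_two] <;> nlinarith⟩

theorem rotation_int (k : ℤ) : rotation k = 1 := by
  have h1 : Real.cos (2 * Real.pi * k) = 1 := by
    rw [mul_comm]; exact Real.cos_int_mul_two_pi k
  have h2 : Real.sin (2 * Real.pi * k) = 0 := by
    have := Real.sin_int_mul_pi (2 * k)
    push_cast at this
    rwa [show (2 * (k : ℝ)) * Real.pi = 2 * Real.pi * k by ring] at this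
  apply Subtype.ext
  simp only [rotation, h1, h2]
  ext a b
  fin_cases a <;> fin_cases b <;> simp

theorem rotation_add (s t : ℝ) : rotation (s + t) = rotation s * rotation t := by
  apply Subtype.ext
  ext a b
  fin_cases a <;> fin_cases b <;>
    simp [rotation, mul_add, Real.cos_add, Real.sin_add] <;> ring

theorem continuous_rotation : Continuous rotation := by
  refine Continuous.subtype_mk ?_ _
  refine continuous_matrix fun a b => ?_
  fin_cases a <;> fin_cases b <;> simp <;> fun_prop

theorem sign_rotation (t : ℝ) : sign (rotation t) = 1 := by
  have : (rotation t).1.det = 1 := by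
    simp [rotation, Matrix.det_fin_two]
    have := Real.sin_sq_add_cos_sq (2 * Real.pi * t)
    nlinarith
  show (if (rotation t).1.det = 1 then (1 : ℤˣ) else -1) = 1
  rw [if_pos this]

theorem conj_rotation (A : O2) (t : ℝ) :
    A * rotation t = rotation (((sign A : ℤˣ) : ℤ) * t) * A := by
  obtain ⟨h1, h2, h3⟩ := sq_sum A
  rw [sign_cast]
  have hd := Matrix.det_fin_two A.1
  rcases det_eq A with hA | hA
  · rw [hA] at hd ⊢
    have e1 : A.1 1 1 = A.1 0 0 := by
      linear_combination -A.1 0 0 * hd + A.1 1 0 * h2 - A.1 1 1 * h1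
    have e2 : A.1 0 1 = -A.1 1 0 := by
      linear_combination A.1 1 0 * hd + A.1 0 0 * h2 - A.1 0 1 * h1
    apply Subtype.ext
    ext a b
    fin_cases a <;> fin_cases b <;>
      simp [rotation, Matrix.mul_apply, Fin.sum_univ_two, e1, e2] <;> ring
  · rw [hA] at hd ⊢
    have e1 : A.1 1 1 = - A.1 0 0 := by
      linear_combination -A.1 0 0 * hd + A.1 1 0 * h2 - A.1 1 1 * h1
    have e2 : A.1 0 1 = A.1 1 0 := by
      linear_combination A.1 1 0 * hd + A.1 0 0 * h2 - A.1 0 1 * h1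
    apply Subtype.ext
    ext a b
    fin_cases a <;> fin_cases b <;>
      simp [rotation, Matrix.mul_apply, Fin.sum_univ_two, e1, e2] <;> ring

end O2

/-! ### Connective coverings and planar Lie groups -/

/-- A homomorphism of topological groups is a connective covering if it is a covering of a union of
connected components of the target, and the preimage of the identity component is connected.
(Fibres of a covering map are allowed to be empty, so that `p` need not be surjective.) -/
structure IsConnectiveCovering {G H : Type*} [Group G] [TopologicalSpace G] [Group H]
    [TopologicalSpace H] (p : G →* H) : Prop where
  isCoveringMap : IsCoveringMap p
  isConnected_preimage : IsConnected (p ⁻¹' connectedComponent (1 : H))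

/-- A (thin) planar Lie group: a connective covering of `O(2)`. -/
structure PlanarLieGroup where
  carrier : Type u
  [group : Group carrier]
  [topology : TopologicalSpace carrier]
  [isTopologicalGroup : IsTopologicalGroup carrier]
  p : carrier →* O2
  connective : IsConnectiveCovering p

namespace PlanarLieGroup

instance : CoeSort PlanarLieGroup (Type u) := ⟨carrier⟩

attribute [instance] group topology isTopologicalGroup

variable (G : PlanarLieGroup.{u})

theorem exists_lift : ∃ e : C(ℝ, G), e 0 = 1 ∧ ∀ t, G.p (e t) = O2.rotation t := by
  have h0 : O2.rotation 0 = 1 := by simpa using O2.rotation_int 0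
  obtain ⟨e, he, -⟩ := G.connective.isCoveringMap.existsUnique_continuousMap_lifts
    (⟨O2.rotation, O2.continuous_rotation⟩ : C(ℝ, O2)) 0 1 (by simp [h0])
  exact ⟨e, he.1, fun t => congrFun he.2 t⟩

/-- The one-parameter subgroup `e : ℝ → G`: the unique continuous lift, with `e 0 = 1`, of the map
which sends `t` to the rotation by `2πt`. -/
def e : C(ℝ, G) := G.exists_lift.choose

theorem e_zero : G.e 0 = 1 := G.exists_lift.choose_spec.1

theorem p_e (t : ℝ) : G.p (G.e t) = O2.rotation t := G.exists_lift.choose_spec.2 t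

/-- The sign `±1` of an element of `G`. -/
def sign : G →* ℤˣ := O2.sign.comp G.p

theorem sign_e (t : ℝ) : G.sign (G.e t) = 1 := by
  simp [sign, p_e, O2.sign_rotation]

theorem e_add (s t : ℝ) : G.e (s + t) = G.e s * G.e t := by
  have := G.connective.isCoveringMap.eq_of_comp_eq (g₁ := fun t : ℝ => G.e (s + t))
    (g₂ := fun t : ℝ => G.e s * G.e t) (by fun_prop) (by fun_prop)
    (by ext1 t; simp [p_e, O2.rotation_add]) 0 (by simp [e_zero])
  exact congrFun this t

theorem mul_e (g : G) (t : ℝ) : g * G.e t = G.e (((G.sign g : ℤˣ) : ℤ) * t) * g := by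
  have := G.connective.isCoveringMap.eq_of_comp_eq (g₁ := fun t : ℝ => g * G.e t)
    (g₂ := fun t : ℝ => G.e (((G.sign g : ℤˣ) : ℤ) * t) * g) (by fun_prop) (by fun_prop)
    (by ext1 t; simp [p_e, sign, O2.conj_rotation]) 0 (by simp [e_zero])
  exact congrFun this t

/-- The preimage `p⁻¹(O(1))`, where `O(1) ⊂ O(2)` is the stabilizer of the point `1` of the circle. -/
def base : Subgroup G where
  carrier := {g | O2.toHomeo (G.p g) 1 = 1}
  mul_mem' {a b} ha hb := by
    simp only [Set.mem_ofPred_eq, map_mul] at *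
    show O2.toHomeo (G.p a) (O2.toHomeo (G.p b) 1) = 1
    rw [hb, ha]
  one_mem' := by simp
  inv_mem' {a} ha := by
    simp only [Set.mem_ofPred_eq, map_inv] at *
    show (O2.toHomeo (G.p a)).symm 1 = 1
    rw [Homeomorph.symm_apply_eq, ha]

/-- The element `e k`, `k ∈ ℤ` of `p⁻¹(O(1))`: the lift of `k` full turns. -/
def turn (k : ℤ) : G.base := ⟨G.e k, by
  show O2.toHomeo (G.p (G.e k)) 1 = 1
  rw [p_e, O2.rotation_int]; exact O2.act_one 1⟩

theorem turn_zero : G.turn 0 = 1 := Subtype.ext (by simp [turn, e_zero])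

theorem turn_add (j k : ℤ) : G.turn (j + k) = G.turn j * G.turn k :=
  Subtype.ext (by simp [turn, e_add])

theorem sign_turn (k : ℤ) : G.sign (G.turn k : G) = 1 := G.sign_e k

theorem mul_turn (g : G.base) (k : ℤ) :
    g * G.turn k = G.turn (((G.sign (g : G) : ℤˣ) : ℤ) * k) * g :=
  Subtype.ext (by simpa [turn] using G.mul_e g k)

end PlanarLieGroup

/-! ### The paracyclic category -/

/-- Morphisms of the paracyclic category: monotone maps `f : ℤ → ℤ` with
`f (l + (m + 1)) = f l + (n + 1)`. -/
@[ext]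
structure Para (m n : ℕ) where
  toFun : ℤ → ℤ
  monotone' : Monotone toFun
  map_add' : ∀ l, toFun (l + (m + 1)) = toFun l + (n + 1)

namespace Para

instance (m n : ℕ) : FunLike (Para m n) ℤ ℤ where
  coe := toFun
  coe_injective _ _ h := Para.ext h

variable {k m n : ℕ}

theorem ext' {f g : Para m n} (h : ∀ l, f l = g l) : f = g := DFunLike.ext _ _ h

theorem mono (f : Para m n) {a b : ℤ} (h : a ≤ b) : f a ≤ f b := f.monotone' h

theorem map_add (f : Para m n) (l : ℤ) : f (l + (m + 1)) = f l + (n + 1) := f.map_add' l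

theorem map_add_mul (f : Para m n) (l j : ℤ) : f (l + j * (m + 1)) = f l + j * (n + 1) := by
  induction j using Int.induction_on with
  | zero => simp
  | succ i ih =>
    rw [show l + ((i : ℤ) + 1) * (m + 1) = l + i * (m + 1) + (m + 1) by ring, f.map_add, ih]; ring
  | pred i ih =>
    have := f.map_add (l + (-(i : ℤ) - 1) * (m + 1))
    rw [show l + (-(i : ℤ) - 1) * (m + 1) + (m + 1) = l + -(i : ℤ) * (m + 1) by ring, ih] at this
    linarith

/-- The translation `l ↦ l + j`. -/
def trans (n : ℕ) (j : ℤ) : Para n n := ⟨fun l => l + j, fun _ _ h => by dsimp; omega, fun l => by ring⟩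

/-- Composition: first `f`, then `g`. -/
def comp (g : Para m n) (f : Para k m) : Para k n where
  toFun l := g (f l)
  monotone' _ _ h := g.mono (f.mono h)
  map_add' l := by rw [f.map_add, g.map_add]

/-- Addition of `j` full turns: the map `l ↦ f l + j (n + 1)`. -/
def shift (j : ℤ) (f : Para m n) : Para m n where
  toFun l := f l + j * (n + 1)
  monotone' _ _ h := by have := f.mono h; dsimp; omega
  map_add' l := by rw [f.map_add]; ring

/-- The conjugate of `f` by `l ↦ ε l`, `ε = ±1`: for `ε = -1` this is `l ↦ -f (-l)`. -/
def conj (ε : ℤˣ) (f : Para m n) : Para m n where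
  toFun l := ε * f (ε * l)
  monotone' a b h := by
    rcases Int.units_eq_one_or ε with rfl | rfl
    · simpa using f.mono h
    · simpa using f.mono (neg_le_neg h)
  map_add' l := by
    rcases Int.units_eq_one_or ε with rfl | rfl
    · simpa using f.map_add l
    · have := f.map_add (-(l + (m + 1)))
      rw [show -(l + ((m : ℤ) + 1)) + (m + 1) = -l by ring] at this
      simp only [Units.val_neg, Units.val_one, neg_mul, one_mul]
      linarith

@[simp] theorem trans_apply (j l : ℤ) : trans n j l = l + j := rfl
@[simp] theorem comp_apply (g : Para m n) (f : Para k m) (l : ℤ) : g.comp f l = g (f l) := rfl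
@[simp] theorem shift_apply (j : ℤ) (f : Para m n) (l : ℤ) : shift j f l = f l + j * (n + 1) := rfl
@[simp] theorem conj_apply (ε : ℤˣ) (f : Para m n) (l : ℤ) : conj ε f l = ε * f (ε * l) := rfl

/-- The periodic extension of a monotone map `{0, …, m} → {0, …, n}`. -/
def ofOrderHom (φ : Fin (m + 1) →o Fin (n + 1)) : Para m n where
  toFun l := φ ⟨(l % (m + 1)).toNat, by
    have h1 := Int.emod_lt_of_pos l (show (0 : ℤ) < m + 1 by positivity)
    omega⟩ + (l / (m + 1)) * (n + 1)
  monotone' a b h := by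
    have hm : (0 : ℤ) < m + 1 := by positivity
    have hq : a / (m + 1) ≤ b / (m + 1) := Int.ediv_le_ediv hm h
    dsimp only
    rcases hq.eq_or_lt with hq | hq
    · rw [hq]
      have h1 := Int.emod_add_mul_ediv a (m + 1)
      have h2 := Int.emod_add_mul_ediv b (m + 1)
      rw [hq] at h1
      have h3 : a % (m + 1) ≤ b % (m + 1) := by linarith
      have : φ ⟨(a % (m + 1)).toNat, by have := Int.emod_lt_of_pos a hm; omega⟩ ≤
          φ ⟨(b % (m + 1)).toNat, by have := Int.emod_lt_of_pos b hm; omega⟩ :=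
        φ.monotone (Fin.mk_le_mk.2 (Int.toNat_le_toNat h3))
      have h4 : ((φ ⟨(a % (m + 1)).toNat, by have := Int.emod_lt_of_pos a hm; omega⟩ : ℕ) : ℤ) ≤
          (φ ⟨(b % (m + 1)).toNat, by have := Int.emod_lt_of_pos b hm; omega⟩ : ℕ) := by
        exact_mod_cast this
      linarith
    · have h1 := (φ ⟨(a % (m + 1)).toNat, by have := Int.emod_lt_of_pos a hm; omega⟩).2
      have h2 : (a / (m + 1) + 1) * ((n : ℤ) + 1) ≤ b / (m + 1) * (n + 1) :=
        mul_le_mul_of_nonneg_right hq (by positivity)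
      have h5 : ((φ ⟨(a % (m + 1)).toNat, by have := Int.emod_lt_of_pos a hm; omega⟩ : ℕ) : ℤ) <
          n + 1 := by exact_mod_cast h1
      have h6 : (0 : ℤ) ≤
          (φ ⟨(b % (m + 1)).toNat, by have := Int.emod_lt_of_pos b hm; omega⟩ : ℕ) := by positivity
      linarith
  map_add' l := by
    have hm : (m : ℤ) + 1 ≠ 0 := by positivity
    have h1 : (l + (m + 1)) / (m + 1) = l / ((m : ℤ) + 1) + 1 := by
      simpa using Int.add_mul_ediv_right l 1 hm
    have h2 : (l + (m + 1)) % ((m : ℤ) + 1) = l % (m + 1) := by simp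
    simp only [h1, h2]
    ring

/-- A map in the paracyclic category is determined by its values on `{0, …, m}`. -/
theorem ext_fin {f g : Para m n} (h : ∀ a : Fin (m + 1), f (a : ℕ) = g (a : ℕ)) : f = g := by
  refine ext' fun l => ?_
  have hm : (0 : ℤ) < m + 1 := by positivity
  have h1 := Int.emod_add_mul_ediv l (m + 1)
  have h2 := Int.emod_nonneg l hm.ne'
  have h3 := Int.emod_lt_of_pos l hm
  rw [← h1, mul_comm, f.map_add_mul, g.map_add_mul]
  have := h ⟨(l % (m + 1)).toNat, by omega⟩
  simp only [Int.toNat_of_nonneg h2] at this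
  rw [this]

theorem ofOrderHom_apply (φ : Fin (m + 1) →o Fin (n + 1)) (a : Fin (m + 1)) :
    ofOrderHom φ ((a : ℕ) : ℤ) = ((φ a : ℕ) : ℤ) := by
  have ha : ((a : ℕ) : ℤ) < m + 1 := by exact_mod_cast a.2
  have h1 : ((a : ℕ) : ℤ) % (m + 1) = (a : ℕ) := Int.emod_eq_of_lt (by positivity) ha
  have h2 : ((a : ℕ) : ℤ) / (m + 1) = 0 := Int.ediv_eq_zero_of_lt (by positivity) ha
  show ((φ ⟨(((a : ℕ) : ℤ) % (m + 1)).toNat, _⟩ : ℕ) : ℤ) + ((a : ℕ) : ℤ) / (m + 1) * (n + 1) = _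
  simp only [h1, h2]
  simp

theorem ofOrderHom_id : ofOrderHom (OrderHom.id : Fin (n + 1) →o Fin (n + 1)) = trans n 0 :=
  ext_fin fun a => by rw [ofOrderHom_apply]; simp

theorem ofOrderHom_comp (ψ : Fin (m + 1) →o Fin (n + 1)) (φ : Fin (k + 1) →o Fin (m + 1)) :
    ofOrderHom (ψ.comp φ) = (ofOrderHom ψ).comp (ofOrderHom φ) :=
  ext_fin fun a => by rw [ofOrderHom_apply, comp_apply, ofOrderHom_apply, ofOrderHom_apply]; rfl

theorem ofOrderHom_injective {φ ψ : Fin (m + 1) →o Fin (n + 1)} (h : ofOrderHom φ = ofOrderHom ψ) :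
    φ = ψ := by
  ext a
  have := ofOrderHom_apply φ a
  rw [h, ofOrderHom_apply] at this
  exact_mod_cast this.symm

/-- Every morphism is, in a unique way, a translation followed by an extension of a monotone map. -/
theorem exists_factor (f : Para m n) :
    ∃ (φ : Fin (m + 1) →o Fin (n + 1)) (j : ℤ), f = (ofOrderHom φ).comp (trans m j) := by
  obtain ⟨c, hc, hc'⟩ : ∃ c : ℤ, 0 ≤ f c ∧ ∀ z, 0 ≤ f z → c ≤ z := by
    have hm : (0 : ℤ) < m + 1 := by positivity
    refine Int.exists_least_of_bdd ⟨(-(|f 0| + 1)) * (m + 1), fun z hz => ?_⟩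
      ⟨0 + |f 0| * (m + 1), ?_⟩
    · by_contra hlt
      have h1 := f.mono (le_of_lt (not_le.1 hlt))
      have h2 := f.map_add_mul 0 (-(|f 0| + 1))
      rw [zero_add] at h2
      rw [h2] at h1
      have := le_abs_self (f 0)
      nlinarith [abs_nonneg (f 0)]
    · rw [f.map_add_mul]
      have := neg_abs_le (f 0)
      nlinarith [abs_nonneg (f 0)]
  have hlt : ∀ a : Fin (m + 1), f (c + (a : ℕ)) < n + 1 := fun a => by
    have h1 : f (c - 1) < 0 := by
      by_contra h
      have := hc' _ (not_lt.1 h)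
      omega
    have h2 := f.map_add (c - 1)
    have h3 : f (c + (a : ℕ)) ≤ f (c - 1 + (m + 1)) := f.mono (by have := a.2; omega)
    omega
  have hge : ∀ a : Fin (m + 1), 0 ≤ f (c + (a : ℕ)) := fun a => hc.trans (f.mono (by omega))
  refine ⟨⟨fun a => ⟨(f (c + (a : ℕ))).toNat, by have := hlt a; have := hge a; omega⟩,
    fun a b hab => Fin.mk_le_mk.2 (Int.toNat_le_toNat (f.mono (by
      have : (a : ℕ) ≤ b := hab
      omega)))⟩, -c, ?_⟩
  have key : f.comp (trans m c) = ofOrderHom ⟨fun a => ⟨(f (c + (a : ℕ))).toNat, by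
      have := hlt a; have := hge a; omega⟩, fun a b hab => Fin.mk_le_mk.2 (Int.toNat_le_toNat (f.mono (by
      have : (a : ℕ) ≤ b := hab
      omega)))⟩ := by
    refine ext_fin fun a => ?_
    rw [ofOrderHom_apply]
    show f ((a : ℕ) + c) = ((f (c + (a : ℕ))).toNat : ℤ)
    rw [Int.toNat_of_nonneg (hge a), add_comm]
  rw [← key]
  exact ext' fun l => by simp

theorem factor_unique {φ ψ : Fin (m + 1) →o Fin (n + 1)} {i j : ℤ}
    (h : (ofOrderHom φ).comp (trans m i) = (ofOrderHom ψ).comp (trans m j)) : φ = ψ ∧ i = j := by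
  have key : ∀ {φ ψ : Fin (m + 1) →o Fin (n + 1)} {i j : ℤ},
      (ofOrderHom φ).comp (trans m i) = (ofOrderHom ψ).comp (trans m j) → i ≤ j := by
    intro φ ψ i j h
    by_contra hij
    have h1 := DFunLike.congr_fun h (-i)
    simp only [comp_apply, trans_apply, neg_add_cancel] at h1
    have h2 := ofOrderHom_apply φ 0
    have h3 : ofOrderHom ψ (-i + j) ≤ ofOrderHom ψ (-1) := (ofOrderHom ψ).mono (by omega)
    have h4 := ofOrderHom_apply ψ (Fin.last m)
    have h5 := (ofOrderHom ψ).map_add (-1)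
    rw [show (-1 : ℤ) + (m + 1) = ((Fin.last m : ℕ) : ℤ) by simp, h4] at h5
    have h6 := (ψ (Fin.last m)).2
    simp only [Fin.val_zero, Nat.cast_zero] at h2
    omega
  have hij : i = j := le_antisymm (key h) (key h.symm)
  subst hij
  refine ⟨ofOrderHom_injective (ext' fun l => ?_), rfl⟩
  simpa using DFunLike.congr_fun h (l - i)

/-- An invertible morphism is a translation. -/
theorem eq_trans_of_inverse {f : Para m n} {g : Para n m} {a b : ℤ}
    (h1 : ∀ l, g (f l) = l + a) (h2 : ∀ l, f (g l) = l + b) : ∀ l, f l = f 0 + l := by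
  have step : ∀ l, f (l + 1) = f l + 1 := fun l => by
    have hlt : ∀ x y, x < y → f x < f y := fun x y hxy => by
      refine lt_of_le_of_ne (f.mono hxy.le) fun h => ?_
      have := h1 x
      rw [h, h1] at this
      omega
    refine le_antisymm ?_ (hlt l (l + 1) (by omega))
    by_contra h
    push Not at h
    have h3 : f (g (f l + 1 - b)) = f l + 1 := by rw [h2]; ring
    have h4 : l < g (f l + 1 - b) := by
      by_contra hh
      have := f.mono (not_lt.1 hh)
      omega
    have := f.mono (show l + 1 ≤ g (f l + 1 - b) from h4)
    omega
  intro l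
  induction l using Int.induction_on with
  | zero => simp
  | succ i ih => rw [step, ih]; ring
  | pred i ih =>
    have := step (-(i : ℤ) - 1)
    rw [sub_add_cancel, ih] at this
    linarith

end Para

/-! ### Crossed simplicial groups and structured sets -/

/-- A crossed simplicial group: a functor `i : Δ ⥤ ΔG`, bijective on objects, such that every
morphism `i[m] ⟶ i[n]` is uniquely `i(φ) ∘ g` with `φ` in `Δ` and `g` an automorphism of `i[m]`
(in particular `i` is faithful). -/
class IsCrossedSimplicialGroup {D : Type w} [Category.{u} D] (i : SimplexCategory ⥤ D) : Prop where
  bijective_obj : Function.Bijective i.obj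
  existsUnique_factor : ∀ {m n : SimplexCategory} (v : i.obj m ⟶ i.obj n),
    ∃! x : Aut (i.obj m) × (m ⟶ n), v = x.1.hom ≫ i.map x.2

section Structured

variable {D : Type w} [Category.{u} D] (i : SimplexCategory ⥤ D)

/-- The object `[n]` of the crossed simplicial group. -/
abbrev ob (n : ℕ) : D := i.obj (SimplexCategory.mk n)

/-- The group `Aut [n]`; the product is composition, `(g * h).hom = h.hom ≫ g.hom`. -/
abbrev Gen (n : ℕ) := Aut (ob i n)

/-- The `k`-th vertex `[0] ⟶ [n]` in `Δ`. -/
abbrev vertex (n : ℕ) (k : Fin (n + 1)) : SimplexCategory.mk 0 ⟶ SimplexCategory.mk n :=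
  SimplexCategory.const _ _ k

variable [IsCrossedSimplicialGroup i]

/-- The map `{0, …, m} → {0, …, n}` induced by a morphism `v : [m] ⟶ [n]`, under the identification
of `Hom([0], [n]) / Aut [0]` with `Hom_Δ([0], [n]) = {0, …, n}`: the canonical factorization of
`v ∘ k` is `(lam v k) ∘ g` with `g ∈ Aut [0]`. -/
def lam {m n : ℕ} (v : ob i m ⟶ ob i n) (k : Fin (m + 1)) : Fin (n + 1) :=
  (IsCrossedSimplicialGroup.existsUnique_factor (i.map (vertex m k) ≫ v)).choose.2.toOrderHom 0

theorem vertex_lam {m n : ℕ} (v : ob i m ⟶ ob i n) (k : Fin (m + 1)) :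
    ∃ g : Gen i 0, i.map (vertex m k) ≫ v = g.hom ≫ i.map (vertex n (lam i v k)) := by
  refine ⟨(IsCrossedSimplicialGroup.existsUnique_factor (i.map (vertex m k) ≫ v)).choose.1, ?_⟩
  convert (IsCrossedSimplicialGroup.existsUnique_factor
    (i.map (vertex m k) ≫ v)).choose_spec.1 using 3
  ext a
  obtain rfl : a = 0 := Subsingleton.elim (α := Fin 1) _ _
  rfl

theorem lam_eq {m n : ℕ} {v : ob i m ⟶ ob i n} {k : Fin (m + 1)} {l : Fin (n + 1)} {g : Gen i 0}
    (h : i.map (vertex m k) ≫ v = g.hom ≫ i.map (vertex n l)) : lam i v k = l := by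
  have := (IsCrossedSimplicialGroup.existsUnique_factor
    (i.map (vertex m k) ≫ v)).choose_spec.2 (g, vertex n l) h
  rw [lam, ← this]
  rfl

theorem lam_id (n : ℕ) (k : Fin (n + 1)) : lam i (𝟙 (ob i n)) k = k :=
  lam_eq i (g := 1) (by rw [Category.comp_id]; exact (Category.id_comp _).symm)

theorem lam_comp {l m n : ℕ} (v : ob i l ⟶ ob i m) (v' : ob i m ⟶ ob i n) (k : Fin (l + 1)) :
    lam i (v ≫ v') k = lam i v' (lam i v k) := by
  obtain ⟨g, hg⟩ := vertex_lam i v k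
  obtain ⟨g', hg'⟩ := vertex_lam i v' (lam i v k)
  refine lam_eq i (g := g' * g) ?_
  rw [← Category.assoc, hg, Category.assoc, hg', ← Category.assoc]
  rfl

/-- A `ΔG`-structured set: a set `carrier` with `n + 1` elements, and a right torsor `Frame` over
`Aut [n]` with an equivariant map `ρ` to the bijections `{0, …, n} ≃ carrier`. -/
structure StructuredSet where
  carrier : Type u
  n : ℕ
  Frame : Type u
  nonempty_frame : Nonempty Frame
  act : Frame → Gen i n → Frame
  act_one : ∀ f, act f 1 = f
  act_mul : ∀ f g h, act f (g * h) = act (act f g) h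
  existsUnique_act : ∀ f f', ∃! g, act f g = f'
  ρ : Frame → (Fin (n + 1) ≃ carrier)
  ρ_act : ∀ f g k, ρ (act f g) k = ρ f (lam i g.hom k)

namespace StructuredSet

variable {i}

/-- A morphism of structured sets is an equivariant family of morphisms of `ΔG`, indexed by the
frames of the target and of the source. -/
@[ext]
structure Hom (X Y : StructuredSet i) where
  app : Y.Frame → X.Frame → (ob i X.n ⟶ ob i Y.n)
  app_act : ∀ f g f' g', app (Y.act f g) (X.act f' g') = g'.hom ≫ app f f' ≫ g.inv

/-- The unique `g` with `f g = f'`. -/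
def diff (X : StructuredSet i) (f f' : X.Frame) : Gen i X.n := (X.existsUnique_act f f').choose

theorem act_diff (X : StructuredSet i) (f f' : X.Frame) : X.act f (X.diff f f') = f' :=
  (X.existsUnique_act f f').choose_spec.1

theorem diff_eq (X : StructuredSet i) {f f' : X.Frame} {g : Gen i X.n} (h : X.act f g = f') :
    X.diff f f' = g := ((X.existsUnique_act f f').choose_spec.2 g h).symm

/-- A frame of a structured set. -/
def someFrame (X : StructuredSet i) : X.Frame := X.nonempty_frame.some

theorem Hom.app_comp_app {X Y Z : StructuredSet i} (ψ : Hom X Y) (ψ' : Hom Y Z) (f : Z.Frame)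
    (a b : Y.Frame) (f' : X.Frame) : ψ.app a f' ≫ ψ'.app f a = ψ.app b f' ≫ ψ'.app f b := by
  have h1 := ψ.app_act a (Y.diff a b) f' 1
  have h2 := ψ'.app_act f 1 a (Y.diff a b)
  rw [act_diff, act_one] at h1 h2
  rw [h1, h2]
  change _ = (𝟙 _ ≫ _ ≫ _) ≫ _ ≫ _ ≫ 𝟙 _
  simp only [Category.id_comp, Category.comp_id, Category.assoc]
  rw [← Category.assoc (Y.diff a b).inv, (Y.diff a b).inv_hom_id, Category.id_comp]

/-- Composition, `(ψ' ∘ ψ)_{f, f'} = ψ'_{f, a} ∘ ψ_{a, f'}` for any frame `a` of the middle set. -/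
instance : Category.{u} (StructuredSet i) where
  Hom := Hom
  id X :=
    { app := fun f f' => (X.diff f f').hom
      app_act := fun f g f' g' => by
        have : X.diff (X.act f g) (X.act f' g') = g⁻¹ * X.diff f f' * g' := by
          refine X.diff_eq ?_
          rw [← act_mul, mul_assoc, mul_inv_cancel_left, act_mul, act_diff]
        rw [this]
        rfl }
  comp {X Y Z} ψ ψ' :=
    { app := fun f f' => ψ.app Y.someFrame f' ≫ ψ'.app f Y.someFrame
      app_act := fun f g f' g' => by
        have h1 := ψ.app_act Y.someFrame 1 f' g'
        have h2 := ψ'.app_act f g Y.someFrame 1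
        rw [act_one] at h1 h2
        rw [h1, h2]
        change (_ ≫ _ ≫ 𝟙 _) ≫ 𝟙 _ ≫ _ ≫ _ = _
        simp }
  id_comp {X Y} ψ := Hom.ext (funext fun f => funext fun f' => by
    have h := ψ.app_act f 1 X.someFrame (X.diff X.someFrame f')
    rw [act_one, act_diff] at h
    refine Eq.trans ?_ h.symm
    change _ = _ ≫ _ ≫ 𝟙 _
    simp)
  comp_id {X Y} ψ := Hom.ext (funext fun f => funext fun f' => by
    have h := ψ.app_act Y.someFrame (Y.diff Y.someFrame f) f' 1
    rw [act_one, act_diff] at h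
    refine Eq.trans ?_ h.symm
    have : Y.diff f Y.someFrame = (Y.diff Y.someFrame f)⁻¹ := by
      refine Y.diff_eq ?_
      nth_rewrite 1 [← Y.act_diff Y.someFrame f]
      rw [← act_mul, mul_inv_cancel, act_one]
    change ψ.app Y.someFrame f' ≫ (Y.diff f Y.someFrame).hom = 𝟙 _ ≫ _ ≫ _
    rw [this, Category.id_comp]
    rfl)
  assoc ψ ψ' ψ'' := Hom.ext (funext fun f => funext fun f' => Category.assoc _ _ _)

theorem comp_app {X Y Z : StructuredSet i} (ψ : X ⟶ Y) (ψ' : Y ⟶ Z) (f : Z.Frame) (a : Y.Frame)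
    (f' : X.Frame) : Hom.app (ψ ≫ ψ') f f' = Hom.app ψ a f' ≫ Hom.app ψ' f a :=
  Hom.app_comp_app ψ ψ' f _ a f'

theorem id_app (X : StructuredSet i) (f : X.Frame) : Hom.app (𝟙 X) f f = 𝟙 _ := by
  change (X.diff f f).hom = _
  rw [X.diff_eq (X.act_one f)]
  rfl

/-- The map of underlying sets induced by a morphism, computed in the frames `f` and `f'`. -/
def Hom.mapAt {X Y : StructuredSet i} (ψ : Hom X Y) (f : Y.Frame) (f' : X.Frame) :
    X.carrier → Y.carrier :=
  fun x => Y.ρ f (lam i (ψ.app f f') ((X.ρ f').symm x))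

theorem Hom.mapAt_eq {X Y : StructuredSet i} (ψ : Hom X Y) (f₁ f₂ : Y.Frame) (f₁' f₂' : X.Frame) :
    ψ.mapAt f₁ f₁' = ψ.mapAt f₂ f₂' := by
  funext x
  obtain ⟨g, rfl⟩ : ∃ g, Y.act f₁ g = f₂ := ⟨_, Y.act_diff f₁ f₂⟩
  obtain ⟨g', rfl⟩ : ∃ g', X.act f₁' g' = f₂' := ⟨_, X.act_diff f₁' f₂'⟩
  obtain ⟨k, rfl⟩ := (X.ρ (X.act f₁' g')).surjective x
  simp only [mapAt, Equiv.symm_apply_apply, Y.ρ_act, ψ.app_act]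
  rw [X.ρ_act, Equiv.symm_apply_apply, lam_comp, lam_comp, ← lam_comp i g.inv g.hom, g.inv_hom_id,
    lam_id]

/-- The map of underlying sets induced by a morphism. -/
def Hom.map {X Y : StructuredSet i} (ψ : Hom X Y) : X.carrier → Y.carrier :=
  ψ.mapAt Y.someFrame X.someFrame

end StructuredSet

end Structured

/-- The category of nonempty finite sets. -/
abbrev FSet := ObjectProperty.FullSubcategory (fun I : Type u => Finite I ∧ Nonempty I)

/-- The forgetful functor `(I, O(I)) ↦ I`. -/
def StructuredSet.forget {D : Type w} [Category.{u} D] (i : SimplexCategory ⥤ D)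
    [IsCrossedSimplicialGroup i] : StructuredSet i ⥤ FSet.{u} where
  obj X := ⟨X.carrier, Finite.of_equiv _ (X.ρ X.someFrame), ⟨X.ρ X.someFrame 0⟩⟩
  map ψ := ObjectProperty.homMk (TypeCat.ofHom (Hom.map ψ))
  map_id X := by
    apply ObjectProperty.hom_ext
    ext x
    change Hom.map (𝟙 X) x = x
    simp [Hom.map, Hom.mapAt, id_app, lam_id]
  map_comp {X Y Z} ψ ψ' := by
    apply ObjectProperty.hom_ext
    ext x
    change Hom.map (ψ ≫ ψ') x = Hom.map ψ' (Hom.map ψ x)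
    simp [Hom.map, Hom.mapAt, comp_app ψ ψ' _ Y.someFrame, lam_comp]

/-! ### The crossed simplicial group of a planar Lie group -/

/-- Objects of the crossed simplicial group of a planar Lie group: `[n]`, `n ≥ 0`. -/
structure DeltaG (G : PlanarLieGroup.{u}) where
  len : ℕ

namespace DeltaG

variable {G : PlanarLieGroup.{u}}

/-- The identification of `k` full turns in `G` with `k` full turns in the paracyclic category. -/
def homSetoid (G : PlanarLieGroup.{u}) (m n : ℕ) : Setoid (G.base × Para m n) where
  r x y := ∃ k : ℤ, y.1 = x.1 * G.turn k ∧ x.2 = y.2.shift k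
  iseqv :=
    { refl := fun x => ⟨0, by simp [G.turn_zero], Para.ext' fun l => by simp⟩
      symm := by
        rintro ⟨w, f⟩ ⟨w', f'⟩ ⟨k, h1, h2⟩
        dsimp only at h1 h2
        subst h1 h2
        refine ⟨-k, ?_, Para.ext' fun l => by simp⟩
        dsimp only
        rw [mul_assoc, ← G.turn_add, add_neg_cancel, G.turn_zero, mul_one]
      trans := by
        rintro ⟨w, f⟩ ⟨w', f'⟩ ⟨w'', f''⟩ ⟨k, h1, h2⟩ ⟨k', h1', h2'⟩
        dsimp only at h1 h2 h1' h2'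
        subst h1 h2 h1' h2'
        refine ⟨k + k', ?_, Para.ext' fun l => by simp; ring⟩
        dsimp only
        rw [mul_assoc, ← G.turn_add] }

/-- A morphism `[m] ⟶ [n]` is the class of a pair `(w, f)`, standing for `w ∘ f`, where
`w ∈ p⁻¹(O(1))` and `f : [m] ⟶ [n]` is a morphism of the paracyclic category. -/
def Hom (G : PlanarLieGroup.{u}) (m n : ℕ) : Type u := Quotient (homSetoid G m n)

variable {k l m n : ℕ}

/-- The morphism `w ∘ f`. -/
def cls (w : G.base) (f : Para m n) : Hom G m n := Quotient.mk (homSetoid G m n) (w, f)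

theorem cls_eq_iff {w w' : G.base} {f f' : Para m n} :
    cls w f = cls w' f' ↔ ∃ k : ℤ, w' = w * G.turn k ∧ f = f'.shift k := Quotient.eq

theorem exists_cls (v : Hom G m n) : ∃ w f, v = cls w f := by
  obtain ⟨⟨w, f⟩, rfl⟩ := Quotient.exists_rep v
  exact ⟨w, f, rfl⟩

/-- Composition (first `(w, f)`, then `(w', f')`) is `w' ∘ f' ∘ w ∘ f = (w' w) ∘ (f'ʷ ∘ f)`, where
`f'ʷ = w⁻¹ ∘ f' ∘ w` is `f'` or `l ↦ -f' (-l)`, according to the sign of `w`. -/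
def comp (v : Hom G k m) (v' : Hom G m n) : Hom G k n :=
  Quotient.map₂ (fun x y => (y.1 * x.1, (y.2.conj (G.sign (x.1 : G))).comp x.2)) (by
    rintro ⟨w, f⟩ ⟨w₁, f₁⟩ ⟨k, h1, h2⟩ ⟨w', f'⟩ ⟨w₁', f₁'⟩ ⟨k', h1', h2'⟩
    dsimp only at h1 h2 h1' h2'
    subst h1 h2 h1' h2'
    have hs : G.sign ((w * G.turn k : G.base) : G) = G.sign (w : G) := by
      rw [Subgroup.coe_mul, map_mul, G.sign_turn, mul_one]
    refine ⟨((G.sign (w : G) : ℤˣ) : ℤ) * k' + k, ?_, Para.ext' fun l => ?_⟩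
    · dsimp only
      have h := G.mul_turn w (((G.sign (w : G) : ℤˣ) : ℤ) * k')
      have h2 : ((G.sign (w : G) : ℤˣ) : ℤ) * (((G.sign (w : G) : ℤˣ) : ℤ) * k') = k' := by
        rcases Int.units_eq_one_or (G.sign (w : G)) with h | h <;> rw [h] <;> simp
      rw [h2] at h
      rw [G.turn_add, mul_assoc w' w, ← mul_assoc w, h]
      simp only [mul_assoc]
    · dsimp only
      rw [hs]
      rcases Int.units_eq_one_or (G.sign (w : G)) with h | h <;> rw [h]
      · simp [Para.map_add_mul]; ring
      · have := f₁'.map_add_mul (-f₁ l) (-k)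
        simp only [Para.comp_apply, Para.conj_apply, Para.shift_apply, Units.val_neg, Units.val_one]
        rw [show -1 * (f₁ l + k * (m + 1 : ℤ)) = -f₁ l + -k * (m + 1) by ring, this,
          neg_one_mul (f₁ l)]
        ring) v v'

theorem comp_cls (w : G.base) (f : Para k m) (w' : G.base) (f' : Para m n) :
    comp (cls w f) (cls w' f') = cls (w' * w) ((f'.conj (G.sign (w : G))).comp f) := rfl

/-- The identity morphism. -/
def idHom (n : ℕ) : Hom G n n := cls 1 (Para.trans n 0)

theorem id_comp (v : Hom G m n) : comp (idHom m) v = v := by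
  obtain ⟨w, f, rfl⟩ := exists_cls v
  rw [idHom, comp_cls, mul_one]
  congr 1
  exact Para.ext' fun l => by simp

theorem comp_id (v : Hom G m n) : comp v (idHom n) = v := by
  obtain ⟨w, f, rfl⟩ := exists_cls v
  rw [idHom, comp_cls, one_mul]
  congr 1
  refine Para.ext' fun l => ?_
  rcases Int.units_eq_one_or (G.sign (w : G)) with h | h <;> simp [h]

theorem comp_assoc (v : Hom G k l) (v' : Hom G l m) (v'' : Hom G m n) :
    comp (comp v v') v'' = comp v (comp v' v'') := by
  obtain ⟨w, f, rfl⟩ := exists_cls v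
  obtain ⟨w', f', rfl⟩ := exists_cls v'
  obtain ⟨w'', f'', rfl⟩ := exists_cls v''
  simp only [comp_cls, mul_assoc]
  congr 1
  refine Para.ext' fun l => ?_
  rcases Int.units_eq_one_or (G.sign (w : G)) with h | h <;>
    rcases Int.units_eq_one_or (G.sign (w' : G)) with h' | h' <;> simp [h, h']

/-- The morphism of `ΔG` given by a morphism of `Δ`, that is, the class of `(1, f)` where `f` is the
periodic extension. -/
def ofOrderHom (φ : Fin (m + 1) →o Fin (n + 1)) : Hom G m n := cls 1 (Para.ofOrderHom φ)

theorem ofOrderHom_comp (φ : Fin (k + 1) →o Fin (m + 1)) (ψ : Fin (m + 1) →o Fin (n + 1)) :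
    (ofOrderHom (ψ.comp φ) : Hom G k n) = comp (ofOrderHom φ) (ofOrderHom ψ) := by
  rw [ofOrderHom, ofOrderHom, ofOrderHom, comp_cls, mul_one, Para.ofOrderHom_comp]
  refine congrArg (cls 1) (Para.ext' fun l => ?_)
  simp

/-- The morphism `w ∘ τʲ` from `[n]` to `[n]`, where `τ : l ↦ l + 1`. -/
def autHom (n : ℕ) (w : G.base) (j : ℤ) : Hom G n n := cls w (Para.trans n j)

theorem exists_inverse (w : G.base) (j : ℤ) : ∃ v : Hom G n n,
    comp (autHom n w j) v = idHom n ∧ comp v (autHom n w j) = idHom n := by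
  refine ⟨autHom n w⁻¹ (-((G.sign (w : G) : ℤˣ) : ℤ) * j), ?_, ?_⟩
  · rw [autHom, autHom, comp_cls, inv_mul_cancel]
    refine congrArg (cls 1) (Para.ext' fun l => ?_)
    rcases Int.units_eq_one_or (G.sign (w : G)) with h | h <;> simp [h]
  · rw [autHom, autHom, comp_cls, mul_inv_cancel]
    refine congrArg (cls 1) (Para.ext' fun l => ?_)
    rcases Int.units_eq_one_or (G.sign (w : G)) with h | h <;> simp [h]

theorem eq_autHom_of_inverse {g g' : Hom G n n} (h1 : comp g g' = idHom n)
    (h2 : comp g' g = idHom n) : ∃ w j, g = autHom n w j := by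
  obtain ⟨w, f, rfl⟩ := exists_cls g
  obtain ⟨w', f', rfl⟩ := exists_cls g'
  rw [idHom, comp_cls, cls_eq_iff] at h1 h2
  obtain ⟨a, ha, hf⟩ := h1
  obtain ⟨b, hb, hf'⟩ := h2
  have hs : G.sign (w' : G) = G.sign (w : G) := by
    have := congrArg (fun x : G.base => G.sign (x : G)) ha
    simp only [Subgroup.coe_mul, map_mul, G.sign_turn, mul_one, Subgroup.coe_one, map_one] at this
    rcases Int.units_eq_one_or (G.sign (w : G)) with h | h <;>
      rcases Int.units_eq_one_or (G.sign (w' : G)) with h' | h' <;> rw [h, h'] at this ⊢ <;>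
      revert this <;> decide
  have key : ∀ l, f l = f 0 + l := by
    refine Para.eq_trans_of_inverse (g := f'.conj (G.sign (w : G))) (a := a * (n + 1))
      (b := ((G.sign (w : G) : ℤˣ) : ℤ) * b * (n + 1)) (fun l => ?_) (fun l => ?_)
    · simpa using DFunLike.congr_fun hf l
    · have := DFunLike.congr_fun hf' (((G.sign (w : G) : ℤˣ) : ℤ) * l)
      rw [hs] at this
      rcases Int.units_eq_one_or (G.sign (w : G)) with h | h <;> rw [h] at this ⊢ <;>
        simp at this ⊢ <;> linarith
  refine ⟨w, f 0, congrArg (cls w) (Para.ext' fun l => ?_)⟩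
  rw [key, Para.trans_apply, add_comm]

theorem autHom_comp_ofOrderHom (w : G.base) (j : ℤ) (φ : Fin (m + 1) →o Fin (n + 1)) :
    comp (autHom m w j) (ofOrderHom φ) =
      cls w (((Para.ofOrderHom φ).comp
        (Para.trans m (((G.sign (w : G) : ℤˣ) : ℤ) * j))).conj (G.sign (w : G))) := by
  rw [autHom, ofOrderHom, comp_cls, one_mul]
  refine congrArg (cls w) (Para.ext' fun l => ?_)
  rcases Int.units_eq_one_or (G.sign (w : G)) with h | h <;> simp [h, add_comm]

theorem sign_mul_sign_mul (ε : ℤˣ) (j : ℤ) : (ε : ℤ) * ((ε : ℤ) * j) = j := by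
  rcases Int.units_eq_one_or ε with rfl | rfl <;> simp

theorem conj_conj (ε : ℤˣ) (g : Para m n) : (g.conj ε).conj ε = g := by
  refine Para.ext' fun l => ?_
  rcases Int.units_eq_one_or ε with rfl | rfl <;> simp

theorem exists_factor (v : Hom G m n) :
    ∃ w j φ, v = comp (autHom m w j) (ofOrderHom φ) := by
  obtain ⟨w, f, rfl⟩ := exists_cls v
  obtain ⟨φ, j, hφ⟩ := (f.conj (G.sign (w : G))).exists_factor
  refine ⟨w, ((G.sign (w : G) : ℤˣ) : ℤ) * j, φ, ?_⟩
  rw [autHom_comp_ofOrderHom, sign_mul_sign_mul, ← hφ, conj_conj]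

theorem factor_unique {w w' : G.base} {j j' : ℤ} {φ φ' : Fin (m + 1) →o Fin (n + 1)}
    (h : comp (autHom m w j) (ofOrderHom φ) = comp (autHom m w' j') (ofOrderHom φ')) :
    autHom m w j = autHom m w' j' ∧ φ = φ' := by
  rw [autHom_comp_ofOrderHom, autHom_comp_ofOrderHom, cls_eq_iff] at h
  obtain ⟨k, rfl, hk⟩ := h
  have hs : G.sign ((w * G.turn k : G.base) : G) = G.sign (w : G) := by
    rw [Subgroup.coe_mul, map_mul, G.sign_turn, mul_one]
  rw [hs] at hk
  have h1 : (Para.ofOrderHom φ).comp (Para.trans m (((G.sign (w : G) : ℤˣ) : ℤ) * j)) =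
      (Para.ofOrderHom φ').comp
        (Para.trans m (((G.sign (w : G) : ℤˣ) : ℤ) * (j' + k * (m + 1)))) := by
    rw [← conj_conj (G.sign (w : G)) (Para.comp _ _), hk]
    refine Para.ext' fun l => ?_
    have := (Para.ofOrderHom φ').map_add_mul (l + ((G.sign (w : G) : ℤˣ) : ℤ) * j')
      (((G.sign (w : G) : ℤˣ) : ℤ) * k)
    simp only [Para.shift_apply, Para.conj_apply, Para.comp_apply, Para.trans_apply,
      sign_mul_sign_mul]
    rw [show l + ((G.sign (w : G) : ℤˣ) : ℤ) * (j' + k * (m + 1)) =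
      l + ((G.sign (w : G) : ℤˣ) : ℤ) * j' + ((G.sign (w : G) : ℤˣ) : ℤ) * k * (m + 1) by ring, this,
      mul_add, sign_mul_sign_mul]
    ring
  obtain ⟨h2, h3⟩ := Para.factor_unique h1
  have h4 : j = j' + k * (m + 1) := by
    rw [← sign_mul_sign_mul (G.sign (w : G)) j, h3, sign_mul_sign_mul]
  refine ⟨cls_eq_iff.2 ⟨k, rfl, Para.ext' fun l => ?_⟩, h2⟩
  simp only [Para.trans_apply, Para.shift_apply, h4]
  ring

/-- The crossed simplicial group `ΔG` of the planar Lie group `G`: the category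
`(p⁻¹(O(1)) ⋉ Λ_∞) / ℤ`, where `Λ_∞` is the paracyclic category, `p⁻¹(O(1))` acts on it through the
sign and the involution `f ↦ (l ↦ -f (-l))`, and a full turn of `G` is identified with the full turn
`l ↦ l + (n + 1)` of `[n]`. The group `Aut [n]` is `p⁻¹(D_{n + 1})`, by `w ∘ τʲ ↦ w e(j / (n + 1))`.

For the universal covering of `SO(2)` this is `Λ_∞`; for `SO(2)` and its `N`-fold covering it is
`Λ_∞` with `f` and `f + r N (n + 1)` identified, the cyclic category `Λ` and the `N`-cyclic category
`Λ_N`; for `O(2)`, `Pin⁺_N(2)` and the semidirect product of `ℤ/2` and `ℝ` it consists of the maps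
`w ∘ f` which preserve or reverse the order, modulo the same identification (`N = 1`, `N`, none):
the dihedral, `N`-dihedral and paradihedral categories; for `Pin⁻_{2N}(2)`, where
`p⁻¹(O(1))` is the quaternionic group `Q_N` and `Aut [n] = Q_{N(n+1)}`, the `N`-quaternionic
category. -/
instance : Category.{u} (DeltaG G) where
  Hom X Y := Hom G X.len Y.len
  id X := idHom X.len
  comp v v' := comp v v'
  id_comp := id_comp
  comp_id := comp_id
  assoc := comp_assoc

/-- The embedding `Δ → ΔG`; its image consists of the classes of those `(1, f)` for which
`f {0, …, m} ⊆ {0, …, n}`. -/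
def incl (G : PlanarLieGroup.{u}) : SimplexCategory ⥤ DeltaG G where
  obj n := ⟨n.len⟩
  map φ := ofOrderHom φ.toOrderHom
  map_id _ := congrArg (cls 1) Para.ofOrderHom_id
  map_comp φ ψ := ofOrderHom_comp φ.toOrderHom ψ.toOrderHom

instance (G : PlanarLieGroup.{u}) : IsCrossedSimplicialGroup (incl G) where
  bijective_obj := ⟨fun a b h => by
    have : a.len = b.len := congrArg DeltaG.len h
    exact SimplexCategory.ext this, fun X => ⟨SimplexCategory.mk X.len, rfl⟩⟩
  existsUnique_factor {m n} v := by
    obtain ⟨w, j, φ, hv⟩ := exists_factor (G := G) (m := m.len) (n := n.len) v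
    obtain ⟨v', h1, h2⟩ := exists_inverse (n := m.len) w j
    refine ⟨(⟨autHom m.len w j, v', h1, h2⟩, SimplexCategory.Hom.mk φ), hv, ?_⟩
    rintro ⟨g, ψ⟩ hg
    obtain ⟨w', j', hg'⟩ := eq_autHom_of_inverse (G := G) (n := m.len) g.hom_inv_id g.inv_hom_id
    have h3 : comp (autHom m.len w' j') (ofOrderHom ψ.toOrderHom) =
        comp (autHom m.len w j) (ofOrderHom φ) := by
      rw [← hg', ← hv]
      exact hg.symm
    obtain ⟨h4, h5⟩ := factor_unique h3
    refine Prod.ext (Iso.ext (hg'.trans h4)) (SimplexCategory.Hom.ext _ _ h5)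

end DeltaG

/-! ### Planar homeomorphism groups and structured marked circles -/

/-- The planar homeomorphism group `Homeo^G(S¹)` of a planar Lie group `p : G → O(2)`: a connective
covering `q` of `Homeo(S¹)` together with an identification of `G` with its pullback to `O(2)`. It is
determined up to isomorphism by `G`. -/
structure PlanarHomeoGroup (G : PlanarLieGroup.{u}) where
  carrier : Type u
  [group : Group carrier]
  [topology : TopologicalSpace carrier]
  [isTopologicalGroup : IsTopologicalGroup carrier]
  q : carrier →* (Circle ≃ₜ Circle)
  connective : IsConnectiveCovering q
  incl : G →* carrier
  q_incl : ∀ g, q (incl g) = O2.toHomeo (G.p g)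
  isEmbedding : IsEmbedding fun g : G => (G.p g, incl g)
  exists_eq : ∀ (A : O2) (h : carrier), O2.toHomeo A = q h → ∃ g, G.p g = A ∧ incl g = h

namespace PlanarHomeoGroup

variable {G : PlanarLieGroup.{u}}

instance : CoeSort (PlanarHomeoGroup G) (Type u) := ⟨carrier⟩

attribute [instance] group topology isTopologicalGroup

end PlanarHomeoGroup

variable {G : PlanarLieGroup.{u}}

/-- A `G`-structured marked circle: a space `C` homeomorphic to the circle, with a reduction of the
structure group `ρ : F → Homeo(S¹, C)`, where `F` is a right torsor over the topological group
`Homeo^G(S¹)`, and with a nonempty closed subset `J` which is homeomorphic to a finite disjoint union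
of intervals `[0, 1]`. -/
structure MarkedCircle (H : PlanarHomeoGroup G) where
  C : Type u
  [topC : TopologicalSpace C]
  nonempty_homeo : Nonempty (Circle ≃ₜ C)
  F : Type u
  [topF : TopologicalSpace F]
  nonempty_F : Nonempty F
  act : F → H → F
  act_one : ∀ x, act x 1 = x
  act_mul : ∀ x g h, act x (g * h) = act (act x g) h
  isHomeomorph_act : ∀ x, IsHomeomorph (act x)
  ρ : F → (Circle ≃ₜ C)
  ρ_act : ∀ x h z, ρ (act x h) z = ρ x (H.q h z)
  J : Set C
  nonempty_J : J.Nonempty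
  isClosed_J : IsClosed J
  exists_intervals : ∃ k : ℕ, Nonempty (J ≃ₜ Fin k × unitInterval)

namespace MarkedCircle

variable {H : PlanarHomeoGroup G}

attribute [instance] topC topF

/-- Structured homeomorphisms `(φ, φ̃)` of the underlying structured circles. -/
@[ext]
structure StructuredHomeo (X Y : MarkedCircle H) where
  φ : X.C ≃ₜ Y.C
  φt : X.F ≃ₜ Y.F
  φt_act : ∀ x h, φt (X.act x h) = Y.act (φt x) h
  ρ_φt : ∀ x z, Y.ρ (φt x) z = φ (X.ρ x z)

/-- The pair of maps underlying a structured homeomorphism. -/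
def StructuredHomeo.toProd {X Y : MarkedCircle H} (a : StructuredHomeo X Y) :
    (X.C ≃ₜ Y.C) × (X.F → Y.F) := (a.φ, a.φt)

/-- The natural topology: compact-open convergence of `φ` and pointwise convergence of the
equivariant map `φ̃` (evaluation of `φ̃` at any point identifies the space of all `(φ, φ̃)` with the
torsor of `Y`). -/
instance (X Y : MarkedCircle H) : TopologicalSpace (StructuredHomeo X Y) :=
  TopologicalSpace.induced StructuredHomeo.toProd inferInstance

theorem continuous_toProd {X Y : MarkedCircle H} :
    Continuous (StructuredHomeo.toProd : StructuredHomeo X Y → _) := continuous_induced_dom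

/-- The space of structured homeomorphisms with `φ(J) ⊆ J'`, with the subspace topology. -/
abbrev MarkedHomeo (X Y : MarkedCircle H) : Type u :=
  {a : StructuredHomeo X Y // Set.MapsTo a.φ X.J Y.J}

/-- The identity. -/
def MarkedHomeo.id (X : MarkedCircle H) : MarkedHomeo X X :=
  ⟨⟨Homeomorph.refl _, Homeomorph.refl _, fun _ _ => rfl, fun _ _ => rfl⟩, fun _ h => h⟩

/-- Composition: first `a`, then `b`. -/
def MarkedHomeo.comp {X Y Z : MarkedCircle H} (a : MarkedHomeo X Y) (b : MarkedHomeo Y Z) :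
    MarkedHomeo X Z :=
  ⟨⟨a.1.φ.trans b.1.φ, a.1.φt.trans b.1.φt,
    fun x h => by simp [a.1.φt_act, b.1.φt_act], fun x z => by simp [a.1.ρ_φt, b.1.ρ_φt]⟩,
    fun _ h => b.2 (a.2 h)⟩

theorem continuous_φ (X Y : MarkedCircle H) :
    Continuous fun a : MarkedHomeo X Y => (a.1.φ : C(X.C, Y.C)) :=
  (continuous_induced_dom (f := fun φ : X.C ≃ₜ Y.C => (φ : C(X.C, Y.C)))).comp
    (continuous_fst.comp (continuous_toProd.comp continuous_subtype_val))

theorem continuous_φt (X Y : MarkedCircle H) (x : X.F) :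
    Continuous fun a : MarkedHomeo X Y => a.1.φt x :=
  (continuous_apply x).comp
    (continuous_snd.comp (continuous_toProd.comp continuous_subtype_val))

theorem continuous_of {T : Type*} [TopologicalSpace T] {X Y : MarkedCircle H}
    {f : T → MarkedHomeo X Y} (h1 : Continuous fun t => ((f t).1.φ : C(X.C, Y.C)))
    (h2 : ∀ x, Continuous fun t => (f t).1.φt x) : Continuous f :=
  continuous_induced_rng.2 (continuous_induced_rng.2
    (Continuous.prodMk (f := fun t => (f t).1.φ) (g := fun t => ⇑(f t).1.φt)
      (continuous_induced_rng.2 h1) (continuous_pi h2)))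

theorem continuous_comp_left {X Y Z : MarkedCircle H} (a : MarkedHomeo X Y) :
    Continuous fun b : MarkedHomeo Y Z => a.comp b :=
  continuous_of ((ContinuousMap.continuous_precomp (a.1.φ : C(X.C, Y.C))).comp (continuous_φ Y Z))
    fun x => continuous_φt Y Z (a.1.φt x)

theorem continuous_comp_right {X Y Z : MarkedCircle H} (b : MarkedHomeo Y Z) :
    Continuous fun a : MarkedHomeo X Y => a.comp b :=
  continuous_of ((ContinuousMap.continuous_postcomp (b.1.φ : C(Y.C, Z.C))).comp (continuous_φ X Y))
    fun x => b.1.φt.continuous.comp (continuous_φt X Y x)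

/-- The category of `G`-structured marked circles; morphisms are connected components of the spaces
of structured homeomorphisms with `φ(J) ⊆ J'`. -/
instance : Category.{u} (MarkedCircle H) where
  Hom X Y := ZerothHomotopy (MarkedHomeo X Y)
  id X := ZerothHomotopy.mk (MarkedHomeo.id X)
  comp {X Y Z} := Quotient.map₂ MarkedHomeo.comp (by
    rintro a a' ⟨γ⟩ b b' ⟨δ⟩
    exact ⟨(γ.map (continuous_comp_right b)).trans (δ.map (continuous_comp_left a'))⟩)
  id_comp := by rintro X Y ⟨a⟩; rfl
  comp_id := by rintro X Y ⟨a⟩; rfl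
  assoc := by rintro X Y Z W ⟨a⟩ ⟨b⟩ ⟨c⟩; rfl

theorem finite_pi0 (X : MarkedCircle H) : Finite (ZerothHomotopy X.J) := by
  obtain ⟨k, ⟨e⟩⟩ := X.exists_intervals
  refine Finite.of_surjective (fun a : Fin k => ZerothHomotopy.mk (e.symm (a, 0))) ?_
  rintro ⟨x⟩
  refine ⟨(e x).1, ?_⟩
  let γ : Path (0 : unitInterval) (e x).2 := ⟨⟨fun t => t * (e x).2, by fun_prop⟩, by simp, by simp⟩
  have h : Continuous fun t : unitInterval => e.symm ((e x).1, t) := by fun_prop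
  exact ZerothHomotopy.sound ((γ.map h).cast rfl (by simp))

/-- The map `J → J'` induced by a structured homeomorphism with `φ(J) ⊆ J'`. -/
def MarkedHomeo.onJ {X Y : MarkedCircle H} (a : MarkedHomeo X Y) (x : X.J) : Y.J :=
  ⟨a.1.φ x, a.2 x.2⟩

/-- The map `π₀(J) → π₀(J')` induced by a structured homeomorphism with `φ(J) ⊆ J'`. -/
def MarkedHomeo.onPi0 {X Y : MarkedCircle H} (a : MarkedHomeo X Y) :
    ZerothHomotopy X.J → ZerothHomotopy Y.J :=
  ZerothHomotopy.lift (fun x => ZerothHomotopy.mk (a.onJ x)) (fun _ _ γ =>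
    ZerothHomotopy.sound (γ.map (f := a.onJ)
      ((a.1.φ.continuous.comp continuous_subtype_val).subtype_mk _)))

/-- The functor `(C, J) ↦ π₀(J)` to nonempty finite sets. -/
def pi0 (H : PlanarHomeoGroup G) : MarkedCircle H ⥤ FSet.{u} where
  obj X := ⟨ZerothHomotopy X.J, X.finite_pi0,
    have : Nonempty X.J := X.nonempty_J.to_subtype
    inferInstance⟩
  map {X Y} a := ObjectProperty.homMk (TypeCat.ofHom
    (ZerothHomotopy.lift MarkedHomeo.onPi0 (fun a b γ => by
      funext x
      obtain ⟨x, rfl⟩ := ZerothHomotopy.mk_surjective x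
      exact ZerothHomotopy.sound (γ.map (f := fun c : MarkedHomeo X Y => c.onJ x)
        (((continuous_eval_const x.1).comp (continuous_φ X Y)).subtype_mk _))) a))
  map_id X := by
    apply ObjectProperty.hom_ext
    ext x
    obtain ⟨x, rfl⟩ := ZerothHomotopy.mk_surjective x
    rfl
  map_comp {X Y Z} a b := by
    apply ObjectProperty.hom_ext
    ext x
    obtain ⟨x, rfl⟩ := ZerothHomotopy.mk_surjective x
    obtain ⟨a, rfl⟩ := ZerothHomotopy.mk_surjective a
    obtain ⟨b, rfl⟩ := ZerothHomotopy.mk_surjective b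
    rfl

/-- The point `exp(2πik/(n+1))` of the circle. -/
def root (n : ℕ) (k : Fin (n + 1)) : Circle := Circle.exp (2 * Real.pi * (k : ℕ) / (n + 1))

/-- The space `F_J` of those `x ∈ F` for which the homeomorphism `ρ(x)` sends the `(n+1)`-st roots of
unity into `J`, exactly one of them into each component of `J`. -/
abbrev FrameSpace (X : MarkedCircle H) (n : ℕ) : Type u :=
  {x : X.F // ∃ h : ∀ k, X.ρ x (root n k) ∈ X.J,
    Function.Bijective fun k => ZerothHomotopy.mk (⟨X.ρ x (root n k), h k⟩ : X.J)}

/-- The component of `J` which contains the image of the `k`-th root of unity. -/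
def FrameSpace.component {X : MarkedCircle H} {n : ℕ} (x : X.FrameSpace n) (k : Fin (n + 1)) :
    ZerothHomotopy X.J :=
  ZerothHomotopy.mk ⟨X.ρ x.1 (root n k), x.2.1 k⟩

end MarkedCircle

end

end PlanarCSG

open PlanarCSG

/-!
Every element of `Homeo^G(S¹)` can be written as `w ∘ l` with `w ∈ p⁻¹(O(1))` and `l` an increasing
homeomorphism of `ℝ` commuting with `t ↦ t + 1`, uniquely up to shifting `l` by an integer `k` and
multiplying `w` by `e(-k)`. Numbering the components of the preimage in `ℝ` of a marking of the
circle by `ℤ`, such an `l` which maps one marking into another determines a monotone map `ℤ → ℤ`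
which is equivariant under the periods, so `w ∘ l` determines a morphism of `Δ𝔊`. On the space of
structured homeomorphisms between two marked circles this morphism is a complete invariant of the
connected component: two lifts inducing the same monotone map are joined by the segment of their
convex combinations, which again induce it since the components of a marking are intervals. Every
morphism occurs, by a piecewise linear lift. With roots of unity as the marking of the source this
computes `π₀(F_J)`, and with general markings it gives fullness and faithfulness of `π`.

For existence, `Homeo(S¹)` retracts onto `O(2)`, the homeomorphism `φ` going to the orthogonal
transformation with the same value at `1` and the same orientation. The retraction `r` is not
multiplicative, but `r(φψ)` and `r(φ) r(ψ)` differ by the rotation by a real number which depends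
continuously on `φ` and `ψ` and satisfies a cocycle identity. Inserting its image under `e` in the
multiplication turns the pullback of `p` along `r` into a topological group.
-/

namespace PlanarCSG

noncomputable section

open unitInterval Filter
open scoped FourierTransform

/-! ### The universal covering of the circle -/

theorem fourierChar_add_intCast (t : ℝ) (k : ℤ) : 𝐞 (t + k) = 𝐞 t := by
  rw [AddChar.map_add_eq_mul, Real.fourierChar_apply' (k : ℝ), Circle.exp_two_pi_mul_int, mul_one]

theorem fourierChar_add_one (t : ℝ) : 𝐞 (t + 1) = 𝐞 t := by
  simpa using fourierChar_add_intCast t 1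

theorem fourierChar_eq_iff {s t : ℝ} : 𝐞 s = 𝐞 t ↔ ∃ k : ℤ, s = t + k := by
  rw [Real.fourierChar_apply', Real.fourierChar_apply', Circle.exp_eq_exp]
  refine exists_congr fun k => ?_
  rw [← mul_right_inj' Real.two_pi_pos.ne' (b := s)]
  ring_nf

theorem fourierChar_surjective : Function.Surjective (𝐞 : ℝ → Circle) := fun z =>
  ⟨Complex.arg z / (2 * Real.pi), by
    rw [Real.fourierChar_apply', mul_div_cancel₀ _ Real.two_pi_pos.ne', Circle.exp_arg]⟩

theorem homeo_ext {X : Type*} [TopologicalSpace X] {φ ψ : Circle ≃ₜ X}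
    (h : ∀ t, φ (𝐞 t) = ψ (𝐞 t)) : φ = ψ :=
  Homeomorph.ext (fourierChar_surjective.forall.2 h)

theorem isCoveringMap_fourierChar : IsCoveringMap (𝐞 : ℝ → Circle) :=
  (Circle.isCoveringMap_exp.comp_homeomorph (Homeomorph.mulLeft₀ _ Real.two_pi_pos.ne') :)

theorem isOpenQuotientMap_fourierChar : IsOpenQuotientMap (𝐞 : ℝ → Circle) :=
  ⟨fourierChar_surjective, Real.continuous_fourierChar, isCoveringMap_fourierChar.isOpenMap⟩

theorem exists_lift_of_continuous {φ : Circle → Circle} (hφ : Continuous φ) :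
    ∃ g : ℝ → ℝ, Continuous g ∧ ∀ t, 𝐞 (g t) = φ (𝐞 t) := by
  obtain ⟨x, hx⟩ := fourierChar_surjective (φ (𝐞 0))
  obtain ⟨g, ⟨-, hg⟩, -⟩ := isCoveringMap_fourierChar.existsUnique_continuousMap_lifts
    ⟨fun t => φ (𝐞 t), hφ.comp Real.continuous_fourierChar⟩ 0 x hx
  exact ⟨g, g.continuous, congrFun hg⟩

theorem exists_eq_add_intCast {f g : ℝ → ℝ} (hf : Continuous f) (hg : Continuous g)
    (h : ∀ t, 𝐞 (f t) = 𝐞 (g t)) : ∃ k : ℤ, ∀ t, f t = g t + k := by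
  obtain ⟨k, hk⟩ := fourierChar_eq_iff.1 (h 0)
  exact ⟨k, congrFun (isCoveringMap_fourierChar.eq_of_comp_eq hf (hg.add continuous_const)
    (by ext1 t; simp [h, fourierChar_add_intCast]) 0 hk)⟩

theorem exists_degree {φ : Circle → Circle} {g : ℝ → ℝ} (hg : Continuous g)
    (h : ∀ t, 𝐞 (g t) = φ (𝐞 t)) : ∃ d : ℤ, ∀ (t : ℝ) (k : ℤ), g (t + k) = g t + k * d := by
  obtain ⟨d, hd⟩ := exists_eq_add_intCast (f := fun t => g (t + 1)) (by fun_prop) hg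
    fun t => by rw [h, h, fourierChar_add_one]
  refine ⟨d, fun t k => ?_⟩
  simpa using AddConstMapClass.map_add_int' (⟨g, hd⟩ : AddConstMap ℝ ℝ 1 (d : ℝ)) t k

theorem exists_add_half_eq {f : ℝ → ℝ} (hf : Continuous f) (h : f 1 = f 0) :
    ∃ t, f (t + 1 / 2) = f t := by
  have hc : Continuous fun t => f (t + 1 / 2) - f t := by fun_prop
  have hneg : f (0 + 1 / 2) - f 0 = -(f (1 / 2 + 1 / 2) - f (1 / 2)) := by norm_num [h]
  suffices ∃ t, f (t + 1 / 2) - f t = 0 from this.imp fun _ => sub_eq_zero.1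
  rcases le_total (f (0 + 1 / 2) - f 0) 0 with h0 | h0
  · exact mem_range_of_exists_le_of_exists_ge hc ⟨0, h0⟩ ⟨1 / 2, by linarith [hneg]⟩
  · exact mem_range_of_exists_le_of_exists_ge hc ⟨1 / 2, by linarith [hneg]⟩ ⟨0, h0⟩

theorem not_injective_of_continuous_circle {f : Circle → ℝ} (hf : Continuous f) :
    ¬ Function.Injective f := fun hinj => by
  obtain ⟨t, ht⟩ := exists_add_half_eq (hf.comp Real.continuous_fourierChar)
    (by simp only [Function.comp_apply, ← fourierChar_add_one 0, zero_add])
  obtain ⟨k, hk⟩ := fourierChar_eq_iff.1 (hinj ht)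
  have hk' : ((2 * k : ℤ) : ℝ) = (1 : ℤ) := by push_cast; linarith
  have := Int.cast_injective hk'
  omega

theorem units_mul_units_mul (ε : ℤˣ) (t : ℝ) : (ε * (ε * t) : ℝ) = t := by
  rcases Int.units_eq_one_or ε with rfl | rfl <;> simp

/-! ### Lifts of orientation preserving homeomorphisms -/

/-- The group of lifts to the line of the orientation preserving homeomorphisms of the circle: the
increasing bijections `l : ℝ → ℝ` with `l (t + 1) = l t + 1`. -/
abbrev CircleLift : Type := CircleDeg1Liftˣ

namespace CircleLift

theorem ext {a b : CircleLift} (h : ∀ t, a t = b t) : a = b := Units.ext (CircleDeg1Lift.ext h)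

@[simp] theorem mul_apply (a b : CircleLift) (t : ℝ) : (a * b) t = a (b t) := rfl

theorem bijective (l : CircleLift) : Function.Bijective l :=
  CircleDeg1Lift.isUnit_iff_bijective.1 l.isUnit

theorem strictMono (l : CircleLift) : StrictMono l :=
  (l : CircleDeg1Lift).strictMono_iff_injective.2 l.bijective.1

@[fun_prop]
theorem continuous (l : CircleLift) : Continuous l :=
  (l : CircleDeg1Lift).continuous_iff_surjective.2 l.bijective.2

theorem exists_coe_eq_of_surjective {g : ℝ → ℝ} (hmono : StrictMono g)
    (hsurj : Function.Surjective g) (hg : ∀ t, g (t + 1) = g t + 1) :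
    ∃ l : CircleLift, ∀ t, l t = g t := by
  obtain ⟨l, hl⟩ := (CircleDeg1Lift.isUnit_iff_bijective (f := ⟨⟨g, hmono.monotone⟩, hg⟩)).2
    ⟨hmono.injective, hsurj⟩
  exact ⟨l, fun t => by rw [hl]; rfl⟩

theorem exists_coe_eq {g : ℝ → ℝ} (hmono : StrictMono g) (hcont : Continuous g)
    (hg : ∀ t, g (t + 1) = g t + 1) : ∃ l : CircleLift, ∀ t, l t = g t :=
  exists_coe_eq_of_surjective hmono
    ((CircleDeg1Lift.continuous_iff_surjective ⟨⟨g, hmono.monotone⟩, hg⟩).1 hcont) hg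

/-- The topology of locally uniform convergence. -/
instance : TopologicalSpace CircleLift :=
  TopologicalSpace.induced (fun l => (⟨l, l.continuous⟩ : C(ℝ, ℝ))) inferInstance

theorem continuous_eval : Continuous fun x : CircleLift × ℝ => x.1 x.2 :=
  ContinuousEval.continuous_eval.comp
    ((continuous_induced_dom (f := fun l : CircleLift => (⟨l, l.continuous⟩ : C(ℝ, ℝ)))).prodMap
      continuous_id)

@[fun_prop]
theorem continuous_eval_comp {T : Type*} [TopologicalSpace T] {f : T → CircleLift} {g : T → ℝ}
    (hf : Continuous f) (hg : Continuous g) : Continuous fun x => f x (g x) :=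
  continuous_eval.comp (hf.prodMk hg)

theorem continuous_of_uncurry {T : Type*} [TopologicalSpace T] {f : T → CircleLift}
    (h : Continuous fun x : T × ℝ => f x.1 x.2) : Continuous f :=
  continuous_induced_rng.2 (ContinuousMap.continuous_of_continuous_uncurry _ h)

instance : ContinuousMul CircleLift :=
  ⟨continuous_of_uncurry (by simp only [mul_apply]; fun_prop)⟩

/-- The translation by `t`. -/
def translation (t : ℝ) : CircleLift := CircleDeg1Lift.translate (Multiplicative.ofAdd t)

@[simp] theorem translation_apply (t s : ℝ) : translation t s = s + t :=
  (CircleDeg1Lift.translate_apply t s).trans (add_comm t s)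

theorem continuous_translation : Continuous translation :=
  continuous_of_uncurry (by simp only [translation_apply]; fun_prop)

theorem exists_segment (a b : CircleLift) (s : I) :
    ∃ l : CircleLift, ∀ t, l t = (1 - (s : ℝ)) * a t + s * b t := by
  refine exists_coe_eq (fun x y hxy => ?_) (by fun_prop) (fun t => ?_)
  · have ha := a.strictMono hxy
    have hb := b.strictMono hxy
    have hs := s.2.1
    rcases s.2.2.eq_or_lt with hs1 | hs1
    · rw [hs1]; simpa using hb
    · have := mul_lt_mul_of_pos_left ha (sub_pos.2 hs1)
      have := mul_le_mul_of_nonneg_left hb.le hs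
      linarith
  · rw [CircleDeg1Lift.map_add_one, CircleDeg1Lift.map_add_one]; ring

/-- The point `(1 - s) a + s b` of the segment from `a` to `b` in the convex set of lifts. -/
def segment (a b : CircleLift) (s : I) : CircleLift := (exists_segment a b s).choose

theorem segment_apply (a b : CircleLift) (s : I) (t : ℝ) :
    segment a b s t = (1 - (s : ℝ)) * a t + s * b t :=
  (exists_segment a b s).choose_spec t

@[simp] theorem segment_zero (a b : CircleLift) : segment a b 0 = a :=
  ext fun t => by simp [segment_apply]

@[simp] theorem segment_one (a b : CircleLift) : segment a b 1 = b :=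
  ext fun t => by simp [segment_apply]

@[simp] theorem segment_self (a : CircleLift) (s : I) : segment a a s = a :=
  ext fun t => by rw [segment_apply]; ring

theorem segment_mem_uIcc (a b : CircleLift) (s : I) (t : ℝ) :
    segment a b s t ∈ Set.uIcc (a t) (b t) := by
  rw [segment_apply, ← segment_eq_uIcc]
  exact ⟨1 - s, s, sub_nonneg.2 s.2.2, s.2.1, by ring, rfl⟩

theorem continuous_segment :
    Continuous fun x : (CircleLift × CircleLift) × I => segment x.1.1 x.1.2 x.2 :=
  continuous_of_uncurry (by simp only [segment_apply]; fun_prop)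

/-- The segment from `a` to `b` as a path. -/
def segmentPath (a b : CircleLift) : Path a b where
  toFun := segment a b
  continuous_toFun :=
    continuous_segment.comp (f := fun s : I => ((a, b), s)) (by fun_prop)
  source' := segment_zero a b
  target' := segment_one a b

instance : PathConnectedSpace CircleLift := ⟨⟨1⟩, fun a b => ⟨segmentPath a b⟩⟩

theorem exists_conj (ε : ℤˣ) (l : CircleLift) : ∃ l' : CircleLift, ∀ t, l' t = ε * l (ε * t) := by
  refine exists_coe_eq ?_ (by fun_prop) ?_
  · rcases Int.units_eq_one_or ε with rfl | rfl
    · simpa using l.strictMono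
    · intro x y hxy
      simpa using l.strictMono (neg_lt_neg hxy)
  · intro t
    rw [mul_add, mul_one, CircleDeg1Lift.map_add_int, mul_add]
    rcases Int.units_eq_one_or ε with rfl | rfl <;> simp

/-- The conjugate of `l` by `t ↦ ε t`, where `ε = ±1`. -/
def conj (ε : ℤˣ) (l : CircleLift) : CircleLift := (exists_conj ε l).choose

theorem conj_apply (ε : ℤˣ) (l : CircleLift) (t : ℝ) : conj ε l t = ε * l (ε * t) :=
  (exists_conj ε l).choose_spec t

theorem continuous_conj (ε : ℤˣ) : Continuous (conj ε) :=
  continuous_of_uncurry (by simp only [conj_apply]; fun_prop)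

theorem fourierChar_apply_congr (l : CircleLift) {s t : ℝ} (h : 𝐞 s = 𝐞 t) :
    𝐞 (l s) = 𝐞 (l t) := by
  obtain ⟨k, rfl⟩ := fourierChar_eq_iff.1 h
  rw [CircleDeg1Lift.map_add_int, fourierChar_add_intCast]

/-- The map of the circle with the lift `l`. -/
def circleMap (l : CircleLift) : C(Circle, Circle) :=
  IsQuotientMap.lift (f := ⟨𝐞, Real.continuous_fourierChar⟩)
    isOpenQuotientMap_fourierChar.isQuotientMap
    ⟨fun t => 𝐞 (l t), Real.continuous_fourierChar.comp l.continuous⟩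
    fun _ _ => l.fourierChar_apply_congr

theorem circleMap_fourierChar (l : CircleLift) (t : ℝ) : circleMap l (𝐞 t) = 𝐞 (l t) :=
  ContinuousMap.congr_fun (IsQuotientMap.lift_comp (f := ⟨𝐞, Real.continuous_fourierChar⟩)
    isOpenQuotientMap_fourierChar.isQuotientMap
    (⟨fun t => 𝐞 (l t), Real.continuous_fourierChar.comp l.continuous⟩ : C(ℝ, Circle))
    fun _ _ => fourierChar_apply_congr l) t

/-- The homomorphism which sends `l` to the homeomorphism of the circle with the lift `l`. -/
def toHomeo : CircleLift →* (Circle ≃ₜ Circle) where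
  toFun l :=
    { toFun := circleMap l
      invFun := circleMap l⁻¹
      left_inv := fourierChar_surjective.forall.2 fun t => by simp [circleMap_fourierChar]
      right_inv := fourierChar_surjective.forall.2 fun t => by simp [circleMap_fourierChar] }
  map_one' := homeo_ext (circleMap_fourierChar 1)
  map_mul' a b := homeo_ext fun t => by
    change circleMap (a * b) (𝐞 t) = circleMap a (circleMap b (𝐞 t))
    simp only [circleMap_fourierChar, mul_apply]

theorem toHomeo_fourierChar (l : CircleLift) (t : ℝ) : toHomeo l (𝐞 t) = 𝐞 (l t) :=
  circleMap_fourierChar l t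

theorem continuous_toHomeo : Continuous toHomeo := by
  refine continuous_induced_rng.2 (ContinuousMap.continuous_of_continuous_uncurry _ ?_)
  have hq : IsOpenQuotientMap (Prod.map (id : CircleLift → CircleLift) 𝐞) :=
    IsOpenQuotientMap.id.prodMap isOpenQuotientMap_fourierChar
  exact hq.isQuotientMap.continuous_iff.2 <|
    (Real.continuous_fourierChar.comp continuous_eval).congr fun x =>
      (toHomeo_fourierChar x.1 x.2).symm

end CircleLift

/-! ### Orientation of homeomorphisms of the circle -/

theorem exists_degree_unit {φ : Circle ≃ₜ Circle} {g : ℝ → ℝ} (hg : Continuous g)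
    (h : ∀ t, 𝐞 (g t) = φ (𝐞 t)) :
    Function.Bijective g ∧ ∃ ε : ℤˣ, ∀ (t : ℝ) (k : ℤ), g (t + k) = g t + k * ε := by
  obtain ⟨g', hg', h'⟩ := exists_lift_of_continuous φ.symm.continuous
  obtain ⟨a, ha⟩ := exists_eq_add_intCast (hg.comp hg') continuous_id fun t => by simp [h, h']
  obtain ⟨b, hb⟩ := exists_eq_add_intCast (hg'.comp hg) continuous_id fun t => by simp [h, h']
  simp only [Function.comp_apply, id] at ha hb
  refine ⟨⟨fun s t hst => ?_, fun t => ⟨g' (t - a), by rw [ha]; ring⟩⟩, ?_⟩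
  · have hs := hb s
    rw [hst, hb] at hs
    linarith
  obtain ⟨d, hd⟩ := exists_degree hg h
  obtain ⟨d', hd'⟩ := exists_degree hg' h'
  have hdd' : d' * d = 1 := by
    have h1 := ha (0 + (1 : ℤ))
    rw [hd', Int.cast_one, one_mul, hd, ha] at h1
    exact_mod_cast (by linarith : (d' * d : ℝ) = 1)
  exact ⟨(IsUnit.of_mul_eq_one_right _ hdd').unit, hd⟩

theorem exists_eq_of_lift {φ : Circle ≃ₜ Circle} {g : ℝ → ℝ} (hg : Continuous g)
    (h : ∀ t, 𝐞 (g t) = φ (𝐞 t)) : ∃ (ε : ℤˣ) (l : CircleLift), ∀ t, g t = l (ε * t) := by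
  obtain ⟨⟨hinj, -⟩, ε, hε⟩ := exists_degree_unit hg h
  have hper (t : ℝ) : g (ε * (t + 1)) = g (ε * t) + 1 := by
    rw [mul_add, mul_one, hε]
    rcases Int.units_eq_one_or ε with rfl | rfl <;> simp
  have hinv : Function.Involutive fun t : ℝ => (ε * t : ℝ) := units_mul_units_mul ε
  have hmono : StrictMono fun t => g (ε * t) := by
    refine (Continuous.strictMono_of_inj (by fun_prop) (hinj.comp hinv.injective)).resolve_right
      fun hanti => ?_
    have h01 : g (ε * (0 + 1)) < g (ε * 0) := hanti (lt_add_one 0)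
    linarith [hper 0]
  obtain ⟨l, hl⟩ := CircleLift.exists_coe_eq hmono (by fun_prop) hper
  exact ⟨ε, l, fun t => by rw [hl, units_mul_units_mul]⟩

theorem exists_lift (φ : Circle ≃ₜ Circle) :
    ∃ (ε : ℤˣ) (l : CircleLift), ∀ t, φ (𝐞 t) = 𝐞 (l (ε * t)) := by
  obtain ⟨g, hg, h⟩ := exists_lift_of_continuous φ.continuous
  obtain ⟨ε, l, hl⟩ := exists_eq_of_lift hg h
  exact ⟨ε, l, fun t => by rw [← h, hl]⟩

theorem lift_unique {ε ε' : ℤˣ} {l l' : CircleLift}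
    (h : ∀ t : ℝ, 𝐞 (l (ε * t)) = 𝐞 (l' (ε' * t))) :
    ε = ε' ∧ ∃ k : ℤ, l = CircleLift.translation k * l' := by
  obtain ⟨k, hk⟩ := exists_eq_add_intCast (f := fun t => l (ε * t)) (by fun_prop) (by fun_prop) h
  obtain rfl : ε = ε' := by
    have h0 := hk 0
    have h1 := hk 1
    have hε := CircleDeg1Lift.map_add_int l 0 ε
    have hε' := CircleDeg1Lift.map_add_int l' 0 ε'
    simp only [mul_one, mul_zero, zero_add] at h0 h1 hε hε'
    exact Units.ext (by exact_mod_cast (by linarith : ((ε : ℤ) : ℝ) = (ε' : ℤ)))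
  refine ⟨rfl, k, CircleLift.ext fun t => ?_⟩
  simpa [units_mul_units_mul] using hk (ε * t)

/-! ### Orthogonal transformations -/

namespace O2

theorem act_rotation (s : ℝ) (z : Circle) : act (rotation s) z = 𝐞 s * z := by
  apply Circle.ext
  apply Complex.ext <;>
    simp [act, rotation, Real.fourierChar_apply', Circle.coe_exp, Complex.exp_re, Complex.exp_im,
      sub_eq_add_neg, add_comm]

theorem act_fourierChar (A : O2) (t : ℝ) : act A (𝐞 t) = 𝐞 (sign A * t) * act A 1 := by
  have key := congrArg (fun B => act B 1) (conj_rotation A t)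
  simpa only [act_mul, act_rotation, mul_one] using key

theorem act_fourierChar_of_act_one {A : O2} (h : act A 1 = 1) (t : ℝ) :
    act A (𝐞 t) = 𝐞 (sign A * t) := by
  rw [act_fourierChar, h, mul_one]

theorem exists_act_one_sign_eq (ε : ℤˣ) : ∃ A : O2, act A 1 = 1 ∧ sign A = ε := by
  rcases Int.units_eq_one_or ε with rfl | rfl
  · exact ⟨1, act_one 1, map_one _⟩
  · refine ⟨⟨!![1, 0; 0, -1], ?_⟩, ?_, ?_⟩
    · rw [Matrix.mem_orthogonalGroup_iff]
      ext a b
      fin_cases a <;> fin_cases b <;> simp [Matrix.mul_apply, Fin.sum_univ_two]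
    · apply Circle.ext
      apply Complex.ext <;> simp [act]
    · exact if_neg (by norm_num [Matrix.det_fin_two])

theorem toHomeo_injective : Function.Injective toHomeo := fun A B h => by
  have act_eq (z : Circle) : act A z = act B z := DFunLike.congr_fun h z
  have at_one := act_eq 1
  have at_i := act_eq (Circle.exp (Real.pi / 2))
  rw [Circle.ext_iff, Complex.ext_iff] at at_one at_i
  simp only [act, Circle.coe_one, Complex.one_re, mul_one, Complex.one_im, mul_zero, add_zero,
    Circle.coe_exp, Complex.ofReal_div, Complex.ofReal_ofNat, Complex.exp_pi_div_two_mul_I,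
    Complex.I_re, Complex.I_im, zero_add] at at_one at_i
  apply Subtype.ext
  ext i j
  fin_cases i <;> fin_cases j <;> simp [at_one, at_i]

end O2

theorem PlanarLieGroup.toHomeo_base (G : PlanarLieGroup.{u}) (w : G.base) (t : ℝ) :
    O2.toHomeo (G.p w) (𝐞 t) = 𝐞 (G.sign (w : G) * t) :=
  O2.act_fourierChar_of_act_one w.2 t

theorem continuous_homeo_eval (X Y : Type*) [TopologicalSpace X] [TopologicalSpace Y]
    [LocallyCompactPair X Y] : Continuous fun x : (X ≃ₜ Y) × X => x.1 x.2 :=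
  (ContinuousEval.continuous_eval (F := C(X, Y))).comp
    (.prodMap (f := fun φ : X ≃ₜ Y => (φ : C(X, Y))) continuous_induced_dom continuous_id)

theorem exists_circleLift_of_homotopy {T : Type*} [TopologicalSpace T] [PreconnectedSpace T]
    {g : T × ℝ → ℝ} (hg : Continuous g) {φ : T → (Circle ≃ₜ Circle)}
    (h : ∀ s t, 𝐞 (g (s, t)) = φ s (𝐞 t)) {s₀ : T} (h0 : g (s₀, 1) - g (s₀, 0) = 1) (s : T) :
    ∃ l : CircleLift, ∀ t, g (s, t) = l t := by
  have hdeg (s : T) : ∃ (ε : ℤˣ) (l : CircleLift), (∀ t, g (s, t) = l (ε * t)) ∧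
      g (s, 1) - g (s, 0) = ε := by
    obtain ⟨ε, l, hl⟩ := exists_eq_of_lift (by fun_prop) (h s)
    refine ⟨ε, l, hl, ?_⟩
    rw [hl, hl, mul_one, mul_zero, ← zero_add ((ε : ℤ) : ℝ), CircleDeg1Lift.map_add_int, zero_add,
      add_sub_cancel_left]
  obtain ⟨ε, l, hl, hε⟩ := hdeg s
  rcases Int.units_eq_one_or ε with rfl | rfl
  · exact ⟨l, by simpa using hl⟩
  · obtain ⟨s', hs'⟩ : ∃ s', g (s', 1) - g (s', 0) = 0 :=
      mem_range_of_exists_le_of_exists_ge (f := fun s => g (s, 1) - g (s, 0)) (by fun_prop)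
        ⟨s, by simp [hε]⟩ ⟨s₀, by simp [h0]⟩
    obtain ⟨ε', -, -, hε'⟩ := hdeg s'
    rw [hs'] at hε'
    exact absurd (by exact_mod_cast hε'.symm) ε'.ne_zero

theorem exists_lift_of_path {φ : I → (Circle ≃ₜ Circle)} (hφ : Continuous φ) {l₀ : CircleLift}
    (h0 : ∀ t, φ 0 (𝐞 t) = 𝐞 (l₀ t)) :
    ∃ l : I → CircleLift, Continuous l ∧ l 0 = l₀ ∧ ∀ s t, φ s (𝐞 t) = 𝐞 (l s t) := by
  have hK : Continuous fun x : I × ℝ => φ x.1 (𝐞 x.2) :=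
    (continuous_homeo_eval Circle Circle).comp (hφ.prodMap Real.continuous_fourierChar)
  let g := isCoveringMap_fourierChar.liftHomotopy ⟨_, hK⟩ ⟨l₀, l₀.continuous⟩ h0
  have hg (s : I) (t : ℝ) : 𝐞 (g (s, t)) = φ s (𝐞 t) :=
    congrFun (isCoveringMap_fourierChar.liftHomotopy_lifts ⟨_, hK⟩ ⟨l₀, l₀.continuous⟩ h0) (s, t)
  have hg0 : ∀ t, g (0, t) = l₀ t :=
    isCoveringMap_fourierChar.liftHomotopy_zero ⟨_, hK⟩ ⟨l₀, l₀.continuous⟩ h0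
  choose l hl using exists_circleLift_of_homotopy g.continuous hg (s₀ := 0) (by
    have h1 := CircleDeg1Lift.map_add_one (l₀ : CircleDeg1Lift) 0
    rw [zero_add] at h1
    rw [hg0, hg0, h1, add_sub_cancel_left])
  refine ⟨l, CircleLift.continuous_of_uncurry ?_, CircleLift.ext fun t => by rw [← hl, hg0],
    fun s t => by rw [← hl, hg]⟩
  simpa only [← hl] using g.continuous

/-! ### The structure of planar homeomorphism groups -/

namespace PlanarHomeoGroup

variable {G : PlanarLieGroup.{u}} (H : PlanarHomeoGroup G)

theorem continuous_q : Continuous H.q := H.connective.isCoveringMap.continuous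

theorem continuous_incl : Continuous H.incl := (continuous_snd.comp H.isEmbedding.continuous :)

theorem q_incl_base (w : G.base) (t : ℝ) : H.q (H.incl w) (𝐞 t) = 𝐞 (G.sign (w : G) * t) := by
  rw [H.q_incl, G.toHomeo_base]

theorem q_mul_apply (g h : H) (z : Circle) : H.q (g * h) z = H.q g (H.q h z) := by
  rw [map_mul]; rfl

theorem eq_of_q_comp_eq {T : Type*} [TopologicalSpace T] [PreconnectedSpace T] {f g : T → H}
    (hf : Continuous f) (hg : Continuous g) (h : ∀ x t, H.q (f x) (𝐞 t) = H.q (g x) (𝐞 t)) (x₀ : T)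
    (h₀ : f x₀ = g x₀) (x : T) : f x = g x :=
  congrFun (H.connective.isCoveringMap.eq_of_comp_eq hf hg
    (funext fun x => homeo_ext (h x)) x₀ h₀) x

/-- The contraction of the space of lifts to the identity along segments, as a family of
homeomorphisms of the circle. -/
def contraction : C(I × CircleLift, Circle ≃ₜ Circle) :=
  ⟨fun x => CircleLift.toHomeo (CircleLift.segment 1 x.2 x.1),
    CircleLift.continuous_toHomeo.comp (CircleLift.continuous_segment.comp
      (f := fun x : I × CircleLift => ((1, x.2), x.1)) (by fun_prop))⟩

/-- The lift of `contraction` to the planar homeomorphism group which starts at `1`. -/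
def contractionLift : C(I × CircleLift, H) :=
  H.connective.isCoveringMap.liftHomotopy contraction (ContinuousMap.const _ 1)
    (fun l => by simp [contraction])

theorem q_contractionLift (x : I × CircleLift) : H.q (H.contractionLift x) = contraction x :=
  congrFun (H.connective.isCoveringMap.liftHomotopy_lifts contraction (ContinuousMap.const _ 1) _) x

theorem contractionLift_zero (l : CircleLift) : H.contractionLift (0, l) = 1 :=
  H.connective.isCoveringMap.liftHomotopy_zero contraction (ContinuousMap.const _ 1) _ l

theorem q_contractionLift_one (l : CircleLift) :
    H.q (H.contractionLift (1, l)) = CircleLift.toHomeo l := by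
  simp [q_contractionLift, contraction]

theorem contractionLift_one_one : H.contractionLift (1, 1) = 1 :=
  H.eq_of_q_comp_eq (f := fun s : I => H.contractionLift (s, 1)) (g := fun _ => 1) (by fun_prop)
    (by fun_prop) (fun s t => by simp [q_contractionLift, contraction]) 0
    (H.contractionLift_zero 1) 1

/-- The lift to `Homeo^G(S¹)` of the canonical homomorphism from the group of lifts, which is the
universal covering of the identity component of `Homeo(S¹)`. -/
def ofLift : CircleLift →* H where
  toFun l := H.contractionLift (1, l)
  map_one' := H.contractionLift_one_one
  map_mul' a b :=
    H.eq_of_q_comp_eq (f := fun x : CircleLift × CircleLift => H.contractionLift (1, x.1 * x.2))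
      (g := fun x => H.contractionLift (1, x.1) * H.contractionLift (1, x.2)) (by fun_prop)
      (by fun_prop) (fun x t => by simp [q_contractionLift_one]) (1, 1)
      (by simp [contractionLift_one_one]) (a, b)

theorem q_ofLift (l : CircleLift) (t : ℝ) : H.q (H.ofLift l) (𝐞 t) = 𝐞 (l t) :=
  (DFunLike.congr_fun (H.q_contractionLift_one l) _).trans (CircleLift.toHomeo_fourierChar l t)

theorem continuous_ofLift : Continuous H.ofLift :=
  H.contractionLift.continuous.comp (Continuous.prodMk_right 1)

theorem ofLift_translation (t : ℝ) : H.ofLift (CircleLift.translation t) = H.incl (G.e t) := by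
  have translation_zero : CircleLift.translation 0 = 1 := CircleLift.ext fun t => by simp
  refine H.eq_of_q_comp_eq (f := fun t => H.ofLift (CircleLift.translation t))
    (g := fun t => H.incl (G.e t)) (H.continuous_ofLift.comp CircleLift.continuous_translation)
    (H.continuous_incl.comp G.e.continuous) (fun t s => ?_) 0
    (by simp [translation_zero, G.e_zero]) t
  rw [q_ofLift, q_incl, G.p_e, CircleLift.translation_apply, add_comm,
    AddChar.map_add_eq_mul]
  exact (O2.act_rotation t (𝐞 s)).symm

theorem ofLift_mul_incl (l : CircleLift) (w : G.base) :
    H.ofLift l * H.incl w = H.incl w * H.ofLift (CircleLift.conj (G.sign (w : G)) l) := by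
  have conj_one : CircleLift.conj (G.sign (w : G)) 1 = 1 := CircleLift.ext fun t => by
    simp [CircleLift.conj_apply, units_mul_units_mul]
  exact H.eq_of_q_comp_eq (f := fun l => H.ofLift l * H.incl w)
    (g := fun l => H.incl w * H.ofLift (CircleLift.conj (G.sign (w : G)) l))
    (H.continuous_ofLift.mul continuous_const)
    (continuous_const.mul (H.continuous_ofLift.comp (CircleLift.continuous_conj _)))
    (fun l t => by simp only [q_mul_apply, q_incl_base, q_ofLift, CircleLift.conj_apply,
      units_mul_units_mul]) 1 (by simp [conj_one]) l

/-- The element `w ∘ l` of `Homeo^G(S¹)`. Every element has this form, uniquely up to moving full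
turns between `w` and `l`. -/
def ofPair (w : G.base) (l : CircleLift) : H := H.incl w * H.ofLift l

theorem q_ofPair (w : G.base) (l : CircleLift) (t : ℝ) :
    H.q (H.ofPair w l) (𝐞 t) = 𝐞 (G.sign (w : G) * l t) := by
  rw [ofPair, q_mul_apply, q_ofLift, q_incl_base]

theorem continuous_ofPair (w : G.base) : Continuous (H.ofPair w) :=
  continuous_const.mul H.continuous_ofLift

theorem ofPair_mul_ofPair (w w' : G.base) (l l' : CircleLift) :
    H.ofPair w' l' * H.ofPair w l =
      H.ofPair (w' * w) (CircleLift.conj (G.sign (w : G)) l' * l) := by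
  rw [ofPair, ofPair, ofPair, map_mul, Subgroup.coe_mul, map_mul, mul_assoc,
    ← mul_assoc (H.ofLift l'), ofLift_mul_incl, mul_assoc, mul_assoc]

theorem ofPair_one_one : H.ofPair 1 1 = 1 := by simp [ofPair]

theorem ofPair_translation (w : G.base) (t : ℝ) :
    H.ofPair w (CircleLift.translation t) = H.incl (w * G.e t) := by
  rw [ofPair, ofLift_translation, map_mul]

theorem exists_eq_ofPair (h : H) : ∃ w l, h = H.ofPair w l := by
  obtain ⟨ε, l, hl⟩ := exists_lift (H.q h)
  obtain ⟨A, hA, hε⟩ := O2.exists_act_one_sign_eq ε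
  have q_eq : O2.toHomeo A * H.q (H.ofLift (CircleLift.conj ε l)) = H.q h := by
    refine homeo_ext fun t => ?_
    change O2.act A (H.q _ (𝐞 t)) = _
    rw [hl, q_ofLift, O2.act_fourierChar_of_act_one hA, hε, CircleLift.conj_apply,
      units_mul_units_mul]
  obtain ⟨g, rfl, hg⟩ := H.exists_eq A (h * (H.ofLift (CircleLift.conj ε l))⁻¹)
    (by rw [map_mul, map_inv, ← q_eq, mul_inv_cancel_right])
  exact ⟨⟨g, hA⟩, CircleLift.conj ε l, by rw [ofPair, hg, inv_mul_cancel_right]⟩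

theorem ofPair_mul_turn (w : G.base) (l : CircleLift) (k : ℤ) :
    H.ofPair (w * G.turn k) l = H.ofPair w (CircleLift.translation k * l) := by
  rw [ofPair, ofPair, map_mul, ofLift_translation, Subgroup.coe_mul, map_mul, mul_assoc]; rfl

theorem exists_turn_of_ofPair_eq {w w' : G.base} {l l' : CircleLift}
    (h : H.ofPair w l = H.ofPair w' l') :
    ∃ k : ℤ, w' = w * G.turn k ∧ l = CircleLift.translation k * l' := by
  obtain ⟨hsign, k, hk⟩ := lift_unique (ε := G.sign (w : G)) (ε' := G.sign (w' : G))
    (l := CircleLift.conj (G.sign (w : G)) l) (l' := CircleLift.conj (G.sign (w' : G)) l')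
    fun t => by
      rw [CircleLift.conj_apply, CircleLift.conj_apply, units_mul_units_mul, units_mul_units_mul,
        ← q_ofPair, ← q_ofPair, h]
  obtain ⟨j, rfl⟩ : ∃ j : ℤ, l = CircleLift.translation j * l' := by
    refine ⟨G.sign (w : G) * k, CircleLift.ext fun t => ?_⟩
    have hkt := congrArg (fun a : CircleLift => (G.sign (w : G) * a (G.sign (w : G) * t) : ℝ)) hk
    simp only [CircleLift.mul_apply, CircleLift.conj_apply, CircleLift.translation_apply, ← hsign,
      mul_add, units_mul_units_mul] at hkt ⊢
    exact_mod_cast hkt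
  refine ⟨j, ?_, rfl⟩
  rw [← ofPair_mul_turn, ofPair, ofPair, mul_left_inj] at h
  have hp : G.p (w * G.turn j : G.base) = G.p w' :=
    O2.toHomeo_injective (by rw [← H.q_incl, ← H.q_incl, h])
  exact Subtype.ext (H.isEmbedding.injective (Prod.ext hp h)).symm

theorem exists_path_lift {γ : I → H} (hγ : Continuous γ) {w : G.base} {l₀ : CircleLift}
    (h0 : γ 0 = H.ofPair w l₀) :
    ∃ l : I → CircleLift, Continuous l ∧ l 0 = l₀ ∧ ∀ s, γ s = H.ofPair w (l s) := by
  obtain ⟨l, hl, hl0, h⟩ := exists_lift_of_path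
    (φ := fun s => H.q ((H.incl w)⁻¹ * γ s)) (l₀ := l₀)
    (H.continuous_q.comp (continuous_const.mul hγ))
    fun t => by rw [h0, ofPair, inv_mul_cancel_left, q_ofLift]
  refine ⟨l, hl, hl0, H.eq_of_q_comp_eq hγ ((H.continuous_ofPair w).comp hl) (fun s t => ?_) 0
    (by rw [h0, hl0])⟩
  rw [ofPair, H.q_mul_apply (H.incl w), q_ofLift, ← h, ← H.q_mul_apply,
    mul_inv_cancel_left]

end PlanarHomeoGroup

/-! ### Piecewise linear homeomorphisms of the line -/

/-- The piecewise linear function with the values `X j` at the integers `j`. -/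
def interpolation (X : ℤ → ℝ) (a : ℝ) : ℝ := X ⌊a⌋ + Int.fract a * (X (⌊a⌋ + 1) - X ⌊a⌋)

theorem interpolation_intCast (X : ℤ → ℝ) (j : ℤ) : interpolation X j = X j := by
  simp [interpolation]

theorem interpolation_add {X : ℤ → ℝ} {N : ℕ} (hp : ∀ j, X (j + N) = X j + 1) (a : ℝ) :
    interpolation X (a + N) = interpolation X a + 1 := by
  rw [interpolation, interpolation, Int.floor_add_natCast, Int.fract_add_natCast,
    add_right_comm ⌊a⌋, hp, hp]
  ring

theorem strictMono_interpolation {X : ℤ → ℝ} (hX : StrictMono X) :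
    StrictMono (interpolation X) := fun a b hab => by
  have hpos (j : ℤ) : 0 < X (j + 1) - X j := sub_pos.2 (hX (lt_add_one j))
  rcases (Int.floor_mono hab.le).eq_or_lt with h | h
  · have hfract : Int.fract a < Int.fract b := by
      rw [Int.fract, Int.fract, h]; linarith
    rw [interpolation, interpolation, h]
    linarith [mul_lt_mul_of_pos_right hfract (hpos ⌊b⌋)]
  · calc interpolation X a < X (⌊a⌋ + 1) := by
          rw [interpolation]
          linarith [mul_lt_mul_of_pos_right (Int.fract_lt_one a) (hpos ⌊a⌋)]
      _ ≤ X ⌊b⌋ := hX.monotone h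
      _ ≤ interpolation X b :=
          le_add_of_nonneg_right (mul_nonneg (Int.fract_nonneg b) (hpos _).le)

theorem exists_le_lt_succ {X : ℤ → ℝ} (hX : StrictMono X) {N : ℕ}
    (hp : ∀ j, X (j + N) = X j + 1) (v : ℝ) : ∃ j, X j ≤ v ∧ v < X (j + 1) := by
  have hmul (k : ℤ) : X (k * N) = X 0 + k := by
    simpa using AddConstMapClass.map_add_zsmul (⟨X, hp⟩ : AddConstMap ℤ ℝ N 1) 0 k
  obtain ⟨j, hj, hmax⟩ : ∃ j : ℤ, X j ≤ v ∧ ∀ z, X z ≤ v → z ≤ j := by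
    refine Int.exists_greatest_of_bdd ⟨⌈v - X 0⌉ * N, fun z hz => hX.le_iff_le.1 ?_⟩
      ⟨⌊v - X 0⌋ * N, ?_⟩
    · rw [hmul]
      linarith [Int.le_ceil (v - X 0)]
    · rw [hmul]
      linarith [Int.floor_le (v - X 0)]
  exact ⟨j, hj, not_le.1 fun h => by linarith [hmax _ h]⟩

theorem surjective_interpolation {X : ℤ → ℝ} (hX : StrictMono X) {N : ℕ}
    (hp : ∀ j, X (j + N) = X j + 1) : Function.Surjective (interpolation X) := fun v => by
  obtain ⟨j, hj, hj'⟩ := exists_le_lt_succ hX hp v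
  have hpos : 0 < X (j + 1) - X j := by linarith
  have hfloor : ⌊(j : ℝ) + (v - X j) / (X (j + 1) - X j)⌋ = j :=
    Int.floor_eq_iff.2 ⟨le_add_of_nonneg_right (div_nonneg (sub_nonneg.2 hj) hpos.le),
      add_lt_add_right ((div_lt_one hpos).2 (by linarith)) _⟩
  refine ⟨j + (v - X j) / (X (j + 1) - X j), ?_⟩
  rw [interpolation, Int.fract, hfloor, add_sub_cancel_left, div_mul_cancel₀ _ hpos.ne']
  ring

theorem CircleLift.exists_interpolation {N : ℕ} (hN : 0 < N) {X : ℤ → ℝ} (hX : StrictMono X)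
    (hp : ∀ j, X (j + N) = X j + 1) : ∃ l : CircleLift, ∀ j : ℤ, l (j / N) = X j := by
  have hN' : (0 : ℝ) < N := Nat.cast_pos.2 hN
  obtain ⟨l, hl⟩ := exists_coe_eq_of_surjective (g := fun t => interpolation X (t * N))
    (fun a b hab => strictMono_interpolation hX (mul_lt_mul_of_pos_right hab hN'))
    ((surjective_interpolation hX hp).comp (mul_right_surjective₀ hN'.ne'))
    (fun t => by rw [add_mul, one_mul, interpolation_add hp])
  exact ⟨l, fun j => by rw [hl, div_mul_cancel₀ _ hN'.ne', interpolation_intCast]⟩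

/-! ### Markings of the circle and labels -/

/-- A subset `S` of the circle is an `n`-marking if it contains the `(n + 1)`-st roots of unity, and
every point of the preimage of `S` in the line can be joined inside this preimage with exactly one
point of `ℤ / (n + 1)`. -/
structure IsMarking (n : ℕ) (S : Set Circle) : Prop where
  root_mem : ∀ j : ℤ, 𝐞 (j / (n + 1)) ∈ S
  existsUnique : ∀ t, 𝐞 t ∈ S → ∃! j : ℤ, ∀ u ∈ Set.uIcc t (j / (n + 1)), 𝐞 u ∈ S

open Classical in
/-- The number `j` of the component of the preimage of an `n`-marking in the line which contains
`t`, namely the component of `j / (n + 1)`. The value is `0` if there is no such component. -/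
def label (n : ℕ) (S : Set Circle) (t : ℝ) : ℤ :=
  if h : ∃ j : ℤ, ∀ u ∈ Set.uIcc t (j / (n + 1)), 𝐞 u ∈ S then h.choose else 0

namespace IsMarking

variable {n : ℕ} {S : Set Circle}

theorem fourierChar_mem_of_mem_uIcc_label (hS : IsMarking n S) {t : ℝ} (ht : 𝐞 t ∈ S) :
    ∀ u ∈ Set.uIcc t (label n S t / (n + 1)), 𝐞 u ∈ S := by
  have h := (hS.existsUnique t ht).exists
  rw [label, dif_pos h]
  exact h.choose_spec

theorem label_eq (hS : IsMarking n S) {t : ℝ} {j : ℤ}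
    (h : ∀ u ∈ Set.uIcc t (j / (n + 1)), 𝐞 u ∈ S) : label n S t = j :=
  have ht : 𝐞 t ∈ S := h t Set.left_mem_uIcc
  (hS.existsUnique t ht).unique (hS.fourierChar_mem_of_mem_uIcc_label ht) h

theorem label_root (hS : IsMarking n S) (j : ℤ) : label n S (j / (n + 1)) = j :=
  hS.label_eq fun u hu => by
    rw [Set.uIcc_self, Set.mem_singleton_iff] at hu
    exact hu ▸ hS.root_mem j

theorem label_eq_label (hS : IsMarking n S) {s t : ℝ} (h : ∀ u ∈ Set.uIcc s t, 𝐞 u ∈ S) :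
    label n S s = label n S t :=
  hS.label_eq fun u hu =>
    (Set.uIcc_subset_uIcc_union_uIcc hu).elim (h u)
      (hS.fourierChar_mem_of_mem_uIcc_label (h t Set.right_mem_uIcc) u)

theorem fourierChar_mem_of_label_eq (hS : IsMarking n S) {s t : ℝ} (hs : 𝐞 s ∈ S) (ht : 𝐞 t ∈ S)
    (h : label n S s = label n S t) : ∀ u ∈ Set.uIcc s t, 𝐞 u ∈ S := fun u hu => by
  rcases Set.uIcc_subset_uIcc_union_uIcc (b := (label n S s / (n + 1) : ℝ)) hu with hu | hu
  · exact hS.fourierChar_mem_of_mem_uIcc_label hs u hu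
  · rw [h, Set.uIcc_comm] at hu
    exact hS.fourierChar_mem_of_mem_uIcc_label ht u hu

theorem label_add_intCast (hS : IsMarking n S) {t : ℝ} (ht : 𝐞 t ∈ S) (k : ℤ) :
    label n S (t + k) = label n S t + k * (n + 1) := hS.label_eq fun u hu => by
  have hroot : ((label n S t + k * (n + 1) : ℤ) : ℝ) / (n + 1) = label n S t / (n + 1) + k := by
    push_cast; field_simp
  rw [hroot, ← Set.image_add_const_uIcc] at hu
  obtain ⟨v, hv, rfl⟩ := hu
  rw [fourierChar_add_intCast]
  exact hS.fourierChar_mem_of_mem_uIcc_label ht v hv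

theorem label_mono (hS : IsMarking n S) {s t : ℝ} (hs : 𝐞 s ∈ S) (ht : 𝐞 t ∈ S) (hst : s ≤ t) :
    label n S s ≤ label n S t := by
  by_contra hlt
  have hroot : (label n S t / (n + 1) : ℝ) < label n S s / (n + 1) :=
    div_lt_div_of_pos_right (by exact_mod_cast not_le.1 hlt) (by positivity)
  have hs' := hS.fourierChar_mem_of_mem_uIcc_label hs
  have ht' := hS.fourierChar_mem_of_mem_uIcc_label ht
  generalize (label n S s / (n + 1) : ℝ) = b at *
  generalize (label n S t / (n + 1) : ℝ) = a at *
  obtain ⟨v, hv, hv'⟩ : ∃ v, v ∈ Set.uIcc s b ∧ v ∈ Set.uIcc t a := by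
    refine ⟨max (min s b) (min t a), ?_, ?_⟩ <;> rw [Set.mem_uIcc] <;> grind
  have hsv : label n S s = label n S v :=
    hS.label_eq_label fun u hu => hs' u (Set.uIcc_subset_uIcc_left hv hu)
  have htv : label n S t = label n S v :=
    hS.label_eq_label fun u hu => ht' u (Set.uIcc_subset_uIcc_left hv' hu)
  omega

end IsMarking

/-! ### The class of a homeomorphism in the crossed simplicial group -/

namespace CircleLift

theorem exists_mem_uIcc_eq (ε : ℤˣ) (l : CircleLift) {s t u : ℝ}
    (hu : u ∈ Set.uIcc (ε * l s : ℝ) (ε * l t)) : ∃ v ∈ Set.uIcc s t, ε * l v = u :=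
  intermediate_value_uIcc (f := fun v => (ε * l v : ℝ)) (by fun_prop) hu

theorem mul_segment_mem_uIcc (ε : ℤˣ) (a b : CircleLift) (s : I) (t : ℝ) :
    (ε * segment a b s t : ℝ) ∈ Set.uIcc (ε * a t : ℝ) (ε * b t) := by
  rw [← Set.image_const_mul_uIcc]
  exact Set.mem_image_of_mem _ (segment_mem_uIcc a b s t)

/-- The paracyclic morphism `f : [m] ⟶ [n]` records the components of the preimage of `S` in the
line which contain the points `ε * l (j / (m + 1))`. For `ε = -1` the signs are chosen so that `f`
is increasing. -/
def HasLabels (m n : ℕ) (S : Set Circle) (ε : ℤˣ) (l : CircleLift) (f : Para m n) : Prop :=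
  ∀ j : ℤ, f j = ε * label n S (ε * l (j / (m + 1)))

variable {m n : ℕ} {S : Set Circle} {ε : ℤˣ} {l : CircleLift} {f : Para m n}

theorem HasLabels.label_eq (hf : HasLabels m n S ε l f) (j : ℤ) :
    label n S (ε * l (j / (m + 1))) = ε * f j := by
  rw [hf, DeltaG.sign_mul_sign_mul]

theorem HasLabels.translation_mul (hS : IsMarking n S) (hf : HasLabels m n S ε l f)
    (hl : ∀ j : ℤ, 𝐞 (ε * l (j / (m + 1))) ∈ S) (k : ℤ) :
    HasLabels m n S ε (translation k * l) (Para.shift k f) := fun j => by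
  rw [Para.shift_apply, hf, mul_apply, translation_apply, mul_add (ε : ℝ), ← Int.cast_mul,
    hS.label_add_intCast (hl j), mul_add (ε : ℤ), mul_assoc, DeltaG.sign_mul_sign_mul]

theorem exists_hasLabels (hS : IsMarking n S) (hl : ∀ j : ℤ, 𝐞 (ε * l (j / (m + 1))) ∈ S) :
    ∃ f : Para m n, HasLabels m n S ε l f := by
  refine ⟨⟨fun j => ε * label n S (ε * l (j / (m + 1))), fun a b hab => ?_, fun j => ?_⟩,
    fun j => rfl⟩
  · have hle : l (a / (m + 1)) ≤ l (b / (m + 1)) :=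
      l.strictMono.monotone (div_le_div_of_nonneg_right (Int.cast_le.2 hab) (by positivity))
    have ha := hl a
    have hb := hl b
    rcases Int.units_eq_one_or ε with rfl | rfl
    · simp only [Units.val_one, Int.cast_one, one_mul] at ha hb ⊢
      exact hS.label_mono ha hb hle
    · simp only [Units.val_neg, Units.val_one, Int.cast_neg, Int.cast_one, neg_mul, one_mul]
        at ha hb ⊢
      exact neg_le_neg (hS.label_mono hb ha (neg_le_neg hle))
  · have hroot : (((j + (m + 1) : ℤ) : ℝ) / (m + 1)) = j / (m + 1) + (1 : ℤ) := by
      push_cast; field_simp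
    rw [hroot, CircleDeg1Lift.map_add_int, mul_add, ← Int.cast_mul, mul_one,
      hS.label_add_intCast (hl j), mul_add, DeltaG.sign_mul_sign_mul]

end CircleLift

namespace PlanarHomeoGroup

open CircleLift

variable {G : PlanarLieGroup.{u}} (H : PlanarHomeoGroup G)

/-- The image of the `(m + 1)`-st roots of unity under `h` is contained in `S`. -/
def MapsRoots (m : ℕ) (S : Set Circle) (h : H) : Prop := ∀ j : ℤ, H.q h (𝐞 (j / (m + 1))) ∈ S

variable {H} {m n k : ℕ} {S S' A : Set Circle} {w : G.base} {l : CircleLift}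

theorem sign_mul_turn (w : G.base) (k : ℤ) :
    G.sign ((w * G.turn k : G.base) : G) = G.sign (w : G) := by
  rw [Subgroup.coe_mul, map_mul, G.sign_turn, mul_one]

theorem MapsRoots.mem (h : H.MapsRoots m S (H.ofPair w l)) (j : ℤ) :
    𝐞 (G.sign (w : G) * l (j / (m + 1))) ∈ S := by
  rw [← q_ofPair]; exact h j

variable (H m n S) in
/-- The morphism `[m] ⟶ [n]` of `ΔG` defined by an element `h = w ∘ l` of the planar homeomorphism
group which maps the roots of unity to a marking `S`: the class of `w` and of the labels of the
images of the roots under `l`. Its value is arbitrary for all other `h`. -/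
def homClass (h : H) : DeltaG.Hom G m n :=
  have : Nonempty (DeltaG.Hom G m n) := ⟨DeltaG.ofOrderHom (OrderHom.const _ 0)⟩
  Classical.epsilon fun v => ∃ w l f, h = H.ofPair w l ∧ HasLabels m n S (G.sign (w : G)) l f ∧
    v = DeltaG.cls w f

theorem homClass_ofPair (hS : IsMarking n S) (h : H.MapsRoots m S (H.ofPair w l)) {f : Para m n}
    (hf : HasLabels m n S (G.sign (w : G)) l f) :
    H.homClass m n S (H.ofPair w l) = DeltaG.cls w f := by
  obtain ⟨w', l', f', hpair, hf', hcls⟩ := Classical.epsilon_spec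
    (p := fun v => ∃ w' l' f', H.ofPair w l = H.ofPair w' l' ∧
      HasLabels m n S (G.sign (w' : G)) l' f' ∧ v = DeltaG.cls w' f') ⟨_, w, l, f, rfl, hf, rfl⟩
  refine hcls.trans (Eq.symm ?_)
  obtain ⟨k, rfl, rfl⟩ := H.exists_turn_of_ofPair_eq hpair
  rw [hpair] at h
  have hmem := h.mem
  rw [sign_mul_turn] at hf' hmem
  refine DeltaG.cls_eq_iff.2 ⟨k, rfl, Para.ext' fun j => ?_⟩
  rw [hf, hf'.translation_mul hS hmem k]

theorem exists_homClass_eq (hS : IsMarking n S) (h : H) (hh : H.MapsRoots m S h) :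
    ∃ w l f, h = H.ofPair w l ∧ HasLabels m n S (G.sign (w : G)) l f ∧
      H.homClass m n S h = DeltaG.cls w f := by
  obtain ⟨w, l, rfl⟩ := H.exists_eq_ofPair h
  obtain ⟨f, hf⟩ := exists_hasLabels hS hh.mem
  exact ⟨w, l, f, rfl, hf, homClass_ofPair hS hh hf⟩

theorem label_eq_of_mapsTo (hS : IsMarking n S) (hA : Set.MapsTo (H.q (H.ofPair w l)) A S)
    {s t : ℝ} (h : ∀ u ∈ Set.uIcc s t, 𝐞 u ∈ A) :
    label n S (G.sign (w : G) * l s) = label n S (G.sign (w : G) * l t) :=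
  hS.label_eq_label fun u hu => by
    obtain ⟨v, hv, rfl⟩ := exists_mem_uIcc_eq _ _ hu
    rw [← q_ofPair]
    exact hA (h v hv)

theorem homClass_mul (hS : IsMarking n S) (hS' : IsMarking k S') {h h' : H}
    (hh : H.MapsRoots m S h) (hh' : Set.MapsTo (H.q h') S S') :
    H.homClass m k S' (h' * h) = DeltaG.comp (H.homClass m n S h) (H.homClass n k S' h') := by
  have roots_h' : H.MapsRoots n S' h' := fun j => hh' (hS.root_mem j)
  have roots_mul : H.MapsRoots m S' (h' * h) := fun j => by
    rw [q_mul_apply]; exact hh' (hh j)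
  obtain ⟨w, l, f, rfl, hf, hcls⟩ := exists_homClass_eq hS h hh
  obtain ⟨w', l', f', rfl, hf', hcls'⟩ := exists_homClass_eq hS' h' roots_h'
  rw [hcls, hcls', DeltaG.comp_cls]
  rw [ofPair_mul_ofPair] at roots_mul ⊢
  refine homClass_ofPair hS' roots_mul fun j => ?_
  have hsign : G.sign ((w' * w : G.base) : G) = G.sign (w : G) * G.sign (w' : G) := by
    rw [Subgroup.coe_mul, map_mul, mul_comm]
  have hlabel := label_eq_of_mapsTo hS' hh' (hS.fourierChar_mem_of_mem_uIcc_label (hh.mem j))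
  rw [hf.label_eq] at hlabel
  rw [Para.comp_apply, Para.conj_apply, hf', hsign, ← hlabel, CircleLift.mul_apply,
    CircleLift.conj_apply, Units.val_mul, Int.cast_mul, mul_assoc, mul_assoc,
    mul_left_comm (((G.sign (w : G) : ℤˣ) : ℤ) : ℝ), units_mul_units_mul]

theorem homClass_one (hS : IsMarking n S) : H.homClass n n S 1 = DeltaG.idHom n := by
  rw [← H.ofPair_one_one]
  refine homClass_ofPair hS (fun j => ?_) fun j => ?_
  · rw [ofPair_one_one, map_one]; exact hS.root_mem j
  · simp [hS.label_root]

theorem homClass_eq_of_path (hS : IsMarking n S) {γ : I → H} (hγ : Continuous γ)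
    (h : ∀ s, H.MapsRoots m S (γ s)) : H.homClass m n S (γ 0) = H.homClass m n S (γ 1) := by
  obtain ⟨w, l₀, f, h0, hf, hcls⟩ := exists_homClass_eq hS (γ 0) (h 0)
  obtain ⟨l, hl, rfl, hγl⟩ := exists_path_lift H hγ h0
  simp only [hγl] at h hcls ⊢
  rw [hcls]
  refine (homClass_ofPair hS (h 1) fun j => ?_).symm
  rw [hf]
  congr 1
  refine hS.label_eq_label fun u hu => ?_
  have hc : Continuous fun s => (G.sign (w : G) * l s (j / (m + 1)) : ℝ) := by fun_prop
  obtain ⟨s, rfl⟩ := (isPreconnected_range hc).ordConnected.uIcc_subset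
    (Set.mem_range_self 0) (Set.mem_range_self 1) hu
  exact (h s).mem j

theorem exists_pairs_of_homClass_eq (hS : IsMarking n S) {h h' : H} (hh : H.MapsRoots m S h)
    (hh' : H.MapsRoots m S h') (heq : H.homClass m n S h = H.homClass m n S h') :
    ∃ w l l' f, h = H.ofPair w l ∧ h' = H.ofPair w l' ∧ HasLabels m n S (G.sign (w : G)) l f ∧
      HasLabels m n S (G.sign (w : G)) l' f := by
  obtain ⟨w, l, f, rfl, hf, hcls⟩ := exists_homClass_eq hS h hh
  obtain ⟨w', l', f', rfl, hf', hcls'⟩ := exists_homClass_eq hS h' hh'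
  rw [hcls, hcls', DeltaG.cls_eq_iff] at heq
  obtain ⟨k, rfl, rfl⟩ := heq
  have hmem := hh'.mem
  rw [sign_mul_turn] at hf' hmem
  exact ⟨w, l, _, _, rfl, H.ofPair_mul_turn w l' k, hf, hf'.translation_mul hS hmem k⟩

/-- Elements with the same class lift to maps which send every component of the preimage of `A` to
the same component of the preimage of `S`, and so does the segment between these lifts. -/
theorem exists_path_of_homClass_eq (hS : IsMarking n S) (hA : ∀ j : ℤ, 𝐞 (j / (m + 1)) ∈ A)
    (hA' : ∀ t, 𝐞 t ∈ A → ∃ j : ℤ, ∀ u ∈ Set.uIcc t (j / (m + 1)), 𝐞 u ∈ A) {h h' : H}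
    (hh : Set.MapsTo (H.q h) A S) (hh' : Set.MapsTo (H.q h') A S)
    (heq : H.homClass m n S h = H.homClass m n S h') :
    ∃ γ : Path h h', ∀ s,
      Set.MapsTo (H.q (γ s)) A S ∧ H.homClass m n S (γ s) = H.homClass m n S h := by
  have hr : H.MapsRoots m S h := fun j => hh (hA j)
  obtain ⟨w, l, l', f, rfl, rfl, hf, hf'⟩ :=
    exists_pairs_of_homClass_eq hS hr (fun j => hh' (hA j)) heq
  have label_eq (t : ℝ) (ht : 𝐞 t ∈ A) :
      label n S (G.sign (w : G) * l t) = label n S (G.sign (w : G) * l' t) := by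
    obtain ⟨j, hj⟩ := hA' t ht
    rw [label_eq_of_mapsTo hS hh hj, label_eq_of_mapsTo hS hh' hj, hf.label_eq, hf'.label_eq]
  have mem_of_mem_uIcc (s : I) (t : ℝ) (ht : 𝐞 t ∈ A) :
      ∀ u ∈ Set.uIcc (G.sign (w : G) * l t : ℝ) (G.sign (w : G) * segment l l' s t), 𝐞 u ∈ S :=
    fun u hu => by
      have hl := hh ht
      have hl' := hh' ht
      rw [q_ofPair] at hl hl'
      exact hS.fourierChar_mem_of_label_eq hl hl' (label_eq t ht) u
        (Set.uIcc_subset_uIcc_left (mul_segment_mem_uIcc _ l l' s t) hu)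
  have mapsTo (s : I) : Set.MapsTo (H.q (H.ofPair w (segment l l' s))) A S := fun z hz => by
    obtain ⟨t, rfl⟩ := fourierChar_surjective z
    rw [q_ofPair]
    exact mem_of_mem_uIcc s t hz _ Set.right_mem_uIcc
  refine ⟨(segmentPath l l').map (H.continuous_ofPair w), fun s => ⟨mapsTo s, ?_⟩⟩
  rw [homClass_ofPair hS hr hf]
  refine homClass_ofPair hS (fun j => mapsTo s (hA j)) fun j => ?_
  rw [hf, hS.label_eq_label (mem_of_mem_uIcc s _ (hA j))]

end PlanarHomeoGroup

/-! ### Markings with nondegenerate closed components -/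

/-- The component of `j / (n + 1)` in the preimage of an `n`-marking `S` in the line. -/
def labelFiber (n : ℕ) (S : Set Circle) (j : ℤ) : Set ℝ := {t | 𝐞 t ∈ S ∧ label n S t = j}

theorem IsMarking.root_mem_labelFiber {n : ℕ} {S : Set Circle} (hS : IsMarking n S) (j : ℤ) :
    (j / (n + 1) : ℝ) ∈ labelFiber n S j := ⟨hS.root_mem j, hS.label_root j⟩

theorem IsMarking.isConnected_labelFiber {n : ℕ} {S : Set Circle} (hS : IsMarking n S) (j : ℤ) :
    _root_.IsConnected (labelFiber n S j) := by
  refine ⟨⟨_, hS.root_mem_labelFiber j⟩, Set.OrdConnected.isPreconnected ?_⟩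
  refine Set.ordConnected_of_uIcc_subset_left (x := j / (n + 1)) fun t ht u hu => ?_
  have mem : ∀ v ∈ Set.uIcc (j / (n + 1) : ℝ) t, 𝐞 v ∈ S :=
    hS.fourierChar_mem_of_label_eq (hS.root_mem j) ht.1 ((hS.label_root j).trans ht.2.symm)
  refine ⟨mem u hu, hS.label_eq fun v hv => mem v (Set.uIcc_subset_uIcc_left hu ?_)⟩
  rwa [Set.uIcc_comm]

/-- A marking which is closed and such that no component is a point. -/
structure IsFatMarking (n : ℕ) (S : Set Circle) : Prop extends IsMarking n S where
  isClosed : IsClosed S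
  exists_ne : ∀ t, 𝐞 t ∈ S → ∃ t', t' ≠ t ∧ ∀ u ∈ Set.uIcc t t', 𝐞 u ∈ S

/-- The left end of the component of `j / (n + 1)` in the preimage of a marking. -/
def leftEnd (n : ℕ) (S : Set Circle) (j : ℤ) : ℝ := sInf (labelFiber n S j)

/-- The right end of the component of `j / (n + 1)` in the preimage of a marking. -/
def rightEnd (n : ℕ) (S : Set Circle) (j : ℤ) : ℝ := sSup (labelFiber n S j)

/-- The midpoint of the component of `j / (n + 1)` in the preimage of a marking. -/
def center (n : ℕ) (S : Set Circle) (j : ℤ) : ℝ := (leftEnd n S j + rightEnd n S j) / 2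

/-- Half of the length of the component of `j / (n + 1)` in the preimage of a marking. -/
def radius (n : ℕ) (S : Set Circle) (j : ℤ) : ℝ := (rightEnd n S j - leftEnd n S j) / 2

/-- The increasing sequence of all ends of components of the preimage of a marking. -/
def endpoint (n : ℕ) (S : Set Circle) (i : ℤ) : ℝ :=
  if Even i then leftEnd n S (i / 2) else rightEnd n S (i / 2)

theorem endpoint_two_mul (n : ℕ) (S : Set Circle) (j : ℤ) :
    endpoint n S (2 * j) = leftEnd n S j := by
  rw [endpoint, if_pos (even_two_mul j), Int.mul_ediv_cancel_left j two_ne_zero]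

theorem endpoint_two_mul_add_one (n : ℕ) (S : Set Circle) (j : ℤ) :
    endpoint n S (2 * j + 1) = rightEnd n S j := by
  rw [endpoint, if_neg (Int.not_even_two_mul_add_one j), show (2 * j + 1) / 2 = j by lia]

namespace IsFatMarking

variable {n : ℕ} {S : Set Circle}

theorem isClosed_labelFiber (hS : IsFatMarking n S) (j : ℤ) : IsClosed (labelFiber n S j) := by
  refine isClosed_of_closure_subset fun t ht => ?_
  have mem : ∀ u ∈ closure (labelFiber n S j), 𝐞 u ∈ S :=
    closure_minimal (fun u hu => hu.1) (hS.isClosed.preimage Real.continuous_fourierChar)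
  refine ⟨mem t ht, hS.label_eq fun u hu => mem u ?_⟩
  exact (hS.isConnected_labelFiber j).closure.isPreconnected.ordConnected.uIcc_subset ht
    (subset_closure (hS.root_mem_labelFiber j)) hu

theorem isCompact_labelFiber (hS : IsFatMarking n S) (j : ℤ) : IsCompact (labelFiber n S j) := by
  refine (isCompact_Icc (a := ((j - 1 : ℤ) / (n + 1) : ℝ)) (b := ((j + 1 : ℤ) / (n + 1)))
    ).of_isClosed_subset (hS.isClosed_labelFiber j) fun t ht => ⟨?_, ?_⟩
  · by_contra! hlt
    have hle := hS.label_mono ht.1 (hS.root_mem (j - 1)) hlt.le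
    rw [hS.label_root, ht.2] at hle
    lia
  · by_contra! hlt
    have hle := hS.label_mono (hS.root_mem (j + 1)) ht.1 hlt.le
    rw [hS.label_root, ht.2] at hle
    lia

theorem labelFiber_eq_Icc (hS : IsFatMarking n S) (j : ℤ) :
    labelFiber n S j = Set.Icc (leftEnd n S j) (rightEnd n S j) :=
  eq_Icc_of_connected_compact (hS.isConnected_labelFiber j) (hS.isCompact_labelFiber j)

theorem leftEnd_lt_rightEnd (hS : IsFatMarking n S) (j : ℤ) : leftEnd n S j < rightEnd n S j := by
  obtain ⟨t, ht_ne, ht⟩ := hS.exists_ne _ (hS.root_mem j)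
  have hroot := hS.root_mem_labelFiber j
  have ht' : t ∈ labelFiber n S j :=
    ⟨ht t Set.right_mem_uIcc, by rw [← hS.label_eq_label ht, hS.label_root]⟩
  rw [hS.labelFiber_eq_Icc] at hroot ht'
  exact (hroot.1.trans hroot.2).lt_of_ne fun heq =>
    ht_ne (by linarith [hroot.1, hroot.2, ht'.1, ht'.2])

theorem rightEnd_lt_leftEnd (hS : IsFatMarking n S) {i j : ℤ} (hij : i < j) :
    rightEnd n S i < leftEnd n S j := by
  have hi : rightEnd n S i ∈ labelFiber n S i :=
    hS.labelFiber_eq_Icc i ▸ Set.right_mem_Icc.2 (hS.leftEnd_lt_rightEnd i).le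
  have hj : leftEnd n S j ∈ labelFiber n S j :=
    hS.labelFiber_eq_Icc j ▸ Set.left_mem_Icc.2 (hS.leftEnd_lt_rightEnd j).le
  by_contra! hle
  have hlabel := hS.label_mono hj.1 hi.1 hle
  rw [hi.2, hj.2] at hlabel
  lia

theorem ends_add (hS : IsFatMarking n S) (j k : ℤ) :
    leftEnd n S (j + k * (n + 1)) = leftEnd n S j + k ∧
      rightEnd n S (j + k * (n + 1)) = rightEnd n S j + k := by
  refine (Set.Icc_eq_Icc_iff (hS.leftEnd_lt_rightEnd _).le).1 ?_
  rw [← Set.image_add_const_Icc, ← hS.labelFiber_eq_Icc, ← hS.labelFiber_eq_Icc]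
  ext t
  rw [Set.image_add_right, Set.mem_preimage, ← Int.cast_neg]
  change _ ∧ _ ↔ _ ∧ _
  rw [fourierChar_add_intCast]
  refine and_congr_right fun ht => ?_
  rw [hS.label_add_intCast ht, neg_mul, ← sub_eq_add_neg, sub_eq_iff_eq_add]

theorem radius_pos (hS : IsFatMarking n S) (j : ℤ) : 0 < radius n S j :=
  half_pos (sub_pos.2 (hS.leftEnd_lt_rightEnd j))

theorem center_mono (hS : IsFatMarking n S) : Monotone (center n S) :=
  monotone_int_of_le_succ fun j => by
    rw [center, center]
    linarith [hS.leftEnd_lt_rightEnd j, hS.rightEnd_lt_leftEnd (lt_add_one j),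
      hS.leftEnd_lt_rightEnd (j + 1)]

theorem center_add (hS : IsFatMarking n S) (j k : ℤ) :
    center n S (j + k * (n + 1)) = center n S j + k := by
  rw [center, center, (hS.ends_add j k).1, (hS.ends_add j k).2]
  ring

theorem radius_add (hS : IsFatMarking n S) (j k : ℤ) :
    radius n S (j + k * (n + 1)) = radius n S j := by
  rw [radius, radius, (hS.ends_add j k).1, (hS.ends_add j k).2, add_sub_add_right_eq_sub]

theorem mem_labelFiber_of_abs_le (hS : IsFatMarking n S) {j : ℤ} {t : ℝ}
    (h : |t - center n S j| ≤ radius n S j) : t ∈ labelFiber n S j := by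
  rw [hS.labelFiber_eq_Icc]
  rw [abs_le, center, radius] at h
  constructor <;> linarith

theorem strictMono_endpoint (hS : IsFatMarking n S) : StrictMono (endpoint n S) :=
  strictMono_int_of_lt_succ fun i => by
    obtain ⟨j, rfl | rfl⟩ := Int.even_or_odd' i
    · rw [endpoint_two_mul, endpoint_two_mul_add_one]
      exact hS.leftEnd_lt_rightEnd j
    · rw [endpoint_two_mul_add_one, show 2 * j + 1 + 1 = 2 * (j + 1) by ring, endpoint_two_mul]
      exact hS.rightEnd_lt_leftEnd (lt_add_one j)

theorem endpoint_add (hS : IsFatMarking n S) (i : ℤ) :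
    endpoint n S (i + (2 * (n + 1) : ℕ)) = endpoint n S i + 1 := by
  push_cast
  obtain ⟨j, rfl | rfl⟩ := Int.even_or_odd' i
  · rw [show 2 * j + 2 * (n + 1 : ℤ) = 2 * (j + 1 * (n + 1)) by ring, endpoint_two_mul,
      endpoint_two_mul, (hS.ends_add j 1).1, Int.cast_one]
  · rw [show 2 * j + 1 + 2 * (n + 1 : ℤ) = 2 * (j + 1 * (n + 1)) + 1 by ring,
      endpoint_two_mul_add_one, endpoint_two_mul_add_one, (hS.ends_add j 1).2, Int.cast_one]

end IsFatMarking

theorem exists_pos_mul_le_of_periodic {N : ℕ} (hN : 0 < N) {D R : ℤ → ℝ} (hR : ∀ i, 0 < R i)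
    (hD : Function.Periodic D N) (hR' : Function.Periodic R N) :
    ∃ δ : ℝ, 0 < δ ∧ δ < 1 ∧ ∀ i, δ * D i ≤ R i := by
  have eventually_lt (i : ℤ) : ∀ᶠ δ in 𝓝[>] (0 : ℝ), δ * D i < R i := by
    have hlim : Tendsto (fun δ => δ * D i) (𝓝[>] (0 : ℝ)) (𝓝 (0 * D i)) :=
      (continuous_mul_const (D i)).continuousWithinAt
    exact hlim.eventually_lt_const (by simpa using hR i)
  obtain ⟨δ, hδ, hδ0, hδ1⟩ :=
    (((Finset.Ico (0 : ℤ) N).eventually_all.2 fun i _ => eventually_lt i).and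
      (Ioo_mem_nhdsGT (zero_lt_one' ℝ))).exists
  refine ⟨δ, hδ0, hδ1, fun i => ?_⟩
  have hper : Function.Periodic (fun i => δ * D i - R i) N := fun i => by
    simp only [hD i, hR' i]
  obtain ⟨j, hj, hij⟩ := hper.exists_mem_Ico₀ (Int.natCast_pos.2 hN) i
  exact sub_nonpos.1 (hij.trans_le (sub_nonpos.2 (hδ j (Finset.mem_Ico.2 hj)).le))

theorem CircleLift.exists_abs_sub_le {N : ℕ} (hN : 0 < N) {X Y R : ℤ → ℝ} (hX : StrictMono X)
    (hXN : ∀ i, X (i + N) = X i + 1) (hY : Monotone Y) (hYN : ∀ i, Y (i + N) = Y i + 1)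
    (hR : ∀ i, 0 < R i) (hRN : Function.Periodic R N) :
    ∃ l : CircleLift, ∀ i, |l (X i) - Y i| ≤ R i := by
  obtain ⟨δ, hδ0, hδ1, hδ⟩ := exists_pos_mul_le_of_periodic hN (D := fun i => |X i - Y i|) hR
    (fun i => by simp only [hXN, hYN, add_sub_add_right_eq_sub]) hRN
  -- Moving `Y` slightly towards `X` makes it strictly monotone.
  obtain ⟨l₁, hl₁⟩ := exists_interpolation hN hX hXN
  obtain ⟨l₂, hl₂⟩ := exists_interpolation hN (X := fun i => (1 - δ) * Y i + δ * X i)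
    ((hY.const_mul (sub_nonneg.2 hδ1.le)).add_strictMono (hX.const_mul hδ0))
    (fun i => by rw [hXN, hYN]; ring)
  refine ⟨l₂ * l₁⁻¹, fun i => ?_⟩
  have hdiff : (l₂ * l₁⁻¹) (X i) - Y i = δ * (X i - Y i) := by
    rw [mul_apply, ← hl₁ i, CircleDeg1Lift.units_inv_apply_apply, hl₂, hl₁]
    ring
  rw [hdiff, abs_mul, abs_of_pos hδ0]
  exact hδ i

theorem monotone_units_mul_comp_units_mul {g : ℤ → ℝ} (hg : Monotone g) (ε : ℤˣ) :
    Monotone fun j : ℤ => (ε * g (ε * j) : ℝ) := by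
  rcases Int.units_eq_one_or ε with rfl | rfl
  · simpa using hg
  · intro i j hij
    simpa using hg (neg_le_neg hij)

theorem abs_units_mul (ε : ℤˣ) (t : ℝ) : |(ε * t : ℝ)| = |t| := by
  rcases Int.units_eq_one_or ε with rfl | rfl <;> simp

namespace IsFatMarking

open CircleLift

variable {m n : ℕ} {A S : Set Circle}

theorem exists_abs_sub_center_le (hA : IsFatMarking m A) (hS : IsFatMarking n S) (ε : ℤˣ)
    (f : Para m n) : ∃ l : CircleLift, ∀ i : ℤ,
      |ε * l (endpoint m A i) - center n S (ε * f (i / 2))| ≤ radius n S (ε * f (i / 2)) := by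
  have half_add (i : ℤ) : (i + (2 * (m + 1) : ℕ)) / 2 = i / 2 + (m + 1) := by lia
  have f_add (j : ℤ) : (ε * f (j + (m + 1)) : ℤ) = ε * f j + ε * (n + 1) := by
    rw [f.map_add, mul_add]
  have unit_sq : (ε * (ε : ℤ) : ℝ) = 1 := by simpa using units_mul_units_mul ε 1
  obtain ⟨l, hl⟩ := CircleLift.exists_abs_sub_le (N := 2 * (m + 1)) (by positivity)
    hA.strictMono_endpoint hA.endpoint_add
    (Y := fun i => ε * center n S (ε * f (i / 2))) (R := fun i => radius n S (ε * f (i / 2)))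
    (fun i j hij => monotone_units_mul_comp_units_mul hS.center_mono ε
      (f.mono (Int.ediv_le_ediv two_pos hij)))
    (fun i => by
      rw [half_add, f_add, hS.center_add, mul_add, unit_sq])
    (fun i => hS.radius_pos _) (fun i => by simp only [half_add, f_add, hS.radius_add])
  refine ⟨l, fun i => ?_⟩
  rw [← abs_units_mul ε, mul_sub, units_mul_units_mul]
  exact hl i

theorem exists_mapsTo_labelFiber (hA : IsFatMarking m A) (hS : IsFatMarking n S) (ε : ℤˣ)
    (f : Para m n) : ∃ l : CircleLift, ∀ t, 𝐞 t ∈ A →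
      (ε * l t : ℝ) ∈ labelFiber n S (ε * f (label m A t)) := by
  obtain ⟨l, hl⟩ := exists_abs_sub_center_le hA hS ε f
  refine ⟨l, fun t ht => ?_⟩
  set j := label m A t
  have htj : t ∈ labelFiber m A j := ⟨ht, rfl⟩
  rw [hA.labelFiber_eq_Icc] at htj
  have hleft := hS.mem_labelFiber_of_abs_le (hl (2 * j))
  have hright := hS.mem_labelFiber_of_abs_le (hl (2 * j + 1))
  rw [endpoint_two_mul, show 2 * j / 2 = j by lia] at hleft
  rw [endpoint_two_mul_add_one, show (2 * j + 1) / 2 = j by lia] at hright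
  refine (hS.isConnected_labelFiber _).isPreconnected.ordConnected.uIcc_subset hleft hright ?_
  rw [← Set.image_const_mul_uIcc]
  refine Set.mem_image_of_mem _ (Set.Icc_subset_uIcc ⟨?_, ?_⟩)
  · exact l.strictMono.monotone htj.1
  · exact l.strictMono.monotone htj.2

end IsFatMarking

namespace PlanarHomeoGroup

variable {G : PlanarLieGroup.{u}} {H : PlanarHomeoGroup G} {m n : ℕ} {S A : Set Circle}

theorem exists_homClass_eq_of_isFatMarking (hA : IsFatMarking m A) (hS : IsFatMarking n S)
    (v : DeltaG.Hom G m n) : ∃ h : H, Set.MapsTo (H.q h) A S ∧ H.homClass m n S h = v := by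
  obtain ⟨w, f, rfl⟩ := DeltaG.exists_cls v
  obtain ⟨l, hl⟩ := IsFatMarking.exists_mapsTo_labelFiber hA hS (G.sign (w : G)) f
  have hmaps : Set.MapsTo (H.q (H.ofPair w l)) A S := fun z hz => by
    obtain ⟨t, rfl⟩ := fourierChar_surjective z
    rw [q_ofPair]
    exact (hl t hz).1
  refine ⟨H.ofPair w l, hmaps, ?_⟩
  refine homClass_ofPair hS.toIsMarking (fun j => hmaps (hA.root_mem j)) fun j => ?_
  rw [(hl _ (hA.root_mem j)).2, hA.label_root, DeltaG.sign_mul_sign_mul]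

end PlanarHomeoGroup

/-! ### The action of the crossed simplicial group on vertices -/

/-- The residue of an integer modulo `n + 1`, as an element of `{0, …, n}`. -/
def residue (n : ℕ) (j : ℤ) : Fin (n + 1) := (Int.divModEquiv (n + 1) j).2

theorem residue_add_ediv_mul (n : ℕ) (j : ℤ) : (residue n j : ℤ) + j / (n + 1) * (n + 1) = j :=
  (add_comm _ _).trans ((Int.divModEquiv (n + 1)).symm_apply_apply j)

theorem divModEquiv_add_mul {n : ℕ} (k : Fin (n + 1)) (q : ℤ) :
    Int.divModEquiv (n + 1) (k + q * (n + 1)) = (q, k) :=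
  ((Int.divModEquiv (n + 1)).eq_symm_apply).1 (add_comm _ _)

theorem residue_add_mul {n : ℕ} (k : Fin (n + 1)) (q : ℤ) : residue n (k + q * (n + 1)) = k :=
  congrArg Prod.snd (divModEquiv_add_mul k q)

theorem add_le_of_residue_eq {n : ℕ} {a b : ℤ} (hab : a < b) (h : residue n a = residue n b) :
    a + (n + 1) ≤ b := by
  have hdvd : (n + 1 : ℤ) ∣ b - a := ⟨b / (n + 1) - a / (n + 1), by
    conv_lhs => rw [← residue_add_ediv_mul n a, ← residue_add_ediv_mul n b, h]
    ring⟩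
  linarith [Int.le_of_dvd (sub_pos.2 hab) hdvd]

theorem ofOrderHom_vertex_apply {n : ℕ} (k : Fin (n + 1)) (q : ℤ) :
    Para.ofOrderHom (vertex n k).toOrderHom q = k + q * (n + 1) := by
  have hzero : Para.ofOrderHom (vertex n k).toOrderHom 0 = k :=
    Para.ofOrderHom_apply (vertex n k).toOrderHom 0
  simpa [hzero] using (Para.ofOrderHom (vertex n k).toOrderHom).map_add_mul 0 q

theorem lam_bijective {D : Type w} [Category.{u} D] (i : SimplexCategory ⥤ D)
    [IsCrossedSimplicialGroup i] {n : ℕ} (g : Gen i n) : Function.Bijective (lam i g.hom) :=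
  Function.bijective_iff_has_inverse.2 ⟨lam i g.inv,
    fun k => by rw [← lam_comp, g.hom_inv_id, lam_id],
    fun k => by rw [← lam_comp, g.inv_hom_id, lam_id]⟩

namespace DeltaG

variable {G : PlanarLieGroup.{u}} {m n : ℕ}

/-- The map `{0, …, m} → {0, …, n}` induced by a morphism of `ΔG`. -/
def vertexMap (v : DeltaG.Hom G m n) : Fin (m + 1) → Fin (n + 1) :=
  lam (DeltaG.incl G) (m := m) (n := n) v

theorem vertexMap_cls (w : G.base) (f : Para m n) (k : Fin (m + 1)) :
    vertexMap (cls w f) k = residue n (G.sign (w : G) * f (k : ℕ)) := by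
  set ε := G.sign (w : G) with hε
  set q : ℤ := ε * f (k : ℕ) / (n + 1) with hq
  obtain ⟨v, hv, hv'⟩ := exists_inverse (n := 0) w (ε * q)
  refine lam_eq (incl G) (g := ⟨autHom 0 w (ε * q), v, hv, hv'⟩) ?_
  change comp (cls 1 (Para.ofOrderHom _)) (cls w f) = comp (autHom 0 w (ε * q)) (ofOrderHom _)
  rw [autHom_comp_ofOrderHom, comp_cls, mul_one, ← hε, sign_mul_sign_mul]
  refine congrArg (cls w) (Para.ext_fin fun a => ?_)
  obtain rfl : a = 0 := Subsingleton.elim (α := Fin 1) _ _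
  rw [Subgroup.coe_one, map_one, Para.comp_apply, Para.conj_apply, Para.conj_apply,
    Para.comp_apply, Para.trans_apply]
  simp only [Fin.val_zero, Nat.cast_zero, mul_zero, zero_add, Units.val_one, one_mul]
  rw [ofOrderHom_vertex_apply, ofOrderHom_vertex_apply, hq, residue_add_ediv_mul,
    sign_mul_sign_mul, zero_mul, add_zero]

end DeltaG

theorem CircleLift.exists_apply_div_eq {n : ℕ} {a : Fin (n + 1) → ℝ} (ha : StrictMono a)
    (h01 : ∀ k, a k ∈ Set.Ico 0 1) :
    ∃ l : CircleLift, ∀ k : Fin (n + 1), l (((k : ℕ) : ℤ) / (n + 1)) = a k := by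
  let X (j : ℤ) : ℝ := a (residue n j) + (j / (n + 1) : ℤ)
  have hX_apply (k : Fin (n + 1)) (q : ℤ) : X (k + q * (n + 1)) = a k + q := by
    have hdiv : ((k : ℤ) + q * (n + 1)) / (n + 1) = q :=
      congrArg Prod.fst (divModEquiv_add_mul k q)
    simp only [X, residue_add_mul, hdiv]
  have hX : StrictMono X := fun i j hij => by
    rcases (Int.ediv_le_ediv (c := n + 1) (by positivity) hij.le).eq_or_lt with hq | hq
    · have hi := residue_add_ediv_mul n i
      have hj := residue_add_ediv_mul n j
      have hres : residue n i < residue n j := by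
        rw [hq] at hi
        exact_mod_cast (show (residue n i : ℤ) < residue n j by linarith)
      simp only [X, hq]
      linarith [ha hres]
    · have hq' : ((i / (n + 1) : ℤ) : ℝ) + 1 ≤ (j / (n + 1) : ℤ) := by exact_mod_cast hq
      linarith [(h01 (residue n i)).2, (h01 (residue n j)).1]
  have hXN (j : ℤ) : X (j + (n + 1 : ℕ)) = X j + 1 := by
    obtain ⟨⟨q, k⟩, rfl⟩ := (Int.divModEquiv (n + 1)).symm.surjective j
    have hj : (Int.divModEquiv (n + 1)).symm (q, k) = k + q * (n + 1) := add_comm _ _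
    rw [hj, show (k + q * (n + 1) + (n + 1 : ℕ) : ℤ) = k + (q + 1) * (n + 1) by push_cast; ring,
      hX_apply, hX_apply]
    push_cast
    ring
  obtain ⟨l, hl⟩ := exists_interpolation n.succ_pos hX hXN
  refine ⟨l, fun k => ?_⟩
  simpa using (hl k).trans (by simpa using hX_apply k 0)

/-! ### The geometry of marked circles -/

theorem exists_mem_Ico_fourierChar_eq (a : ℝ) (z : Circle) :
    ∃ t ∈ Set.Ico a (a + 1), 𝐞 t = z := by
  obtain ⟨t, rfl⟩ := fourierChar_surjective z
  obtain ⟨k, hk, -⟩ := existsUnique_add_zsmul_mem_Ico one_pos t a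
  rw [zsmul_one] at hk
  exact ⟨t + k, hk, fourierChar_add_intCast t k⟩

theorem exists_eq_div_of_fourierChar_eq {n : ℕ} {t : ℝ} {j : ℤ} (h : 𝐞 t = 𝐞 (j / (n + 1))) :
    ∃ i : ℤ, t = i / (n + 1) := by
  obtain ⟨c, rfl⟩ := fourierChar_eq_iff.1 h
  exact ⟨j + c * (n + 1), by push_cast; field_simp⟩

theorem exists_equiv_strictMono_comp {α : Type*} [Finite α] {n : ℕ} (hn : Nat.card α = n)
    {t : α → ℝ} (ht : Function.Injective t) : ∃ e : Fin n ≃ α, StrictMono (t ∘ e) := by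
  let e₀ := (Finite.equivFinOfCardEq hn).symm
  exact ⟨(Tuple.sort (t ∘ e₀)).trans e₀, (Tuple.monotone_sort (t ∘ e₀)).strictMono_of_injective
    (ht.comp ((Tuple.sort (t ∘ e₀)).trans e₀).injective)⟩

namespace MarkedCircle

variable {G : PlanarLieGroup.{u}} {H : PlanarHomeoGroup G}

theorem fourierChar_div_eq_root (n : ℕ) (k : Fin (n + 1)) :
    𝐞 (((k : ℕ) : ℤ) / (n + 1)) = root n k := by
  rw [root, Real.fourierChar_apply']
  congr 1
  push_cast
  ring

theorem fourierChar_div_eq_root_residue (n : ℕ) (j : ℤ) :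
    𝐞 (j / (n + 1)) = root n (residue n j) := by
  rw [← fourierChar_div_eq_root, fourierChar_eq_iff]
  refine ⟨j / (n + 1), ?_⟩
  have hj : (j : ℝ) = (((residue n j : ℕ) : ℤ) : ℝ) + (j / (n + 1) : ℤ) * (n + 1) := by
    exact_mod_cast (residue_add_ediv_mul n j).symm
  rw [div_add' _ _ _ (by positivity), ← hj]

variable (X : MarkedCircle H)

/-- The translation taking `x` to `y` in the torsor `F`: the unique `h` with `x h = y`. -/
def gap (x y : X.F) : H := (X.isHomeomorph_act x).homeomorph.symm y

theorem act_gap (x y : X.F) : X.act x (X.gap x y) = y :=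
  (X.isHomeomorph_act x).homeomorph.apply_symm_apply y

theorem gap_act (x : X.F) (h : H) : X.gap x (X.act x h) = h :=
  (X.isHomeomorph_act x).homeomorph.symm_apply_apply h

theorem continuous_gap (x : X.F) : Continuous (X.gap x) :=
  (X.isHomeomorph_act x).homeomorph.symm.continuous

theorem gap_self (x : X.F) : X.gap x x = 1 := by
  simpa only [X.act_one] using X.gap_act x 1

theorem gap_mul_gap (x y z : X.F) : X.gap x y * X.gap y z = X.gap x z := by
  rw [← X.gap_act x (_ * _), X.act_mul, act_gap, act_gap]

theorem gap_act_right (x y : X.F) (h : H) : X.gap x (X.act y h) = X.gap x y * h := by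
  rw [← X.gap_mul_gap x y, gap_act]

theorem ρ_eq_ρ_gap (x y : X.F) (z : Circle) : X.ρ y z = X.ρ x (H.q (X.gap x y) z) := by
  rw [← X.ρ_act, act_gap]

theorem continuous_ρ_apply (z : Circle) : Continuous fun x => X.ρ x z := by
  obtain ⟨x₀⟩ := X.nonempty_F
  refine Continuous.congr ?_ fun x => (X.ρ_eq_ρ_gap x₀ x z).symm
  exact (X.ρ x₀).continuous.comp ((continuous_homeo_eval Circle Circle).comp
    ((H.continuous_q.comp (X.continuous_gap x₀)).prodMk continuous_const))

/-- The preimage of `J` in the standard circle under the parametrization `ρ x`. -/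
def markedPreimage (x : X.F) : Set Circle := X.ρ x ⁻¹' X.J

theorem mapsTo_markedPreimage (x y : X.F) :
    Set.MapsTo (H.q (X.gap x y)) (X.markedPreimage y) (X.markedPreimage x) := fun z hz => by
  rw [markedPreimage, Set.mem_preimage, ← ρ_eq_ρ_gap]
  exact hz

theorem J_ne_univ : X.J ≠ Set.univ := fun h => by
  obtain ⟨k, ⟨e⟩⟩ := X.exists_intervals
  obtain ⟨φ⟩ := X.nonempty_homeo
  let ψ (z : Circle) : X.J := ⟨φ z, h ▸ Set.mem_univ _⟩
  have hψ : Continuous ψ := φ.continuous.subtype_mk _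
  refine not_injective_of_continuous_circle (f := fun z => ((e (ψ z)).2 : ℝ)) (by fun_prop) ?_
  intro a b hab
  have hfst : (e (ψ a)).1 = (e (ψ b)).1 :=
    PreconnectedSpace.constant inferInstance (f := fun z => (e (ψ z)).1) (by fun_prop)
  have hψab : ψ a = ψ b := e.injective (Prod.ext hfst (Subtype.ext hab))
  exact φ.injective (congrArg Subtype.val hψab)

theorem exists_ne_joined (z : X.J) : ∃ z', z' ≠ z ∧ Joined z z' := by
  obtain ⟨k, ⟨e⟩⟩ := X.exists_intervals
  obtain ⟨s, hs⟩ := exists_ne (e z).2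
  have : PathConnectedSpace I := isPathConnected_iff_pathConnectedSpace.1
    ((convex_Icc 0 1).isPathConnected (Set.nonempty_Icc.2 zero_le_one))
  have hslice : Continuous fun a : I => e.symm ((e z).1, a) := by fun_prop
  refine ⟨e.symm ((e z).1, s), fun h => hs ?_, ?_⟩
  · rw [← h, e.apply_symm_apply]
  · simpa using (PathConnectedSpace.joined (e z).2 s).map hslice

/-- The component of `J` which contains the image of a point under the parametrization `ρ x`. -/
def componentAt (x : X.F) (z : Circle) (hz : z ∈ X.markedPreimage x) : ZerothHomotopy X.J :=
  ZerothHomotopy.mk ⟨X.ρ x z, hz⟩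

variable {X}

theorem componentAt_congr {x y : X.F} {z z' : Circle} (h : X.ρ x z = X.ρ y z')
    (hz : z ∈ X.markedPreimage x) (hz' : z' ∈ X.markedPreimage y) :
    X.componentAt x z hz = X.componentAt y z' hz' :=
  congrArg ZerothHomotopy.mk (Subtype.ext h)

theorem componentAt_eq_of_uIcc {x : X.F} {s t : ℝ}
    (h : ∀ u ∈ Set.uIcc s t, 𝐞 u ∈ X.markedPreimage x) :
    X.componentAt x (𝐞 s) (h s Set.left_mem_uIcc) =
      X.componentAt x (𝐞 t) (h t Set.right_mem_uIcc) := by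
  have hmem (a : I) : AffineMap.lineMap s t (a : ℝ) ∈ Set.uIcc s t := by
    rw [← segment_eq_uIcc, segment_eq_image_lineMap]
    exact Set.mem_image_of_mem _ a.2
  refine ZerothHomotopy.sound ⟨⟨fun a : I => ⟨X.ρ x (𝐞 (AffineMap.lineMap s t (a : ℝ))),
    h _ (hmem a)⟩, ?_⟩, ?_, ?_⟩
  · exact Continuous.subtype_mk ((X.ρ x).continuous.comp (Real.continuous_fourierChar.comp
      (AffineMap.lineMap_continuous.comp continuous_subtype_val))) _
  · simp
  · simp

theorem exists_uIcc_of_componentAt_eq {x : X.F} {t : ℝ} {z : X.J} (ht : 𝐞 t ∈ X.markedPreimage x)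
    (h : X.componentAt x (𝐞 t) ht = ZerothHomotopy.mk z) :
    ∃ t', X.ρ x (𝐞 t') = z ∧ ∀ u ∈ Set.uIcc t t', 𝐞 u ∈ X.markedPreimage x := by
  obtain ⟨γ⟩ : Joined (⟨X.ρ x (𝐞 t), ht⟩ : X.J) z := Quotient.exact h
  have hγ : Continuous fun s => (X.ρ x).symm (γ s : X.C) :=
    (X.ρ x).symm.continuous.comp (continuous_subtype_val.comp γ.continuous)
  obtain ⟨Γ, hΓ, hΓ0⟩ := isCoveringMap_fourierChar.exists_path_lifts ⟨_, hγ⟩ t (by simp)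
  have hρΓ (s : I) : X.ρ x (𝐞 (Γ s)) = γ s :=
    (congrArg (X.ρ x) (congrFun hΓ s)).trans ((X.ρ x).apply_symm_apply _)
  refine ⟨Γ 1, by rw [hρΓ, γ.target], fun u hu => ?_⟩
  rw [← hΓ0] at hu
  obtain ⟨s, rfl⟩ := (isPreconnected_range Γ.continuous).ordConnected.uIcc_subset
    (Set.mem_range_self 0) (Set.mem_range_self 1) hu
  rw [markedPreimage, Set.mem_preimage, hρΓ]
  exact (γ s).2

namespace FrameSpace

variable {m n : ℕ}

theorem fourierChar_mem (x : X.FrameSpace n) (j : ℤ) :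
    𝐞 (j / (n + 1)) ∈ X.markedPreimage x.1 := by
  rw [fourierChar_div_eq_root_residue]
  exact x.2.1 _

theorem eq_of_uIcc (x : X.FrameSpace n) {a b : ℤ}
    (h : ∀ u ∈ Set.uIcc (a / (n + 1) : ℝ) (b / (n + 1)), 𝐞 u ∈ X.markedPreimage x.1) : a = b := by
  wlog hab : a < b generalizing a b
  · rcases lt_trichotomy a b with hlt | heq | hgt
    · exact absurd hlt hab
    · exact heq
    · exact (this (by rwa [Set.uIcc_comm]) hgt).symm
  have hres : residue n a = residue n b := x.2.2.1 <| by
    simp only [← fourierChar_div_eq_root_residue]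
    exact componentAt_eq_of_uIcc h
  have hturn : (a / (n + 1) : ℝ) + 1 ≤ b / (n + 1) := by
    rw [div_add_one (by positivity)]
    exact div_le_div_of_nonneg_right (by exact_mod_cast add_le_of_residue_eq hab hres)
      (by positivity)
  refine absurd (Set.eq_univ_of_forall fun z => ?_) X.J_ne_univ
  obtain ⟨y, rfl⟩ := (X.ρ x.1).surjective z
  obtain ⟨t, ht, rfl⟩ := exists_mem_Ico_fourierChar_eq (a / (n + 1)) y
  exact h t (Set.mem_uIcc_of_le ht.1 (ht.2.le.trans hturn))

theorem exists_uIcc (x : X.FrameSpace n) {t : ℝ} (ht : 𝐞 t ∈ X.markedPreimage x.1) :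
    ∃ j : ℤ, ∀ u ∈ Set.uIcc t (j / (n + 1)), 𝐞 u ∈ X.markedPreimage x.1 := by
  obtain ⟨k, hk⟩ := x.2.2.2 (X.componentAt x.1 (𝐞 t) ht)
  obtain ⟨t', hρt', huIcc⟩ := exists_uIcc_of_componentAt_eq ht hk.symm
  obtain ⟨i, rfl⟩ := exists_eq_div_of_fourierChar_eq
    (((X.ρ x.1).injective hρt').trans (fourierChar_div_eq_root n k).symm)
  exact ⟨i, huIcc⟩

theorem isFatMarking (x : X.FrameSpace n) : IsFatMarking n (X.markedPreimage x.1) where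
  root_mem := x.fourierChar_mem
  existsUnique t ht := by
    obtain ⟨i, hi⟩ := x.exists_uIcc ht
    refine ⟨i, hi, fun j hj => x.eq_of_uIcc fun u hu => ?_⟩
    rcases Set.uIcc_subset_uIcc_union_uIcc (b := t) hu with hu | hu
    · exact hj u (by rwa [Set.uIcc_comm])
    · exact hi u hu
  isClosed := X.isClosed_J.preimage (X.ρ x.1).continuous
  exists_ne t ht := by
    obtain ⟨z, hz, ⟨γ⟩⟩ := X.exists_ne_joined ⟨X.ρ x.1 (𝐞 t), ht⟩
    obtain ⟨t', hρt', huIcc⟩ := exists_uIcc_of_componentAt_eq ht (ZerothHomotopy.sound γ)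
    refine ⟨t', ?_, huIcc⟩
    rintro rfl
    exact hz (Subtype.ext hρt'.symm)

theorem isMarking (x : X.FrameSpace n) : IsMarking n (X.markedPreimage x.1) :=
  x.isFatMarking.toIsMarking

theorem componentAt_eq_component (x : X.FrameSpace n) {t : ℝ}
    (ht : 𝐞 t ∈ X.markedPreimage x.1) :
    X.componentAt x.1 (𝐞 t) ht = x.component (residue n (label n (X.markedPreimage x.1) t)) := by
  rw [componentAt_eq_of_uIcc (x.isMarking.fourierChar_mem_of_mem_uIcc_label ht)]
  exact componentAt_congr (congrArg _ (fourierChar_div_eq_root_residue n _)) _ _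

theorem root_mem_markedPreimage_act (x : X.FrameSpace n) {h : H}
    (hh : H.MapsRoots m (X.markedPreimage x.1) h) (k : Fin (m + 1)) :
    root m k ∈ X.markedPreimage (X.act x.1 h) := by
  rw [markedPreimage, Set.mem_preimage, X.ρ_act, ← fourierChar_div_eq_root]
  exact hh _

theorem componentAt_act_root (x : X.FrameSpace n) {h : H}
    (hh : H.MapsRoots m (X.markedPreimage x.1) h) (k : Fin (m + 1)) :
    X.componentAt (X.act x.1 h) (root m k) (x.root_mem_markedPreimage_act hh k) =
      x.component (DeltaG.vertexMap (H.homClass m n (X.markedPreimage x.1) h) k) := by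
  obtain ⟨w, l, f, rfl, hf, hcls⟩ := PlanarHomeoGroup.exists_homClass_eq x.isMarking h hh
  rw [hcls, DeltaG.vertexMap_cls, ← hf.label_eq, ← x.componentAt_eq_component (hh.mem _)]
  refine componentAt_congr ?_ _ _
  rw [X.ρ_act, ← fourierChar_div_eq_root, H.q_ofPair]

theorem exists_eq_act (x : X.FrameSpace n) {h : H}
    (hh : H.MapsRoots n (X.markedPreimage x.1) h) (g : Gen (DeltaG.incl G) n)
    (hg : g.hom = H.homClass n n (X.markedPreimage x.1) h) :
    ∃ y : X.FrameSpace n, y.1 = X.act x.1 h := by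
  refine ⟨⟨X.act x.1 h, x.root_mem_markedPreimage_act hh, ?_⟩, rfl⟩
  have hcomponents : (fun k => X.componentAt (X.act x.1 h) (root n k)
      (x.root_mem_markedPreimage_act hh k)) = x.component ∘ lam (DeltaG.incl G) g.hom := by
    funext k
    rw [x.componentAt_act_root hh, ← hg]
    rfl
  exact hcomponents ▸ Function.Bijective.comp (g := x.component) x.2.2 (lam_bijective _ g)

end FrameSpace

variable (X)

/-- The integer `n` for which `J` has `n + 1` components. -/
def dim : ℕ := Nat.card (ZerothHomotopy X.J) - 1

theorem card_zerothHomotopy_J : Nat.card (ZerothHomotopy X.J) = X.dim + 1 := by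
  have := X.finite_pi0
  have : Nonempty X.J := X.nonempty_J.to_subtype
  exact (Nat.sub_add_cancel Nat.card_pos).symm

theorem exists_componentAt_eq (x : X.F) (c : ZerothHomotopy X.J) :
    ∃ t ∈ Set.Ico (0 : ℝ) 1, ∃ ht : 𝐞 t ∈ X.markedPreimage x, X.componentAt x (𝐞 t) ht = c := by
  obtain ⟨⟨z, hz⟩, rfl⟩ := ZerothHomotopy.mk_surjective c
  obtain ⟨y, rfl⟩ := (X.ρ x).surjective z
  obtain ⟨t, ht, rfl⟩ := exists_mem_Ico_fourierChar_eq 0 y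
  exact ⟨t, by rwa [zero_add] at ht, hz, rfl⟩

theorem nonempty_frameSpace : Nonempty (X.FrameSpace X.dim) := by
  have := X.finite_pi0
  obtain ⟨x₀⟩ := X.nonempty_F
  choose t ht01 ht htc using X.exists_componentAt_eq x₀
  have hinj : Function.Injective t := fun c c' h => by
    rw [← htc c, ← htc c']
    exact componentAt_congr (by rw [h]) _ _
  obtain ⟨e, he⟩ := exists_equiv_strictMono_comp X.card_zerothHomotopy_J hinj
  obtain ⟨l, hl⟩ := CircleLift.exists_apply_div_eq he fun k => ht01 (e k)
  have hroot (k : Fin (X.dim + 1)) :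
      X.ρ (X.act x₀ (H.ofLift l)) (root X.dim k) = X.ρ x₀ (𝐞 (t (e k))) := by
    rw [X.ρ_act, ← fourierChar_div_eq_root, H.q_ofLift, hl, Function.comp_apply]
  have hmem (k : Fin (X.dim + 1)) :
      root X.dim k ∈ X.markedPreimage (X.act x₀ (H.ofLift l)) := by
    rw [markedPreimage, Set.mem_preimage, hroot]
    exact ht (e k)
  have hcomponents : (fun k => X.componentAt _ _ (hmem k)) = e :=
    funext fun k => (componentAt_congr (hroot k) _ _).trans (htc (e k))
  exact ⟨⟨X.act x₀ (H.ofLift l), hmem, hcomponents ▸ e.bijective⟩⟩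

end MarkedCircle

/-! ### Structured sets and the crossed simplicial group -/

namespace StructuredSet

variable {D : Type w} [Category.{u} D] (i : SimplexCategory ⥤ D) [IsCrossedSimplicialGroup i]

/-- The structured set with underlying set `{0, …, n}` whose torsor of frames is `Aut [n]`. -/
def standard (n : ℕ) : StructuredSet i where
  carrier := ULift (Fin (n + 1))
  n := n
  Frame := Gen i n
  nonempty_frame := ⟨1⟩
  act f g := f * g
  act_one := mul_one
  act_mul f g h := (mul_assoc f g h).symm
  existsUnique_act f f' := ⟨f⁻¹ * f', mul_inv_cancel_left f f', fun g hg => by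
    rw [← hg, inv_mul_cancel_left]⟩
  ρ f := (Equiv.ofBijective _ (lam_bijective i f)).trans Equiv.ulift.symm
  ρ_act f g k := congrArg ULift.up (lam_comp i g.hom f.hom k)

/-- The functor which sends a structured set with `n + 1` elements to `[n]`, and a morphism to its
component at the chosen frames. -/
def toObject : StructuredSet i ⥤ D where
  obj X := ob i X.n
  map {X Y} ψ := Hom.app ψ Y.someFrame X.someFrame
  map_id X := id_app X _
  map_comp {X Y Z} ψ ψ' := comp_app ψ ψ' Z.someFrame Y.someFrame X.someFrame

variable {i}

theorem hom_ext_of_app {X Y : StructuredSet i} {ψ ψ' : X ⟶ Y} (f : Y.Frame) (f' : X.Frame)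
    (h : Hom.app ψ f f' = Hom.app ψ' f f') : ψ = ψ' := by
  refine Hom.ext (funext fun a => funext fun b => ?_)
  have happ := Hom.app_act ψ f (Y.diff f a) f' (X.diff f' b)
  have happ' := Hom.app_act ψ' f (Y.diff f a) f' (X.diff f' b)
  rw [act_diff, act_diff] at happ happ'
  rw [happ, happ', h]

instance : (toObject i).Faithful where
  map_injective h := hom_ext_of_app _ _ h

theorem diff_self (X : StructuredSet i) (f : X.Frame) : X.diff f f = 1 := X.diff_eq (X.act_one f)

theorem diff_act (X : StructuredSet i) (f f' : X.Frame) (g : Gen i X.n) :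
    X.diff f (X.act f' g) = X.diff f f' * g :=
  X.diff_eq (by rw [X.act_mul, act_diff])

/-- The morphism of structured sets with a prescribed component at the chosen frames. -/
def homOfObject {X Y : StructuredSet i} (v : ob i X.n ⟶ ob i Y.n) : Hom X Y where
  app f f' := (X.diff X.someFrame f').hom ≫ v ≫ (Y.diff Y.someFrame f).inv
  app_act f g f' g' := by
    rw [diff_act, diff_act]
    change (g'.hom ≫ (X.diff X.someFrame f').hom) ≫ v ≫ ((Y.diff Y.someFrame f).inv ≫ g.inv) = _
    simp only [Category.assoc]

instance : (toObject i).Full where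
  map_surjective {X Y} v := by
    refine ⟨homOfObject v, ?_⟩
    change (X.diff X.someFrame X.someFrame).hom ≫ v ≫ (Y.diff Y.someFrame Y.someFrame).inv = v
    rw [diff_self, diff_self]
    exact (Category.id_comp _).trans (Category.comp_id v)

instance : (toObject i).EssSurj where
  mem_essImage d := by
    obtain ⟨n, rfl⟩ := (IsCrossedSimplicialGroup.bijective_obj (i := i)).2 d
    exact ⟨standard i n.len, ⟨Iso.refl _⟩⟩

instance : (toObject i).IsEquivalence where

theorem nonempty_iso_of_eq {X Y : StructuredSet i} (h : X.n = Y.n) : Nonempty (X ≅ Y) :=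
  ⟨(toObject i).preimageIso (eqToIso (congrArg (ob i) h))⟩

end StructuredSet

/-! ### Frames of marked circles -/

namespace MarkedCircle

variable {G : PlanarLieGroup.{u}} {H : PlanarHomeoGroup G} {X : MarkedCircle H} {n : ℕ}

theorem mapsRoots_gap (x y : X.FrameSpace n) :
    H.MapsRoots n (X.markedPreimage x.1) (X.gap x.1 y.1) := fun j =>
  X.mapsTo_markedPreimage x.1 y.1 (y.fourierChar_mem j)

/-- The class in `ΔG` of the element of `Homeo^G(S¹)` which maps the frame `x` to the frame `y`. -/
def frameClass (x y : X.FrameSpace n) : DeltaG.Hom G n n :=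
  H.homClass n n (X.markedPreimage x.1) (X.gap x.1 y.1)

theorem frameClass_comp (x y z : X.FrameSpace n) :
    DeltaG.comp (frameClass y z) (frameClass x y) = frameClass x z := by
  rw [frameClass, frameClass, frameClass, ← X.gap_mul_gap x.1 y.1 z.1]
  exact (PlanarHomeoGroup.homClass_mul y.isMarking x.isMarking (mapsRoots_gap y z)
    (X.mapsTo_markedPreimage x.1 y.1)).symm

theorem frameClass_self (x : X.FrameSpace n) : frameClass x x = DeltaG.idHom n := by
  rw [frameClass, gap_self]
  exact PlanarHomeoGroup.homClass_one x.isMarking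

/-- The class `frameClass x y` as an automorphism of `[n]`. -/
def frameIso (x y : X.FrameSpace n) : Gen (DeltaG.incl G) n where
  hom := frameClass x y
  inv := frameClass y x
  hom_inv_id := (frameClass_comp y x y).trans (frameClass_self y)
  inv_hom_id := (frameClass_comp x y x).trans (frameClass_self x)

theorem frameClass_eq_of_mk_eq (x : X.FrameSpace n) {y z : X.FrameSpace n}
    (h : ZerothHomotopy.mk y = ZerothHomotopy.mk z) : frameClass x y = frameClass x z := by
  obtain ⟨γ⟩ : Joined y z := Quotient.exact h
  simpa only [frameClass, γ.source, γ.target] using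
    PlanarHomeoGroup.homClass_eq_of_path (m := n) x.isMarking (γ := fun s => X.gap x.1 (γ s).1)
      ((X.continuous_gap x.1).comp (continuous_subtype_val.comp γ.continuous))
      (fun s => mapsRoots_gap x (γ s))

theorem frameClass_eq_idHom {x y : X.FrameSpace n}
    (h : ZerothHomotopy.mk x = ZerothHomotopy.mk y) : frameClass x y = DeltaG.idHom n := by
  rw [← frameClass_self x]
  exact frameClass_eq_of_mk_eq x h.symm

theorem exists_path_of_frameClass_eq {x y z : X.FrameSpace n}
    (h : frameClass x y = frameClass x z) :
    ∃ γ : Path (X.gap x.1 y.1) (X.gap x.1 z.1), ∀ s,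
      H.MapsRoots n (X.markedPreimage x.1) (γ s) ∧
        H.homClass n n (X.markedPreimage x.1) (γ s) = frameClass x y := by
  let roots : Set Circle := Set.range fun j : ℤ => 𝐞 (j / (n + 1))
  have mapsTo_roots (y : X.FrameSpace n) :
      Set.MapsTo (H.q (X.gap x.1 y.1)) roots (X.markedPreimage x.1) := by
    rintro - ⟨j, rfl⟩
    exact mapsRoots_gap x y j
  have exists_uIcc (t : ℝ) (ht : 𝐞 t ∈ roots) :
      ∃ j : ℤ, ∀ u ∈ Set.uIcc t (j / (n + 1)), 𝐞 u ∈ roots := by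
    obtain ⟨j, hj⟩ := ht
    obtain ⟨i, rfl⟩ := exists_eq_div_of_fourierChar_eq hj.symm
    refine ⟨i, fun u hu => ?_⟩
    rw [Set.uIcc_self, Set.mem_singleton_iff] at hu
    exact ⟨i, by rw [hu]⟩
  obtain ⟨γ, hγ⟩ := PlanarHomeoGroup.exists_path_of_homClass_eq x.isMarking
    (fun j => Set.mem_range_self j) exists_uIcc (mapsTo_roots y) (mapsTo_roots z) h
  exact ⟨γ, fun s => ⟨fun j => (hγ s).1 (Set.mem_range_self j), (hγ s).2⟩⟩

theorem mk_eq_of_frameClass_eq {x y z : X.FrameSpace n} (h : frameClass x y = frameClass x z) :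
    ZerothHomotopy.mk y = ZerothHomotopy.mk z := by
  obtain ⟨γ, hγ⟩ := exists_path_of_frameClass_eq h
  choose δ hδ using fun s => x.exists_eq_act (hγ s).1 (frameIso x y) (hγ s).2.symm
  refine ZerothHomotopy.sound ⟨⟨δ, continuous_induced_rng.2 ?_⟩, ?_, ?_⟩
  · exact ((X.isHomeomorph_act x.1).continuous.comp γ.continuous).congr fun s => (hδ s).symm
  · exact Subtype.ext ((hδ 0).trans (by rw [γ.source, act_gap]))
  · exact Subtype.ext ((hδ 1).trans (by rw [γ.target, act_gap]))

theorem sign_mul_translation_apply_div (w : G.base) (i j : ℤ) :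
    (G.sign (w : G) * CircleLift.translation (j / (n + 1)) (i / (n + 1)) : ℝ) =
      ((G.sign (w : G) * (i + j) : ℤ) : ℝ) / (n + 1) := by
  rw [CircleLift.translation_apply]
  push_cast
  ring

theorem mapsRoots_incl (x : X.FrameSpace n) (w : G.base) (j : ℤ) :
    H.MapsRoots n (X.markedPreimage x.1) (H.incl (w * G.e (j / (n + 1)))) := fun i => by
  rw [← H.ofPair_translation, H.q_ofPair, sign_mul_translation_apply_div]
  exact x.fourierChar_mem _

theorem homClass_incl (x : X.FrameSpace n) (w : G.base) (j : ℤ) :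
    H.homClass n n (X.markedPreimage x.1) (H.incl (w * G.e (j / (n + 1)))) =
      DeltaG.autHom n w j := by
  have h := mapsRoots_incl x w j
  rw [← H.ofPair_translation] at h ⊢
  refine PlanarHomeoGroup.homClass_ofPair x.isMarking h fun i => ?_
  rw [sign_mul_translation_apply_div, x.isMarking.label_root, DeltaG.sign_mul_sign_mul]
  rfl

theorem exists_eq_act_incl (x : X.FrameSpace n) (g : Gen (DeltaG.incl G) n) (w : G.base) (j : ℤ)
    (hg : g.hom = DeltaG.autHom n w j) : ∃ y : X.FrameSpace n,
      y.1 = X.act x.1 (H.incl (w * G.e (j / (n + 1)))) ∧ frameClass x y = g.hom := by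
  obtain ⟨y, hy⟩ := x.exists_eq_act (mapsRoots_incl x w j) g (hg.trans (homClass_incl x w j).symm)
  refine ⟨y, hy, ?_⟩
  rw [frameClass, hy, gap_act]
  exact (homClass_incl x w j).trans hg.symm

theorem exists_frameClass_eq (x : X.FrameSpace n) (g : Gen (DeltaG.incl G) n) :
    ∃ y : X.FrameSpace n, frameClass x y = g.hom := by
  obtain ⟨w, j, hg⟩ := DeltaG.eq_autHom_of_inverse (G := G) (n := n) g.hom_inv_id g.inv_hom_id
  obtain ⟨y, -, hy⟩ := exists_eq_act_incl x g w j hg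
  exact ⟨y, hy⟩

theorem component_eq (x y : X.FrameSpace n) (k : Fin (n + 1)) :
    y.component k = x.component (DeltaG.vertexMap (frameClass x y) k) := by
  rw [frameClass, ← x.componentAt_act_root (mapsRoots_gap x y) k]
  exact componentAt_congr (by rw [X.act_gap]) _ _

theorem component_eq_of_mk_eq {x y : X.FrameSpace n}
    (h : ZerothHomotopy.mk x = ZerothHomotopy.mk y) : x.component = y.component := by
  funext k
  obtain ⟨γ⟩ : Joined x y := Quotient.exact h
  have hcont : Continuous fun x : X.FrameSpace n => (⟨X.ρ x.1 (root n k), x.2.1 k⟩ : X.J) :=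
    ((X.continuous_ρ_apply (root n k)).comp continuous_subtype_val).subtype_mk _
  exact ZerothHomotopy.sound (γ.map hcont)

variable (X) in
/-- The structured frames of a marked circle: the components of the frame space. -/
abbrev Frames : Type u := ZerothHomotopy (X.FrameSpace X.dim)

/-- The right action of `Aut [n]` on structured frames. -/
def frameAct (f : X.Frames) (g : Gen (DeltaG.incl G) X.dim) : X.Frames :=
  ZerothHomotopy.mk (exists_frameClass_eq (Quotient.out f) g).choose

theorem frameAct_mk {x y : X.FrameSpace X.dim} {g : Gen (DeltaG.incl G) X.dim}
    (h : frameClass x y = g.hom) : frameAct (ZerothHomotopy.mk x) g = ZerothHomotopy.mk y := by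
  set x' := Quotient.out (ZerothHomotopy.mk x)
  refine mk_eq_of_frameClass_eq (x := x') ((exists_frameClass_eq x' g).choose_spec.trans ?_)
  rw [← frameClass_comp x' x y,
    frameClass_eq_idHom (x := x') (y := x) (Quotient.out_eq (ZerothHomotopy.mk x)),
    DeltaG.comp_id, h]

theorem frameAct_mul (f : X.Frames) (g h : Gen (DeltaG.incl G) X.dim) :
    frameAct f (g * h) = frameAct (frameAct f g) h := by
  obtain ⟨x, rfl⟩ := ZerothHomotopy.mk_surjective f
  obtain ⟨y, hy⟩ := exists_frameClass_eq x g
  obtain ⟨z, hz⟩ := exists_frameClass_eq y h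
  rw [frameAct_mk hy, frameAct_mk hz]
  refine frameAct_mk ?_
  rw [← frameClass_comp x y z, hy, hz]
  rfl

theorem existsUnique_frameAct_eq (f f' : X.Frames) : ∃! g, frameAct f g = f' := by
  obtain ⟨x, rfl⟩ := ZerothHomotopy.mk_surjective f
  obtain ⟨x', rfl⟩ := ZerothHomotopy.mk_surjective f'
  refine ⟨frameIso x x', frameAct_mk rfl, fun g hg => Iso.ext ?_⟩
  obtain ⟨y, hy⟩ := exists_frameClass_eq x g
  exact hy.symm.trans (frameClass_eq_of_mk_eq x ((frameAct_mk hy).symm.trans hg))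

variable (X) in
/-- The structured set `π₀(J)` of components of a marked circle. -/
def toStructuredSet : StructuredSet (DeltaG.incl G) where
  carrier := ZerothHomotopy X.J
  n := X.dim
  Frame := X.Frames
  nonempty_frame := have := X.nonempty_frameSpace; inferInstance
  act := frameAct
  act_one f := by
    obtain ⟨x, rfl⟩ := ZerothHomotopy.mk_surjective f
    exact frameAct_mk (frameClass_self x)
  act_mul := frameAct_mul
  existsUnique_act := existsUnique_frameAct_eq
  ρ := ZerothHomotopy.lift (fun x => Equiv.ofBijective x.component x.2.2) fun _ _ γ =>
    Equiv.coe_fn_injective (component_eq_of_mk_eq (ZerothHomotopy.sound γ))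
  ρ_act f g k := by
    obtain ⟨x, rfl⟩ := ZerothHomotopy.mk_surjective f
    obtain ⟨y, hy⟩ := exists_frameClass_eq x g
    rw [frameAct_mk hy]
    change y.component k = x.component (lam _ g.hom k)
    rw [component_eq x y k, hy]
    rfl

end MarkedCircle

/-! ### The functor to structured sets -/

namespace MarkedCircle

variable {G : PlanarLieGroup.{u}} {H : PlanarHomeoGroup G} {X Y Z : MarkedCircle H} {k m n : ℕ}

/-- The morphism of `ΔG` which expresses a structured homeomorphism in terms of frames. -/
def homOfFrames (a : MarkedHomeo X Y) (y : Y.FrameSpace n) (x : X.FrameSpace m) :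
    DeltaG.Hom G m n :=
  H.homClass m n (Y.markedPreimage y.1) (Y.gap y.1 (a.1.φt x.1))

theorem mapsTo_gap_φt (a : MarkedHomeo X Y) (y : Y.F) (x : X.F) :
    Set.MapsTo (H.q (Y.gap y (a.1.φt x))) (X.markedPreimage x) (Y.markedPreimage y) :=
  fun z hz => by
    change Y.ρ y _ ∈ Y.J
    rw [← Y.ρ_eq_ρ_gap, a.1.ρ_φt]
    exact a.2 hz

theorem mapsRoots_gap_φt (a : MarkedHomeo X Y) (y : Y.F) (x : X.FrameSpace m) :
    H.MapsRoots m (Y.markedPreimage y) (Y.gap y (a.1.φt x.1)) :=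
  fun j => mapsTo_gap_φt a y x.1 (x.fourierChar_mem j)

theorem homOfFrames_comp (a : MarkedHomeo X Y) (b : MarkedHomeo Y Z) (z : Z.FrameSpace k)
    (y : Y.FrameSpace n) (x : X.FrameSpace m) :
    DeltaG.comp (homOfFrames a y x) (homOfFrames b z y) = homOfFrames (a.comp b) z x := by
  have hgap : Z.gap z.1 ((a.comp b).1.φt x.1) =
      Z.gap z.1 (b.1.φt y.1) * Y.gap y.1 (a.1.φt x.1) := by
    rw [← Z.gap_act_right, ← b.1.φt_act, Y.act_gap]
    rfl
  rw [homOfFrames, homOfFrames, homOfFrames, hgap]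
  exact (PlanarHomeoGroup.homClass_mul y.isMarking z.isMarking (mapsRoots_gap_φt a y.1 x)
    (mapsTo_gap_φt b z.1 y.1)).symm

theorem frameClass_comp_homOfFrames (a : MarkedHomeo X Y) (y : Y.FrameSpace n)
    (x x' : X.FrameSpace m) :
    DeltaG.comp (frameClass x x') (homOfFrames a y x) = homOfFrames a y x' :=
  homOfFrames_comp (MarkedHomeo.id X) a y x x'

theorem homOfFrames_comp_frameClass (a : MarkedHomeo X Y) (y y' : Y.FrameSpace n)
    (x : X.FrameSpace m) :
    DeltaG.comp (homOfFrames a y x) (frameClass y' y) = homOfFrames a y' x :=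
  homOfFrames_comp a (MarkedHomeo.id Y) y' y x

theorem homOfFrames_eq_of_mk_eq {a a' : MarkedHomeo X Y}
    (h : ZerothHomotopy.mk a = ZerothHomotopy.mk a') (y : Y.FrameSpace n) (x : X.FrameSpace m) :
    homOfFrames a y x = homOfFrames a' y x := by
  obtain ⟨γ⟩ : Joined a a' := Quotient.exact h
  simpa only [homOfFrames, γ.source, γ.target] using
    PlanarHomeoGroup.homClass_eq_of_path (m := m) y.isMarking
      (γ := fun s => Y.gap y.1 ((γ s).1.φt x.1))
      ((Y.continuous_gap y.1).comp ((continuous_φt X Y x.1).comp γ.continuous))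
      (fun s => mapsRoots_gap_φt (γ s) y.1 x)

/-- The morphism `homOfFrames`, as a function of homotopy classes. -/
def homOfFrameClasses (α : ZerothHomotopy (MarkedHomeo X Y)) (f : Y.Frames) (f' : X.Frames) :
    DeltaG.Hom G X.dim Y.dim := homOfFrames (Quotient.out α) (Quotient.out f) (Quotient.out f')

theorem homOfFrameClasses_mk (a : MarkedHomeo X Y) (y : Y.FrameSpace Y.dim)
    (x : X.FrameSpace X.dim) :
    homOfFrameClasses (ZerothHomotopy.mk a) (ZerothHomotopy.mk y) (ZerothHomotopy.mk x) =
      homOfFrames a y x := by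
  rw [homOfFrameClasses,
    homOfFrames_eq_of_mk_eq (a' := a) (Quotient.out_eq (ZerothHomotopy.mk a)),
    ← frameClass_comp_homOfFrames a _ x, ← homOfFrames_comp_frameClass a y,
    frameClass_eq_idHom (x := Quotient.out (ZerothHomotopy.mk y)) (y := y)
      (Quotient.out_eq (ZerothHomotopy.mk y)),
    frameClass_eq_idHom (x := x) (y := Quotient.out (ZerothHomotopy.mk x))
      (Quotient.out_eq (ZerothHomotopy.mk x)).symm, DeltaG.id_comp, DeltaG.comp_id]

/-- The morphism of structured sets defined by a structured homeomorphism. -/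
def toStructuredHom (α : X ⟶ Y) : X.toStructuredSet ⟶ Y.toStructuredSet where
  app f f' := homOfFrameClasses α f f'
  app_act f g f' g' := by
    obtain ⟨a, rfl⟩ := ZerothHomotopy.mk_surjective α
    obtain ⟨y, rfl⟩ := ZerothHomotopy.mk_surjective f
    obtain ⟨x, rfl⟩ := ZerothHomotopy.mk_surjective f'
    obtain ⟨y', hy⟩ := exists_frameClass_eq y g
    obtain ⟨x', hx⟩ := exists_frameClass_eq x g'
    have hg : g = frameIso y y' := Iso.ext hy.symm
    change homOfFrameClasses _ (frameAct (ZerothHomotopy.mk y) g)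
      (frameAct (ZerothHomotopy.mk x) g') = _
    rw [frameAct_mk hy, frameAct_mk hx, homOfFrameClasses_mk, homOfFrameClasses_mk,
      ← frameClass_comp_homOfFrames a y' x, ← homOfFrames_comp_frameClass a y, hx, hg]
    rfl

theorem toStructuredHom_id (X : MarkedCircle H) :
    toStructuredHom (𝟙 X) = 𝟙 X.toStructuredSet := by
  refine StructuredSet.Hom.ext (funext fun f => funext fun f' => ?_)
  obtain ⟨y, rfl⟩ := ZerothHomotopy.mk_surjective f
  obtain ⟨x, rfl⟩ := ZerothHomotopy.mk_surjective f'
  change homOfFrameClasses (ZerothHomotopy.mk (MarkedHomeo.id X)) _ _ =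
    (X.toStructuredSet.diff _ _).hom
  rw [homOfFrameClasses_mk, X.toStructuredSet.diff_eq (g := frameIso y x) (frameAct_mk rfl)]
  rfl

theorem toStructuredHom_comp (α : X ⟶ Y) (β : Y ⟶ Z) :
    toStructuredHom (α ≫ β) = toStructuredHom α ≫ toStructuredHom β := by
  refine StructuredSet.Hom.ext (funext fun f => funext fun f' => ?_)
  obtain ⟨a, rfl⟩ := ZerothHomotopy.mk_surjective α
  obtain ⟨b, rfl⟩ := ZerothHomotopy.mk_surjective β
  obtain ⟨z, rfl⟩ := ZerothHomotopy.mk_surjective f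
  obtain ⟨x, rfl⟩ := ZerothHomotopy.mk_surjective f'
  obtain ⟨y⟩ := Y.nonempty_frameSpace
  refine Eq.trans ?_ (StructuredSet.comp_app (toStructuredHom (ZerothHomotopy.mk a))
    (toStructuredHom (ZerothHomotopy.mk b)) (ZerothHomotopy.mk z) (ZerothHomotopy.mk y)
    (ZerothHomotopy.mk x)).symm
  change homOfFrameClasses (ZerothHomotopy.mk (a.comp b)) _ _ =
    DeltaG.comp (homOfFrameClasses _ _ _) (homOfFrameClasses _ _ _)
  rw [homOfFrameClasses_mk, homOfFrameClasses_mk, homOfFrameClasses_mk, homOfFrames_comp]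

variable (H) in
/-- The functor `π` from marked circles to structured sets. -/
def toStructuredSetFunctor : MarkedCircle H ⥤ StructuredSet (DeltaG.incl G) where
  obj X := X.toStructuredSet
  map α := toStructuredHom α
  map_id X := toStructuredHom_id X
  map_comp α β := toStructuredHom_comp α β

end MarkedCircle

/-! ### The equivalence of categories -/

theorem card_zerothHomotopy_of_homeomorph {X ι Y : Type*} [TopologicalSpace X] [TopologicalSpace ι]
    [DiscreteTopology ι] [TopologicalSpace Y] [PathConnectedSpace Y] (e : X ≃ₜ ι × Y) :
    Nat.card (ZerothHomotopy X) = Nat.card ι := by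
  obtain ⟨y₀⟩ : Nonempty Y := inferInstance
  have hbij : Function.Bijective fun a : ι => ZerothHomotopy.mk (e.symm (a, y₀)) := by
    constructor
    · intro a b hab
      obtain ⟨γ⟩ : Joined (e.symm (a, y₀)) (e.symm (b, y₀)) := Quotient.exact hab
      have hconst : (e (γ 0)).1 = (e (γ 1)).1 :=
        PreconnectedSpace.constant inferInstance (f := fun s => (e (γ s)).1) (by fun_prop)
      simpa only [γ.source, γ.target, e.apply_symm_apply] using hconst
    · rintro ⟨x⟩
      obtain ⟨γ⟩ := PathConnectedSpace.joined y₀ (e x).2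
      have hcont : Continuous fun y : Y => e.symm ((e x).1, y) := by fun_prop
      exact ⟨(e x).1, ZerothHomotopy.sound ((γ.map hcont).cast rfl (e.symm_apply_apply x).symm)⟩
  rw [← Nat.card_congr (Equiv.ofBijective _ hbij)]

theorem injOn_fourierChar : Set.InjOn (fun t : ℝ => 𝐞 t) (Set.Ico 0 1) := by
  intro s hs t ht hst
  obtain ⟨k, hk⟩ := fourierChar_eq_iff.1 hst
  rw [← Int.fract_eq_self.2 hs, ← Int.fract_eq_self.2 ht, hk, Int.fract_add_intCast]

/-- A parametrization of `n + 1` disjoint arcs of the circle which start at the `(n + 1)`-st roots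
of unity. -/
def arc (n : ℕ) (x : Fin (n + 1) × I) : Circle := 𝐞 ((((x.1 : ℕ) : ℝ) + (x.2 : ℝ) / 2) / (n + 1))

theorem continuous_arc (n : ℕ) : Continuous (arc n) := by
  have hcast : Continuous fun x : Fin (n + 1) × I => ((x.1 : ℕ) : ℝ) :=
    (continuous_of_discreteTopology (f := fun a : Fin (n + 1) => ((a : ℕ) : ℝ))).comp
      continuous_fst
  exact Real.continuous_fourierChar.comp (by fun_prop)

theorem injective_arc (n : ℕ) : Function.Injective (arc n) := by
  have mem_Ico (x : Fin (n + 1) × I) :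
      (((x.1 : ℕ) : ℝ) + (x.2 : ℝ) / 2) / (n + 1) ∈ Set.Ico (0 : ℝ) 1 := by
    have hle : (((x.1 : ℕ) : ℝ)) ≤ n := by exact_mod_cast Nat.lt_succ_iff.1 x.1.2
    have hnonneg := x.2.2.1
    refine ⟨by positivity, ?_⟩
    rw [div_lt_one (by positivity)]
    linarith [x.2.2.2]
  have floor_eq (x : Fin (n + 1) × I) : ⌊((x.1 : ℕ) : ℝ) + (x.2 : ℝ) / 2⌋₊ = x.1 := by
    have hnonneg := x.2.2.1
    rw [Nat.floor_eq_iff (by positivity)]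
    exact ⟨by linarith, by linarith [x.2.2.2]⟩
  intro x y hxy
  have heq := (div_left_inj' (by positivity)).1 (injOn_fourierChar (mem_Ico x) (mem_Ico y) hxy)
  have hfst : x.1 = y.1 := Fin.ext (by rw [← floor_eq x, heq, floor_eq y])
  refine Prod.ext hfst (Subtype.ext ?_)
  rw [hfst] at heq
  linarith

namespace MarkedCircle

variable {G : PlanarLieGroup.{u}} {H : PlanarHomeoGroup G} {X Y : MarkedCircle H}

theorem MarkedHomeo.ext_of_φt {a a' : MarkedHomeo X Y} (x : X.F) (h : a.1.φt x = a'.1.φt x) :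
    a = a' := by
  refine Subtype.ext (StructuredHomeo.ext ?_ ?_)
  · ext z
    obtain ⟨c, rfl⟩ := (X.ρ x).surjective z
    rw [← a.1.ρ_φt, ← a'.1.ρ_φt, h]
  · ext z
    rw [← X.act_gap x z, a.1.φt_act, a'.1.φt_act, h]

/-- The structured homeomorphism which maps the point `x` of the torsor of `X` to `y h`. -/
def ofElement (x : X.F) (y : Y.F) (h : H)
    (hh : Set.MapsTo (H.q h) (X.markedPreimage x) (Y.markedPreimage y)) : MarkedHomeo X Y :=
  ⟨{ φ := ((X.ρ x).symm.trans (H.q h)).trans (Y.ρ y)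
     φt := ((X.isHomeomorph_act x).homeomorph.symm.trans (Homeomorph.mulLeft h)).trans
       (Y.isHomeomorph_act y).homeomorph
     φt_act := fun z k => by
       change Y.act y (h * X.gap x (X.act z k)) = Y.act (Y.act y (h * X.gap x z)) k
       rw [X.gap_act_right, ← mul_assoc, Y.act_mul y]
     ρ_φt := fun z c => by
       change Y.ρ (Y.act y (h * X.gap x z)) c = Y.ρ y (H.q h ((X.ρ x).symm (X.ρ z c)))
       rw [Y.ρ_act, H.q_mul_apply, X.ρ_eq_ρ_gap x z, Homeomorph.symm_apply_apply] },
    fun z hz => hh (by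
      change X.ρ x ((X.ρ x).symm z) ∈ X.J
      rwa [Homeomorph.apply_symm_apply])⟩

theorem ofElement_φt (x : X.F) (y : Y.F) (h : H)
    (hh : Set.MapsTo (H.q h) (X.markedPreimage x) (Y.markedPreimage y)) (z : X.F) :
    (ofElement x y h hh).1.φt z = Y.act y (h * X.gap x z) := rfl

theorem ofElement_φt_self (x : X.F) (y : Y.F) (h : H)
    (hh : Set.MapsTo (H.q h) (X.markedPreimage x) (Y.markedPreimage y)) :
    (ofElement x y h hh).1.φt x = Y.act y h := by
  rw [ofElement_φt, gap_self, mul_one]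

theorem ofElement_eq_of_eq_gap {a : MarkedHomeo X Y} {x : X.F} {y : Y.F} {h : H}
    (hh : Set.MapsTo (H.q h) (X.markedPreimage x) (Y.markedPreimage y))
    (heq : h = Y.gap y (a.1.φt x)) : ofElement x y h hh = a :=
  MarkedHomeo.ext_of_φt x (by rw [ofElement_φt_self, heq, act_gap])

theorem continuous_ofElement {T : Type*} [TopologicalSpace T] (x : X.F) (y : Y.F) {f : T → H}
    (hf : Continuous f)
    (hh : ∀ s, Set.MapsTo (H.q (f s)) (X.markedPreimage x) (Y.markedPreimage y)) :
    Continuous fun s => ofElement x y (f s) (hh s) := by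
  refine continuous_of ?_ fun z => ?_
  · refine ContinuousMap.continuous_of_continuous_uncurry _ ?_
    change Continuous fun p : T × X.C => Y.ρ y (H.q (f p.1) ((X.ρ x).symm p.2))
    exact (Y.ρ y).continuous.comp ((continuous_homeo_eval Circle Circle).comp
      ((H.continuous_q.comp (hf.comp continuous_fst)).prodMk
        ((X.ρ x).symm.continuous.comp continuous_snd)))
  · simp only [ofElement_φt]
    exact (Y.isHomeomorph_act y).continuous.comp (hf.mul continuous_const)

theorem mk_eq_of_homOfFrames_eq {m n : ℕ} {a a' : MarkedHomeo X Y} (y : Y.FrameSpace n)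
    (x : X.FrameSpace m) (h : homOfFrames a y x = homOfFrames a' y x) :
    ZerothHomotopy.mk a = ZerothHomotopy.mk a' := by
  obtain ⟨γ, hγ⟩ := PlanarHomeoGroup.exists_path_of_homClass_eq (A := X.markedPreimage x.1)
    y.isMarking x.fourierChar_mem (fun t ht => (x.isMarking.existsUnique t ht).exists)
    (mapsTo_gap_φt a y.1 x.1) (mapsTo_gap_φt a' y.1 x.1) h
  exact ZerothHomotopy.sound
    { toFun := fun s => ofElement x.1 y.1 (γ s) (hγ s).1
      continuous_toFun := continuous_ofElement x.1 y.1 γ.continuous _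
      source' := ofElement_eq_of_eq_gap _ γ.source
      target' := ofElement_eq_of_eq_gap _ γ.target }

instance : (toStructuredSetFunctor H).Faithful where
  map_injective {X Y} α α' h := by
    obtain ⟨a, rfl⟩ := ZerothHomotopy.mk_surjective α
    obtain ⟨a', rfl⟩ := ZerothHomotopy.mk_surjective α'
    obtain ⟨x⟩ := X.nonempty_frameSpace
    obtain ⟨y⟩ := Y.nonempty_frameSpace
    refine mk_eq_of_homOfFrames_eq y x ?_
    rw [← homOfFrameClasses_mk, ← homOfFrameClasses_mk]
    exact congrArg (fun ψ : StructuredSet.Hom X.toStructuredSet Y.toStructuredSet =>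
      ψ.app (ZerothHomotopy.mk y) (ZerothHomotopy.mk x)) h

instance : (toStructuredSetFunctor H).Full where
  map_surjective {X Y} (ψ : StructuredSet.Hom X.toStructuredSet Y.toStructuredSet) := by
    obtain ⟨x⟩ := X.nonempty_frameSpace
    obtain ⟨y⟩ := Y.nonempty_frameSpace
    obtain ⟨h, hmaps, hclass⟩ := PlanarHomeoGroup.exists_homClass_eq_of_isFatMarking (H := H)
      x.isFatMarking y.isFatMarking (ψ.app (ZerothHomotopy.mk y) (ZerothHomotopy.mk x))
    refine ⟨ZerothHomotopy.mk (ofElement x.1 y.1 h hmaps), StructuredSet.hom_ext_of_app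
      (X := X.toStructuredSet) (Y := Y.toStructuredSet) (ZerothHomotopy.mk y)
      (ZerothHomotopy.mk x) (Eq.trans ?_ hclass)⟩
    change homOfFrameClasses _ _ _ = _
    rw [homOfFrameClasses_mk, homOfFrames, ofElement_φt_self, gap_act]

theorem isClosedEmbedding_up_arc (n : ℕ) :
    IsClosedEmbedding (ULift.up.{u} ∘ arc n) :=
  Homeomorph.ulift.symm.isClosedEmbedding.comp
    ((continuous_arc n).isClosedEmbedding (injective_arc n))

variable (H) in
/-- The standard marked circle with `n + 1` arcs. -/
def standard (n : ℕ) : MarkedCircle H where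
  C := ULift.{u} Circle
  nonempty_homeo := ⟨Homeomorph.ulift.symm⟩
  F := H
  nonempty_F := ⟨1⟩
  act x h := x * h
  act_one := mul_one
  act_mul x g h := (mul_assoc x g h).symm
  isHomeomorph_act x := (Homeomorph.mulLeft x).isHomeomorph
  ρ x := (H.q x).trans Homeomorph.ulift.symm
  ρ_act x h z := congrArg ULift.up (H.q_mul_apply x h z)
  J := Set.range (ULift.up ∘ arc n)
  nonempty_J := Set.range_nonempty _
  isClosed_J := (isClosedEmbedding_up_arc n).isClosed_range
  exists_intervals := ⟨n + 1, ⟨(isClosedEmbedding_up_arc n).isEmbedding.toHomeomorph.symm⟩⟩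

theorem dim_standard (n : ℕ) : (standard H n).dim = n := by
  have : PathConnectedSpace I := isPathConnected_iff_pathConnectedSpace.1
    ((convex_Icc 0 1).isPathConnected (Set.nonempty_Icc.2 zero_le_one))
  have hcard := card_zerothHomotopy_of_homeomorph
    (isClosedEmbedding_up_arc n).isEmbedding.toHomeomorph.symm
  rw [Nat.card_fin] at hcard
  exact Nat.sub_eq_of_eq_add hcard

instance : (toStructuredSetFunctor H).EssSurj where
  mem_essImage S := ⟨standard H S.n, StructuredSet.nonempty_iso_of_eq (dim_standard S.n)⟩

instance : (toStructuredSetFunctor H).IsEquivalence where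

theorem map_toStructuredHom (α : X ⟶ Y) (c : ZerothHomotopy X.J) :
    StructuredSet.Hom.map (toStructuredHom α) c = ((pi0 H).map α).hom c := by
  obtain ⟨a, rfl⟩ := ZerothHomotopy.mk_surjective α
  obtain ⟨x⟩ := X.nonempty_frameSpace
  obtain ⟨y⟩ := Y.nonempty_frameSpace
  obtain ⟨k, rfl⟩ := x.2.2.2 c
  have hvertex : (X.toStructuredSet.ρ (ZerothHomotopy.mk x)).symm (x.component k) = k :=
    (Equiv.ofBijective x.component x.2.2).symm_apply_apply k
  rw [StructuredSet.Hom.map, StructuredSet.Hom.mapAt_eq _ _ (ZerothHomotopy.mk y) _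
    (ZerothHomotopy.mk x)]
  change y.component (lam (DeltaG.incl G) (homOfFrameClasses (ZerothHomotopy.mk a)
    (ZerothHomotopy.mk y) (ZerothHomotopy.mk x))
      ((X.toStructuredSet.ρ (ZerothHomotopy.mk x)).symm (x.component k))) =
        ZerothHomotopy.mk (a.onJ ⟨X.ρ x.1 (root X.dim k), x.2.1 k⟩)
  rw [hvertex, homOfFrameClasses_mk]
  refine (y.componentAt_act_root (mapsRoots_gap_φt a y.1 x) k).symm.trans
    (congrArg ZerothHomotopy.mk (Subtype.ext ?_))
  change Y.ρ _ _ = a.1.φ _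
  rw [Y.act_gap, a.1.ρ_φt]

variable (H) in
/-- The factorization of `(C, J) ↦ π₀(J)` through structured sets, as a natural isomorphism. -/
def forgetIso :
    toStructuredSetFunctor H ⋙ StructuredSet.forget (DeltaG.incl G) ≅ pi0 H :=
  NatIso.ofComponents (fun _ => Iso.refl _) fun α => by
    apply ObjectProperty.hom_ext
    ext c
    exact map_toStructuredHom α c

end MarkedCircle

/-! ### The topological group of homeomorphisms of the circle -/

theorem continuous_homeo_of_uncurry {T X Y : Type*} [TopologicalSpace T] [TopologicalSpace X]
    [TopologicalSpace Y] {f : T → (X ≃ₜ Y)} (h : Continuous fun x : T × X => f x.1 x.2) :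
    Continuous f :=
  continuous_induced_rng.2 (ContinuousMap.continuous_of_continuous_uncurry _ h)

instance (X : Type*) [TopologicalSpace X] [LocallyCompactSpace X] : ContinuousMul (X ≃ₜ X) where
  continuous_mul := by
    have hev := continuous_homeo_eval X X
    exact continuous_homeo_of_uncurry <| hev.comp <| (continuous_fst.comp continuous_fst).prodMk <|
      hev.comp <| (continuous_snd.comp continuous_fst).prodMk continuous_snd

instance (X : Type*) [TopologicalSpace X] [CompactSpace X] [T2Space X] :
    ContinuousInv (X ≃ₜ X) where
  continuous_inv := by
    refine continuous_induced_rng.2 (ContinuousMap.continuous_compactOpen.2 fun K hK U hU => ?_)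
    have mapsTo_inv_iff (φ : X ≃ₜ X) : Set.MapsTo ⇑φ⁻¹ K U ↔ Set.MapsTo φ Uᶜ Kᶜ := by
      refine ⟨fun h z hz hzK => hz ?_, fun h z hz => by_contra fun hzU => h hzU ?_⟩
      · simpa using h hzK
      · simpa using hz
    change IsOpen {φ : X ≃ₜ X | Set.MapsTo ⇑φ⁻¹ K U}
    simp only [mapsTo_inv_iff]
    exact (ContinuousMap.isOpen_setOfPred_mapsTo hU.isClosed_compl.isCompact
      hK.isClosed.isOpen_compl).preimage continuous_induced_dom

/-- The orientation character of a homeomorphism of the circle: its degree. -/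
def orientation (φ : Circle ≃ₜ Circle) : ℤˣ := (exists_lift φ).choose

/-- A lift of a homeomorphism of the circle, precomposed with its orientation so as to be
increasing. -/
def liftOf (φ : Circle ≃ₜ Circle) : CircleLift := (exists_lift φ).choose_spec.choose

theorem apply_fourierChar (φ : Circle ≃ₜ Circle) (t : ℝ) :
    φ (𝐞 t) = 𝐞 (liftOf φ (orientation φ * t)) :=
  (exists_lift φ).choose_spec.choose_spec t

theorem apply_one (φ : Circle ≃ₜ Circle) : φ 1 = 𝐞 (liftOf φ 0) := by
  simpa using apply_fourierChar φ 0

theorem orientation_eq {φ : Circle ≃ₜ Circle} {ε : ℤˣ} {l : CircleLift}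
    (h : ∀ t, φ (𝐞 t) = 𝐞 (l (ε * t))) : orientation φ = ε :=
  (lift_unique fun t => by rw [← apply_fourierChar, h]).1

theorem exists_liftOf_eq {φ : Circle ≃ₜ Circle} {ε : ℤˣ} {l : CircleLift}
    (h : ∀ t, φ (𝐞 t) = 𝐞 (l (ε * t))) : ∃ k : ℤ, liftOf φ = CircleLift.translation k * l :=
  (lift_unique fun t => by rw [← apply_fourierChar, h]).2

/-- The displacement of a homeomorphism `φ` of the circle at `z`: the angle, measured in turns
along a lift, by which `φ z` is ahead of the image of `z` under the orthogonal transformation that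
agrees with `φ` at `1` and has the same orientation. -/
def displacement (φ : Circle ≃ₜ Circle) (z : Circle) : ℝ :=
  liftOf φ (orientation φ * Function.surjInv fourierChar_surjective z) - liftOf φ 0 -
    orientation φ * Function.surjInv fourierChar_surjective z

theorem displacement_fourierChar {φ : Circle ≃ₜ Circle} {ε : ℤˣ} {l : CircleLift}
    (h : ∀ t, φ (𝐞 t) = 𝐞 (l (ε * t))) (t : ℝ) :
    displacement φ (𝐞 t) = l (ε * t) - l 0 - ε * t := by
  obtain ⟨k, hk⟩ := exists_liftOf_eq h
  obtain ⟨c, hc⟩ := fourierChar_eq_iff.1 (Function.surjInv_eq fourierChar_surjective (𝐞 t))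
  have hper := CircleDeg1Lift.map_add_int l (ε * t) (ε * c)
  push_cast at hper
  rw [displacement, orientation_eq h, hk, hc, CircleLift.mul_apply, CircleLift.mul_apply,
    CircleLift.translation_apply, CircleLift.translation_apply, mul_add, hper]
  ring

theorem continuous_displacement_right (φ : Circle ≃ₜ Circle) : Continuous (displacement φ) := by
  refine isOpenQuotientMap_fourierChar.isQuotientMap.continuous_iff.2 ?_
  have hlift : displacement φ ∘ 𝐞 =
      fun t => liftOf φ (orientation φ * t) - liftOf φ 0 - orientation φ * t :=
    funext (displacement_fourierChar (apply_fourierChar φ))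
  rw [hlift]
  fun_prop

/-- The angle in `(-1/2, 1/2]`, measured in turns, from the image of the point `z` under `φ₀` to
its image under `φ`. -/
def angle (φ₀ φ : Circle ≃ₜ Circle) (z : Circle) : ℝ :=
  Complex.arg ((φ z / φ₀ z : Circle) : ℂ) / (2 * Real.pi)

theorem fourierChar_angle (φ₀ φ : Circle ≃ₜ Circle) (z : Circle) :
    𝐞 (angle φ₀ φ z) = φ z / φ₀ z := by
  rw [Real.fourierChar_apply', angle, mul_div_cancel₀ _ Real.two_pi_pos.ne', Circle.exp_arg]

theorem continuous_div_apply (φ₀ : Circle ≃ₜ Circle) :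
    Continuous fun x : (Circle ≃ₜ Circle) × Circle => ((x.1 x.2 / φ₀ x.2 : Circle) : ℂ) :=
  continuous_subtype_val.comp
    ((continuous_homeo_eval Circle Circle).div' (φ₀.continuous.comp continuous_snd))

theorem continuousAt_angle {T : Type*} [TopologicalSpace T] {φ₀ : Circle ≃ₜ Circle}
    {f : T → (Circle ≃ₜ Circle)} {g : T → Circle} (hf : Continuous f) (hg : Continuous g) {t : T}
    (h : ((f t (g t) / φ₀ (g t) : Circle) : ℂ) ∈ Complex.slitPlane) :
    ContinuousAt (fun t => angle φ₀ (f t) (g t)) t :=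
  (ContinuousAt.comp (g := Complex.arg) (x := t) (Complex.continuousAt_arg h)
    ((continuous_div_apply φ₀).comp (hf.prodMk hg)).continuousAt).div_const _

theorem div_self_mem_slitPlane (z : Circle) : ((z / z : Circle) : ℂ) ∈ Complex.slitPlane := by
  simp

theorem eventually_mem_slitPlane (φ₀ : Circle ≃ₜ Circle) :
    ∀ᶠ φ in 𝓝 φ₀, ∀ z, ((φ z / φ₀ z : Circle) : ℂ) ∈ Complex.slitPlane := by
  have hcont : Continuous fun φ : Circle ≃ₜ Circle =>
      (⟨fun z => ((φ z / φ₀ z : Circle) : ℂ),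
        continuous_subtype_val.comp (φ.continuous.div' φ₀.continuous)⟩ : C(Circle, ℂ)) :=
    ContinuousMap.continuous_of_continuous_uncurry _ (continuous_div_apply φ₀)
  have hopen := (ContinuousMap.isOpen_setOfPred_mapsTo (isCompact_univ (X := Circle))
    Complex.isOpen_slitPlane).preimage hcont
  filter_upwards [hopen.mem_nhds fun z _ => div_self_mem_slitPlane (φ₀ z)] with φ hφ z
  exact hφ (Set.mem_univ z)

theorem exists_lift_eq_add_angle {φ₀ φ : Circle ≃ₜ Circle}
    (h : ∀ z, ((φ z / φ₀ z : Circle) : ℂ) ∈ Complex.slitPlane) :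
    ∃ l : CircleLift, (∀ t, φ (𝐞 t) = 𝐞 (l (orientation φ₀ * t))) ∧
      ∀ t, l (orientation φ₀ * t) = liftOf φ₀ (orientation φ₀ * t) + angle φ₀ φ (𝐞 t) := by
  have hcont : Continuous (angle φ₀ φ) := continuous_iff_continuousAt.2 fun z =>
    continuousAt_angle continuous_const continuous_id (h z)
  have hlift (t : ℝ) :
      𝐞 (liftOf φ₀ (orientation φ₀ * t) + angle φ₀ φ (𝐞 t)) = φ (𝐞 t) := by
    rw [AddChar.map_add_eq_mul, ← apply_fourierChar, fourierChar_angle, mul_div_cancel]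
  obtain ⟨ε, l, hl⟩ := exists_eq_of_lift (φ := φ)
    (by have := Real.continuous_fourierChar; fun_prop) hlift
  obtain rfl : orientation φ₀ = ε := by
    have h0 := hl 0
    have h1 := hl 1
    have hper₀ := CircleDeg1Lift.map_add_int (liftOf φ₀) 0 (orientation φ₀)
    have hper := CircleDeg1Lift.map_add_int l 0 ε
    have fourierChar_one : 𝐞 1 = 𝐞 0 := by simpa using fourierChar_add_one 0
    simp only [mul_one, mul_zero, zero_add, fourierChar_one] at h0 h1 hper₀ hper
    exact Units.ext (by exact_mod_cast (by linarith : ((orientation φ₀ : ℤ) : ℝ) = (ε : ℤ)))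
  exact ⟨l, fun t => by rw [← hl, hlift], fun t => (hl t).symm⟩

theorem orientation_eq_of_forall_mem_slitPlane {φ₀ φ : Circle ≃ₜ Circle}
    (h : ∀ z, ((φ z / φ₀ z : Circle) : ℂ) ∈ Complex.slitPlane) : orientation φ = orientation φ₀ :=
  let ⟨_, hl, _⟩ := exists_lift_eq_add_angle h
  orientation_eq hl

theorem displacement_eq_of_forall_mem_slitPlane {φ₀ φ : Circle ≃ₜ Circle}
    (h : ∀ z, ((φ z / φ₀ z : Circle) : ℂ) ∈ Complex.slitPlane) (z : Circle) :
    displacement φ z = displacement φ₀ z + angle φ₀ φ z - angle φ₀ φ 1 := by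
  obtain ⟨l, hl, hangle⟩ := exists_lift_eq_add_angle h
  obtain ⟨t, rfl⟩ := fourierChar_surjective z
  have h0 := hangle 0
  rw [mul_zero, AddChar.map_zero_eq_one] at h0
  rw [displacement_fourierChar hl, displacement_fourierChar (apply_fourierChar φ₀), hangle, h0]
  ring

theorem continuous_orientation : Continuous orientation :=
  continuous_iff_continuousAt.2 fun φ₀ => continuousAt_const.congr <|
    (eventually_mem_slitPlane φ₀).mono fun _ hφ => (orientation_eq_of_forall_mem_slitPlane hφ).symm

theorem continuous_displacement :
    Continuous fun x : (Circle ≃ₜ Circle) × Circle => displacement x.1 x.2 := by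
  rw [continuous_iff_continuousAt]
  rintro ⟨φ₀, z₀⟩
  have hangle : ContinuousAt (fun x : (Circle ≃ₜ Circle) × Circle => angle φ₀ x.1 x.2) (φ₀, z₀) :=
    continuousAt_angle continuous_fst continuous_snd (div_self_mem_slitPlane _)
  have hangle_one : ContinuousAt
      (fun x : (Circle ≃ₜ Circle) × Circle => angle φ₀ x.1 1) (φ₀, z₀) :=
    continuousAt_angle continuous_fst continuous_const (div_self_mem_slitPlane _)
  have hright : Continuous fun x : (Circle ≃ₜ Circle) × Circle => displacement φ₀ x.2 :=
    (continuous_displacement_right φ₀).comp continuous_snd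
  have hnear : ∀ᶠ x in 𝓝 (φ₀, z₀), displacement φ₀ x.2 + angle φ₀ x.1 x.2 - angle φ₀ x.1 1 =
      displacement x.1 x.2 :=
    (continuous_fst.continuousAt.eventually (eventually_mem_slitPlane φ₀)).mono
      fun x hx => (displacement_eq_of_forall_mem_slitPlane hx x.2).symm
  exact ((hright.continuousAt.add hangle).sub hangle_one).congr hnear

theorem continuous_displacement_apply_one {T : Type*} [TopologicalSpace T]
    {f g : T → (Circle ≃ₜ Circle)} (hf : Continuous f) (hg : Continuous g) :
    Continuous fun t => displacement (f t) (g t 1) :=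
  continuous_displacement.comp
    (hf.prodMk ((continuous_homeo_eval Circle Circle).comp (hg.prodMk continuous_const)))

theorem mul_apply_fourierChar (φ ψ : Circle ≃ₜ Circle) (t : ℝ) :
    (φ * ψ) (𝐞 t) = 𝐞 ((liftOf φ * CircleLift.conj (orientation φ) (liftOf ψ))
      ((orientation φ * orientation ψ : ℤˣ) * t)) := by
  rw [CircleLift.mul_apply, CircleLift.conj_apply, Units.val_mul, Int.cast_mul, mul_assoc,
    units_mul_units_mul, ← apply_fourierChar, ← apply_fourierChar]
  rfl

theorem orientation_mul (φ ψ : Circle ≃ₜ Circle) :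
    orientation (φ * ψ) = orientation φ * orientation ψ :=
  orientation_eq (mul_apply_fourierChar φ ψ)

theorem displacement_mul (φ ψ : Circle ≃ₜ Circle) (z : Circle) :
    displacement (φ * ψ) z + displacement φ (ψ 1) =
      displacement φ (ψ z) + orientation φ * displacement ψ z := by
  obtain ⟨t, rfl⟩ := fourierChar_surjective z
  rw [displacement_fourierChar (mul_apply_fourierChar φ ψ), apply_one ψ, apply_fourierChar ψ,
    displacement_fourierChar (apply_fourierChar φ), displacement_fourierChar (apply_fourierChar φ),
    displacement_fourierChar (apply_fourierChar ψ), CircleLift.mul_apply, CircleLift.mul_apply]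
  simp only [CircleLift.conj_apply, Units.val_mul, Int.cast_mul, mul_assoc, units_mul_units_mul,
    mul_zero]
  ring

theorem displacement_one_right (φ : Circle ≃ₜ Circle) : displacement φ 1 = 0 := by
  simpa using displacement_fourierChar (apply_fourierChar φ) 0

/-! ### The retraction of `Homeo(S¹)` to `O(2)` -/

namespace O2

theorem eq_of_act_one_eq {A B : O2} (h : act A 1 = act B 1) (hs : sign A = sign B) : A = B :=
  toHomeo_injective <| homeo_ext fun t => by
    change act A (𝐞 t) = act B (𝐞 t)
    rw [act_fourierChar, act_fourierChar B, h, hs]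

theorem exists_toHomeo_fourierChar (A : O2) :
    ∃ s, ∀ t, toHomeo A (𝐞 t) = 𝐞 (CircleLift.translation s (sign A * t)) := by
  obtain ⟨s, hs⟩ := fourierChar_surjective (act A 1)
  refine ⟨s, fun t => ?_⟩
  rw [CircleLift.translation_apply, AddChar.map_add_eq_mul, hs, ← act_fourierChar]
  rfl

theorem orientation_toHomeo (A : O2) : orientation (toHomeo A) = sign A :=
  let ⟨_, hs⟩ := exists_toHomeo_fourierChar A
  orientation_eq hs

theorem displacement_toHomeo (A : O2) (z : Circle) : displacement (toHomeo A) z = 0 := by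
  obtain ⟨s, hs⟩ := exists_toHomeo_fourierChar A
  obtain ⟨t, rfl⟩ := fourierChar_surjective z
  simp [displacement_fourierChar hs]

theorem continuous_toHomeo : Continuous toHomeo := by
  refine continuous_homeo_of_uncurry (Continuous.subtype_mk ?_ _)
  have hentry (a b : Fin 2) : Continuous fun x : O2 × Circle => x.1.1 a b :=
    (continuous_subtype_val.comp continuous_fst).matrix_elem a b
  have hre : Continuous fun x : O2 × Circle => (x.2 : ℂ).re := by fun_prop
  have him : Continuous fun x : O2 × Circle => (x.2 : ℂ).im := by fun_prop
  exact Complex.equivRealProdCLM.symm.continuous.comp <|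
    (((hentry 0 0).mul hre).add ((hentry 0 1).mul him)).prodMk
      (((hentry 1 0).mul hre).add ((hentry 1 1).mul him))

theorem circle_re_mul_re_add_im_mul_im (z : Circle) :
    (z : ℂ).re * (z : ℂ).re + (z : ℂ).im * (z : ℂ).im = 1 := by
  rw [← Complex.normSq_apply, Circle.normSq_coe]

/-- The orthogonal matrix with first column `z` and determinant `ε`. -/
def ofColumn (z : Circle) (ε : ℤˣ) : O2 :=
  ⟨!![(z : ℂ).re, -ε * (z : ℂ).im; (z : ℂ).im, ε * (z : ℂ).re], by
    have hz := circle_re_mul_re_add_im_mul_im z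
    rw [Matrix.mem_orthogonalGroup_iff]
    rcases Int.units_eq_one_or ε with rfl | rfl <;> ext a b <;> fin_cases a <;> fin_cases b <;>
      simp [Matrix.mul_apply, Fin.sum_univ_two] <;> linarith⟩

theorem act_ofColumn_one (z : Circle) (ε : ℤˣ) : act (ofColumn z ε) 1 = z := by
  apply Circle.ext
  apply Complex.ext <;> simp [act, ofColumn]

theorem sign_ofColumn (z : Circle) (ε : ℤˣ) : sign (ofColumn z ε) = ε := by
  have hdet : (ofColumn z ε).1.det = ε := by
    rw [ofColumn, Matrix.det_fin_two_of]
    linear_combination (ε : ℝ) * circle_re_mul_re_add_im_mul_im z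
  exact Units.ext (by exact_mod_cast (sign_cast (ofColumn z ε)).trans hdet)

theorem continuous_ofColumn : Continuous fun x : Circle × ℤˣ => ofColumn x.1 x.2 := by
  have hε : Continuous fun x : Circle × ℤˣ => ((x.2 : ℤ) : ℝ) :=
    (continuous_of_discreteTopology (f := fun ε : ℤˣ => ((ε : ℤ) : ℝ))).comp continuous_snd
  refine Continuous.subtype_mk (continuous_matrix fun a b => ?_) _
  fin_cases a <;> fin_cases b <;>
    simp only [Fin.isValue, Fin.zero_eta, Fin.mk_one, Matrix.of_apply, Matrix.cons_val',
      Matrix.cons_val_zero, Matrix.cons_val_one, Matrix.cons_val_fin_one] <;>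
    fun_prop

end O2

/-- The retraction of `Homeo(S¹)` onto `O(2)`, which keeps the orientation and the image of `1`. -/
def retract (φ : Circle ≃ₜ Circle) : O2 := O2.ofColumn (φ 1) (orientation φ)

theorem act_retract_one (φ : Circle ≃ₜ Circle) : O2.act (retract φ) 1 = φ 1 :=
  O2.act_ofColumn_one _ _

theorem sign_retract (φ : Circle ≃ₜ Circle) : O2.sign (retract φ) = orientation φ :=
  O2.sign_ofColumn _ _

theorem continuous_retract : Continuous retract :=
  O2.continuous_ofColumn.comp (((continuous_homeo_eval Circle Circle).comp
    (continuous_id.prodMk continuous_const)).prodMk continuous_orientation)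

theorem retract_toHomeo (A : O2) : retract (O2.toHomeo A) = A :=
  O2.eq_of_act_one_eq (act_retract_one _) ((sign_retract _).trans (O2.orientation_toHomeo A))

theorem retract_one : retract 1 = 1 := by rw [← map_one O2.toHomeo, retract_toHomeo]

theorem apply_eq_displacement_mul_retract (φ : Circle ≃ₜ Circle) (z : Circle) :
    φ z = 𝐞 (displacement φ z) * O2.act (retract φ) z := by
  obtain ⟨t, rfl⟩ := fourierChar_surjective z
  rw [O2.act_fourierChar, act_retract_one, sign_retract, apply_one φ, apply_fourierChar,
    displacement_fourierChar (apply_fourierChar φ), ← AddChar.map_add_eq_mul,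
    ← AddChar.map_add_eq_mul]
  ring_nf

theorem retract_mul (φ ψ : Circle ≃ₜ Circle) :
    retract (φ * ψ) = O2.rotation (displacement φ (ψ 1)) * retract φ * retract ψ := by
  refine O2.eq_of_act_one_eq ?_ ?_
  · rw [act_retract_one, O2.act_mul, O2.act_mul, act_retract_one, O2.act_rotation,
      ← apply_eq_displacement_mul_retract]
    rfl
  · rw [sign_retract, map_mul, map_mul, O2.sign_rotation, sign_retract, sign_retract, one_mul,
      orientation_mul]

theorem retract_inv (φ : Circle ≃ₜ Circle) :
    retract φ⁻¹ = (retract φ)⁻¹ * O2.rotation (-displacement φ (φ⁻¹ 1)) := by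
  have hmul := retract_mul φ φ⁻¹
  have hrot := O2.rotation_add (-displacement φ (φ⁻¹ 1)) (displacement φ (φ⁻¹ 1))
  have rotation_zero : O2.rotation 0 = 1 := by simpa using O2.rotation_int 0
  rw [mul_inv_cancel, retract_one, mul_assoc] at hmul
  rw [neg_add_cancel, rotation_zero] at hrot
  rw [eq_inv_mul_iff_mul_eq, ← mul_one (O2.rotation (-_)), hmul, ← mul_assoc, ← hrot, one_mul]

namespace CircleLift

theorem orientation_toHomeo (l : CircleLift) : orientation (toHomeo l) = 1 :=
  orientation_eq (l := l) fun t => by simp [toHomeo_fourierChar]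

theorem toHomeo_liftOf {φ : Circle ≃ₜ Circle} (h : orientation φ = 1) : toHomeo (liftOf φ) = φ :=
  homeo_ext fun t => by
    rw [toHomeo_fourierChar, apply_fourierChar φ, h, Units.val_one, Int.cast_one, one_mul]

theorem retract_toHomeo {l : CircleLift} {φ : Circle ≃ₜ Circle} (h : orientation φ = 1)
    (hl : l 0 = liftOf φ 0) : retract (toHomeo l) = retract φ := by
  refine O2.eq_of_act_one_eq ?_ ?_
  · rw [act_retract_one, act_retract_one, apply_one φ, ← hl, ← toHomeo_fourierChar,
      AddChar.map_zero_eq_one]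
  · rw [sign_retract, sign_retract, orientation_toHomeo, h]

theorem toHomeo_translation_liftOf {φ : Circle ≃ₜ Circle} (h : orientation φ = 1) :
    toHomeo (translation (liftOf φ 0)) = O2.toHomeo (retract φ) :=
  homeo_ext fun t => by
    change _ = O2.act (retract φ) (𝐞 t)
    rw [toHomeo_fourierChar, translation_apply, O2.act_fourierChar, act_retract_one, sign_retract,
      h, apply_one φ, AddChar.map_add_eq_mul, Units.val_one, Int.cast_one, one_mul]

end CircleLift

theorem exists_path_retract {φ : Circle ≃ₜ Circle} (h : orientation φ = 1) :
    ∃ γ : Path φ (O2.toHomeo (retract φ)), ∀ s, retract (γ s) = retract φ := by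
  refine ⟨((CircleLift.segmentPath (liftOf φ) (CircleLift.translation (liftOf φ 0))).map
    CircleLift.continuous_toHomeo).cast (CircleLift.toHomeo_liftOf h).symm
      (CircleLift.toHomeo_translation_liftOf h).symm, fun s => CircleLift.retract_toHomeo h ?_⟩
  change CircleLift.segment _ _ s 0 = _
  rw [CircleLift.segment_apply, CircleLift.translation_apply]
  ring

/-! ### Pullbacks of coverings -/

theorem isCoveringMap_pullback_fst {E X Y : Type*} [TopologicalSpace E] [TopologicalSpace X]
    [TopologicalSpace Y] {p : E → X} (hp : IsCoveringMap p) {r : Y → X} (hr : Continuous r) :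
    IsCoveringMap (Function.Pullback.fst : r.Pullback p → Y) := fun y => by
  obtain ⟨hdisc, U, hyU, hU, _, e, he⟩ := hp (r y)
  have hfst : Continuous (Function.Pullback.fst : r.Pullback p → Y) :=
    continuous_fst.comp continuous_subtype_val
  have hmem (x : Function.Pullback.fst (f := r) (g := p) ⁻¹' (r ⁻¹' U)) : x.1.1.2 ∈ p ⁻¹' U := by
    rw [Set.mem_preimage, ← x.1.2]
    exact x.2
  have he_fst (x : Function.Pullback.fst (f := r) (g := p) ⁻¹' (r ⁻¹' U)) :
      (⟨r x.1.1.1, x.2⟩, (e ⟨x.1.1.2, hmem x⟩).2) = e ⟨x.1.1.2, hmem x⟩ :=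
    Prod.ext (Subtype.ext (x.1.2.trans (he ⟨x.1.1.2, hmem x⟩).symm)) rfl
  suffices h : IsEvenlyCovered (Function.Pullback.fst : r.Pullback p → Y) y (p ⁻¹' {r y}) from
    h.to_isEvenlyCovered_preimage
  refine ⟨hdisc, r ⁻¹' U, hyU, hU.preimage hr, (hU.preimage hr).preimage hfst,
    { toFun x := (⟨x.1.1.1, x.2⟩, (e ⟨x.1.1.2, hmem x⟩).2)
      invFun z := ⟨⟨(z.1, e.symm (⟨r z.1, z.1.2⟩, z.2)), by rw [← he, e.apply_symm_apply]⟩, z.1.2⟩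
      left_inv x := by
        refine Subtype.ext (Subtype.ext (Prod.ext rfl ?_))
        change (e.symm (⟨r x.1.1.1, x.2⟩, (e ⟨x.1.1.2, hmem x⟩).2) : E) = x.1.1.2
        rw [he_fst, e.symm_apply_apply]
      right_inv z := by simp only [Subtype.coe_eta, e.apply_symm_apply]
      continuous_toFun := by fun_prop
      continuous_invFun := by fun_prop }, fun _ => rfl⟩

/-! ### The planar homeomorphism group of a planar Lie group -/

/-- The pullback of `p : G → O(2)` along the retraction `Homeo(S¹) → O(2)`. It carries a group
structure which makes the projection to `Homeo(S¹)` a homomorphism, although the retraction is not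
one. -/
def RetractPullback (G : PlanarLieGroup.{u}) : Type u := Function.Pullback retract G.p

namespace RetractPullback

variable {G : PlanarLieGroup.{u}}

instance : TopologicalSpace (RetractPullback G) := instTopologicalSpaceSubtype

/-- The homeomorphism of the circle underlying an element of the pullback. -/
def homeo (x : RetractPullback G) : Circle ≃ₜ Circle := Function.Pullback.fst x

/-- The element of `G` over the retraction of the underlying homeomorphism. -/
def elem (x : RetractPullback G) : G := Function.Pullback.snd x

theorem p_elem (x : RetractPullback G) : G.p x.elem = retract x.homeo := x.2.symm

theorem ext {x y : RetractPullback G} (hhomeo : x.homeo = y.homeo) (helem : x.elem = y.elem) :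
    x = y :=
  Subtype.ext (Prod.ext hhomeo helem)

theorem continuous_homeo : Continuous (homeo (G := G)) := continuous_fst.comp continuous_subtype_val

theorem continuous_elem : Continuous (elem (G := G)) := continuous_snd.comp continuous_subtype_val

theorem continuous_of_homeo_elem {T : Type*} [TopologicalSpace T] {f : T → RetractPullback G}
    (hhomeo : Continuous fun t => (f t).homeo) (helem : Continuous fun t => (f t).elem) :
    Continuous f :=
  continuous_induced_rng.2 (hhomeo.prodMk helem)

theorem sign_elem (x : RetractPullback G) : G.sign x.elem = orientation x.homeo := by
  rw [← sign_retract, ← x.p_elem]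
  rfl

/-- The factor `e(displacement)` lifts to `G` the rotation by which the retraction fails to be
multiplicative. -/
instance : Mul (RetractPullback G) where
  mul x y := ⟨(x.homeo * y.homeo, G.e (displacement x.homeo (y.homeo 1)) * x.elem * y.elem), by
    rw [map_mul, map_mul, G.p_e, x.p_elem, y.p_elem, retract_mul]⟩

instance : One (RetractPullback G) where
  one := ⟨(1, 1), by rw [map_one, retract_one]⟩

instance : Inv (RetractPullback G) where
  inv x := ⟨(x.homeo⁻¹, x.elem⁻¹ * G.e (-displacement x.homeo (x.homeo⁻¹ 1))), by
    rw [map_mul, map_inv, G.p_e, x.p_elem, retract_inv]⟩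

theorem mul_homeo (x y : RetractPullback G) : (x * y).homeo = x.homeo * y.homeo := rfl

theorem mul_elem (x y : RetractPullback G) :
    (x * y).elem = G.e (displacement x.homeo (y.homeo 1)) * x.elem * y.elem := rfl

theorem one_homeo : (1 : RetractPullback G).homeo = 1 := rfl

theorem one_elem : (1 : RetractPullback G).elem = 1 := rfl

theorem inv_homeo (x : RetractPullback G) : x⁻¹.homeo = x.homeo⁻¹ := rfl

theorem inv_elem (x : RetractPullback G) :
    x⁻¹.elem = x.elem⁻¹ * G.e (-displacement x.homeo (x.homeo⁻¹ 1)) := rfl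

theorem elem_mul_e (x : RetractPullback G) (t : ℝ) :
    x.elem * G.e t = G.e (orientation x.homeo * t) * x.elem := by
  rw [G.mul_e, sign_elem]

protected theorem mul_assoc (x y z : RetractPullback G) : x * y * z = x * (y * z) := by
  refine ext (mul_assoc _ _ _) ?_
  simp only [mul_elem, mul_homeo]
  calc G.e (displacement (x.homeo * y.homeo) (z.homeo 1)) *
          (G.e (displacement x.homeo (y.homeo 1)) * x.elem * y.elem) * z.elem
      = G.e (displacement (x.homeo * y.homeo) (z.homeo 1) + displacement x.homeo (y.homeo 1)) *
          x.elem * y.elem * z.elem := by simp only [G.e_add, mul_assoc]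
    _ = G.e (displacement x.homeo (y.homeo (z.homeo 1))) *
          (x.elem * G.e (displacement y.homeo (z.homeo 1))) * y.elem * z.elem := by
        rw [displacement_mul, G.e_add, elem_mul_e]
        simp only [mul_assoc]
    _ = G.e (displacement x.homeo (y.homeo (z.homeo 1))) * x.elem *
          (G.e (displacement y.homeo (z.homeo 1)) * y.elem * z.elem) := by simp only [mul_assoc]

protected theorem mul_one (x : RetractPullback G) : x * 1 = x := by
  refine ext (mul_one _) ?_
  rw [mul_elem, one_homeo, one_elem, Homeomorph.one_apply, displacement_one_right, G.e_zero,
    one_mul, mul_one]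

protected theorem mul_inv_cancel (x : RetractPullback G) : x * x⁻¹ = 1 := by
  refine ext (mul_inv_cancel _) ?_
  rw [mul_elem, inv_homeo, inv_elem, mul_assoc, mul_inv_cancel_left, ← G.e_add, add_neg_cancel,
    G.e_zero, one_elem]

instance : Group (RetractPullback G) :=
  Group.ofRightAxioms RetractPullback.mul_assoc RetractPullback.mul_one
    RetractPullback.mul_inv_cancel

instance : IsTopologicalGroup (RetractPullback G) where
  continuous_mul := by
    have hx : Continuous fun a : RetractPullback G × RetractPullback G => a.1.homeo :=
      continuous_homeo.comp continuous_fst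
    have hy : Continuous fun a : RetractPullback G × RetractPullback G => a.2.homeo :=
      continuous_homeo.comp continuous_snd
    exact continuous_of_homeo_elem (hx.mul hy)
      (((G.e.continuous.comp (continuous_displacement_apply_one hx hy)).mul
        (continuous_elem.comp continuous_fst)).mul (continuous_elem.comp continuous_snd))
  continuous_inv := by
    have hx := (continuous_homeo (G := G)).inv
    exact continuous_of_homeo_elem hx (continuous_elem.inv.mul
      (G.e.continuous.comp (continuous_displacement_apply_one continuous_homeo hx).neg))

/-- The projection of the pullback to `Homeo(S¹)`. -/
def toHomeo : RetractPullback G →* (Circle ≃ₜ Circle) where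
  toFun := homeo
  map_one' := one_homeo
  map_mul' := mul_homeo

/-- The inclusion of `G` over the inclusion of `O(2)` in `Homeo(S¹)`. -/
def incl : G →* RetractPullback G where
  toFun g := ⟨(O2.toHomeo (G.p g), g), retract_toHomeo _⟩
  map_one' := ext ((congrArg O2.toHomeo (map_one G.p)).trans (map_one _)) rfl
  map_mul' g h := by
    refine ext ((congrArg O2.toHomeo (map_mul G.p g h)).trans (map_mul _ _ _)) ?_
    change g * h = G.e (displacement (O2.toHomeo (G.p g)) _) * g * h
    rw [O2.displacement_toHomeo, G.e_zero, one_mul]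

theorem isCoveringMap_toHomeo : IsCoveringMap (toHomeo (G := G)) :=
  isCoveringMap_pullback_fst G.connective.isCoveringMap continuous_retract

theorem continuous_p : Continuous G.p := G.connective.isCoveringMap.continuous

theorem continuous_incl : Continuous (incl (G := G)) :=
  continuous_of_homeo_elem (O2.continuous_toHomeo.comp continuous_p) continuous_id

theorem exists_path_incl_elem {x : RetractPullback G} (hx : orientation x.homeo = 1) :
    Nonempty (Path x (incl x.elem)) := by
  obtain ⟨γ, hγ⟩ := exists_path_retract hx
  exact ⟨{
    toFun s := ⟨(γ s, x.elem), (hγ s).trans x.p_elem.symm⟩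
    continuous_toFun := continuous_of_homeo_elem γ.continuous continuous_const
    source' := ext γ.source rfl
    target' := ext (γ.target.trans (congrArg O2.toHomeo x.p_elem.symm)) rfl }⟩

theorem orientation_of_mem_connectedComponent_one {φ : Circle ≃ₜ Circle}
    (hφ : φ ∈ connectedComponent 1) : orientation φ = 1 := by
  rw [isPreconnected_connectedComponent.constant continuous_orientation.continuousOn hφ
    mem_connectedComponent, ← map_one O2.toHomeo, O2.orientation_toHomeo, map_one]

theorem isConnected_preimage_toHomeo :
    _root_.IsConnected (toHomeo (G := G) ⁻¹' connectedComponent 1) := by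
  have hone : (1 : RetractPullback G) ∈ toHomeo (G := G) ⁻¹' connectedComponent 1 := by
    rw [Set.mem_preimage, map_one]
    exact mem_connectedComponent
  refine ⟨⟨1, hone⟩, isPreconnected_of_forall 1 fun x hx => ?_⟩
  obtain ⟨γ⟩ := exists_path_incl_elem (orientation_of_mem_connectedComponent_one hx)
  have hp_elem : G.p x.elem ∈ connectedComponent (1 : O2) := by
    rw [p_elem, ← retract_one]
    exact continuous_retract.image_connectedComponent_subset 1 (Set.mem_image_of_mem _ hx)
  refine ⟨incl '' (G.p ⁻¹' connectedComponent 1) ∪ Set.range γ, Set.union_subset ?_ ?_,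
    Or.inl ⟨1, ?_, map_one _⟩, Or.inr ⟨0, γ.source⟩,
    IsPreconnected.union (incl x.elem) ⟨_, hp_elem, rfl⟩ ⟨1, γ.target⟩
      (G.connective.isConnected_preimage.isPreconnected.image _ continuous_incl.continuousOn)
      (isPreconnected_range γ.continuous)⟩
  · rintro - ⟨g, hg, rfl⟩
    have h := O2.continuous_toHomeo.image_connectedComponent_subset 1 (Set.mem_image_of_mem _ hg)
    rwa [map_one] at h
  · rintro - ⟨s, rfl⟩
    have hmem : toHomeo (γ s) ∈ connectedComponent (toHomeo x) :=
      (isPreconnected_range (continuous_homeo.comp γ.continuous)).subset_connectedComponent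
        ⟨0, congrArg homeo γ.source⟩ ⟨s, rfl⟩
    rwa [← connectedComponent_eq hx] at hmem
  · rw [Set.mem_preimage, map_one]
    exact mem_connectedComponent

end RetractPullback

open RetractPullback in
/-- The pullback of `p` along the retraction `Homeo(S¹) → O(2)`, as a planar homeomorphism group of
`G`. -/
def planarHomeoGroup (G : PlanarLieGroup.{u}) : PlanarHomeoGroup G where
  carrier := RetractPullback G
  q := toHomeo
  connective := ⟨isCoveringMap_toHomeo, isConnected_preimage_toHomeo⟩
  incl := incl
  q_incl _ := rfl
  isEmbedding := Function.LeftInverse.isEmbedding (f := fun x : O2 × RetractPullback G => x.2.elem)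
    (fun _ => rfl) (continuous_elem.comp continuous_snd) (continuous_p.prodMk continuous_incl)
  exists_eq A x h := by
    have hA : G.p x.elem = A :=
      x.p_elem.trans ((congrArg retract h.symm).trans (retract_toHomeo A))
    exact ⟨x.elem, hA, ext ((congrArg O2.toHomeo hA).trans h) rfl⟩

end

end PlanarCSG

theorem mainTheorem6 (G : PlanarLieGroup.{u}) :
    Nonempty (PlanarHomeoGroup G) ∧
    ∀ H : PlanarHomeoGroup G,
      (∃ (π : MarkedCircle H ⥤ StructuredSet (DeltaG.incl G))
          (α : π ⋙ StructuredSet.forget (DeltaG.incl G) ≅ MarkedCircle.pi0 H),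
        π.IsEquivalence ∧
        ∀ X : MarkedCircle H,
          ∃ β : (π.obj X).Frame ≃ ZerothHomotopy (X.FrameSpace (π.obj X).n),
            ∀ (f : (π.obj X).Frame) (x : X.FrameSpace (π.obj X).n),
              β f = ZerothHomotopy.mk x →
              (∀ k, (α.hom.app X).hom ((π.obj X).ρ f k) = x.component k) ∧
              ∀ (g : Gen (DeltaG.incl G) (π.obj X).n) (w : G.base) (j : ℤ),
                g.hom = DeltaG.autHom (π.obj X).n w j →
                ∃ y : X.FrameSpace (π.obj X).n,
                  y.1 = X.act x.1 (H.incl (w * G.e (j / ((π.obj X).n + 1)))) ∧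
                  β ((π.obj X).act f g) = ZerothHomotopy.mk y) ∧
      Nonempty (MarkedCircle H ≌ DeltaG G) := by
  refine ⟨⟨planarHomeoGroup G⟩, fun H => ?_⟩
  refine ⟨⟨MarkedCircle.toStructuredSetFunctor H, MarkedCircle.forgetIso H, inferInstance,
    fun X => ⟨Equiv.refl _, ?_⟩⟩, ⟨(MarkedCircle.toStructuredSetFunctor H).asEquivalence.trans
      (StructuredSet.toObject (DeltaG.incl G)).asEquivalence⟩⟩
  rintro _ x rfl
  refine ⟨fun k => rfl, fun g w j hg => ?_⟩
  obtain ⟨y, hy, hclass⟩ := MarkedCircle.exists_eq_act_incl x g w j hg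
  exact ⟨y, hy, MarkedCircle.frameAct_mk hclass⟩
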